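/- Let $1\le k<d$ be integers. Items are finitely many (at least one) axis-parallel $d$-dimensional hypercubes with side lengths $s(i)>0$; for a nonempty item set $\mathcal I$ put $\hat s=\max_{i\in\mathcal I}s(i)$. Items may be translated but not rotated. A $(d-k)$-dimensional grid with boundaries $g_{i,0}<\dots<g_{i,n_i}$ ($n_i\ge1$, $1\le i\le d-k$) is a finite set $A$ of hypercuboids (cells) of the form $\prod_i[g_{i,j_i-1},g_{i,j_i}]$ with $1\le j_i\le n_i$. Let $N\ge 1$ be an integer and let $\alpha\ge1$, $\varepsilon>0$ be real. An admissible instance $(\mathcal I,A,B)$ consists of a nonempty item set $\mathcal I$, a $(d-k)$-dimensional grid $A$ of at most $N$ cells, all of whose side lengths are at most $\alpha\hat s$, and a $(k-1)$-dimensional hypercuboid $B=\prod_{j=1}^{k-1}[0,b_j]$ with $b_j\ge N\alpha^{d-k}\hat s$ for all $j$ (a point if $k=1$), such that each single item of $\mathcal I$ fits on the base $A\times B$. Let $\mathrm{cont}(A,B,h)=\big(\bigcup_{a\in A}a\big)\times B\times[0,h]$, let $B+\hat s=\prod_j[0,b_j+\hat s]$, and let $\mathrm{OPT}_{\mathrm{strip}}(\mathcal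 I,A,B)$ be the minimal $h$ for which $\mathcal I$ can be packed without overlap into $\mathrm{cont}(A,B,h)$. Let a set $Q$ of items be packed in a $d$-dimensional hypercuboid $C$ whose side lengths are $n_1\sigma,\dots,n_d\sigma$ with positive integers $n_j$, where $\sigma>0$ is an upper bound on the side lengths of the items in $Q$. Then $C$ is an $\mathcal N$-Box if, for some such $\sigma,n_1,\dots,n_d$, $|Q|\le\prod_j n_j$; it is a $\mathcal V$-Box if, for some such $\sigma,n_1,\dots,n_d$, $\sum_{i\in Q}s(i)^d\le \mathrm{vol}(C)-\sigma\,\mathrm{surf}(C)/2$, where $\mathrm{surf}(C)$ is the sum of the $(d-1)$-dimensional volumes of the facets of $C$. Theorem. There are a constant $c$ depending only on $k$, and constants $K$ and $M$ depending only on $d,k,\alpha,N,\varepsilon$, such that for every admissible instance $(\mathcal I,A,B)$ all items of $\mathcal I$ can be packed without overlap into $\mathrm{cont}(A,B+\hat s,h)$ for some $$h\le(1+c\,\varepsilon)\,\mathrm{OPT}_{\mathrm{strip}}(\mathcal I,A,B)+K\hat s,$$ and there are at most $M$ pairwise non-overlapping hypercuboids contained in $\mathrm{cont}(A,B+\hat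 s,h)$ such that every item is assigned to, and packed inside, one of them, and each of these hypercuboids, together with the items assigned to it, is an $\mathcal N$-Box or a $\mathcal V$-Box. Moreover, for fixed $d,k,\alpha,N,\varepsilon$ there is an algorithm (a partial recursive function) which, given any admissible instance with rational data, halts and outputs such a packing together with its boxes and the assignment of the items to them, all with rational data and with the same constants $c,K,M$. -/

import Mathlib

noncomputable section

namespace HypercubeStrip

/-- An axis-aligned hypercuboid, given by its lower corner and its side lengths. -/
structure Cuboid (κ : Type) where
  lower : κ → ℝ
  side : κ → ℝ

namespace Cuboid

variable {κ : Type} [Fintype κ] [DecidableEq κ]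

/-- The closed set `∏ j, [lower j, lower j + side j]`. -/
def toSet (C : Cuboid κ) : Set (κ → ℝ) := Set.Icc C.lower (C.lower + C.side)

def vol (C : Cuboid κ) : ℝ := ∏ j, C.side j

/-- The sum of the volumes of all facets. -/
def surf (C : Cuboid κ) : ℝ := 2 * ∑ i, ∏ j ∈ Finset.univ.erase i, C.side j

/-- Two hypercuboids do not overlap: their interiors are disjoint. -/
def NonOverlapping (C D : Cuboid κ) : Prop := Disjoint (interior C.toSet) (interior D.toSet)

end Cuboid

/-- The hypercube of side length `s` with lower corner `p`. -/
def cube {κ : Type} (p : κ → ℝ) (s : ℝ) : Cuboid κ := ⟨p, fun _ => s⟩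

/-- `pos` places hypercubes of side lengths `size` without overlap into the region `R`. -/
def IsPacking {κ : Type} {n : ℕ} (size : Fin n → ℝ) (pos : Fin n → κ → ℝ)
    (R : Set (κ → ℝ)) : Prop :=
  (∀ i, (cube (pos i) (size i)).toSet ⊆ R) ∧
    ∀ i j, i ≠ j → (cube (pos i) (size i)).NonOverlapping (cube (pos j) (size j))

section Boxes

variable {κ : Type} [Fintype κ] [DecidableEq κ] {n : ℕ}

/-- `σ` bounds the sizes of the items in `Q`, and the side lengths of `C` are the positive
multiples `c j * σ` of `σ`. -/
def HasBoxSides (size : Fin n → ℝ) (Q : Finset (Fin n)) (C : Cuboid κ) (σ : ℝ)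
    (c : κ → ℕ) : Prop :=
  0 < σ ∧ (∀ i ∈ Q, size i ≤ σ) ∧ ∀ j, 0 < c j ∧ C.side j = c j * σ

/-- `C`, holding the items in `Q`, is an N-Box. -/
def IsNBox (size : Fin n → ℝ) (Q : Finset (Fin n)) (C : Cuboid κ) : Prop :=
  ∃ (σ : ℝ) (c : κ → ℕ), HasBoxSides size Q C σ c ∧ Q.card ≤ ∏ j, c j

/-- `C`, holding the items in `Q`, is a V-Box. -/
def IsVBox (size : Fin n → ℝ) (Q : Finset (Fin n)) (C : Cuboid κ) : Prop :=
  ∃ (σ : ℝ) (c : κ → ℕ), HasBoxSides size Q C σ c ∧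
    ∑ i ∈ Q, size i ^ Fintype.card κ ≤ C.vol - σ * (C.surf / 2)

end Boxes

/-- The data of an `m`-dimensional grid: in dimension `i` there are `layers i` layers with
boundaries `bdry i 0 < ⋯ < bdry i (layers i)` (the other values of `bdry i` are irrelevant),
and `cells` is the set of the index tuples of the cells that belong to the grid. -/
structure Grid (m : ℕ) where
  layers : Fin m → ℕ
  bdry : Fin m → ℕ → ℝ
  cells : Finset (Fin m → ℕ)

namespace Grid

variable {m : ℕ}

def IsGrid (A : Grid m) : Prop :=
  (∀ i, 0 < A.layers i) ∧ (∀ i, StrictMonoOn (A.bdry i) (Set.Iic (A.layers i))) ∧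
    ∀ c ∈ A.cells, ∀ i, c i < A.layers i

/-- The cell `∏ i, [bdry i (c i), bdry i (c i + 1)]`. -/
def cell (A : Grid m) (c : Fin m → ℕ) : Cuboid (Fin m) :=
  ⟨fun i => A.bdry i (c i), fun i => A.bdry i (c i + 1) - A.bdry i (c i)⟩

/-- The union of the cells. -/
def region (A : Grid m) : Set (Fin m → ℝ) := ⋃ c ∈ A.cells, (A.cell c).toSet

end Grid

/-- The coordinates of the strip: `m` short ones, `q` long ones, and the height. -/
abbrev Coord (m q : ℕ) : Type := Fin m ⊕ Fin q ⊕ Unit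

/-- The region `(⋃ a ∈ A, a) × (∏ j, [0, b j]) × [0, h]`. -/
def container {m q : ℕ} (A : Grid m) (b : Fin q → ℝ) (h : ℝ) : Set (Coord m q → ℝ) :=
  {x | (fun i => x (Sum.inl i)) ∈ A.region ∧
    (fun j => x (Sum.inr (Sum.inl j))) ∈ Set.Icc 0 b ∧ x (Sum.inr (Sum.inr ())) ∈ Set.Icc 0 h}

/-- The data of a strip packing instance: `n` hypercubes with the given sizes, the grid `A`, and
the side lengths `b` of the hypercuboid `B`. -/
structure StripInstance (m q : ℕ) where
  n : ℕ
  size : Fin n → ℝ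
  A : Grid m
  b : Fin q → ℝ

namespace StripInstance

variable {m q : ℕ}

/-- The largest side length of an item. -/
def maxSize (I : StripInstance m q) : ℝ := ⨆ i, I.size i

/-- The input conditions: there are items, and all have positive size; `A` is a grid of at most
`N` cells, each of whose sides has length at most `α ŝ`; each side of `B` has length at least
`N α^m ŝ`; and every single item can be placed on the base `A × B`. -/
structure IsAdmissible (I : StripInstance m q) (N : ℕ) (α : ℝ) : Prop where
  nonempty : 0 < I.n
  size_pos : ∀ i, 0 < I.size i
  isGrid : I.A.IsGrid
  card_cells : I.A.cells.card ≤ N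
  short : ∀ c ∈ I.A.cells, ∀ i, (I.A.cell c).side i ≤ α * I.maxSize
  long : ∀ j, N * α ^ m * I.maxSize ≤ I.b j
  fits : ∀ i, ∃ p : Coord m q → ℝ,
    (cube p (I.size i)).toSet ⊆ container I.A I.b (I.size i)

/-- The minimal height `h` such that all items can be packed into the container over the base
`A × B` of height `h`. -/
def opt (I : StripInstance m q) : ℝ :=
  sInf {h | ∃ pos : Fin I.n → Coord m q → ℝ, IsPacking I.size pos (container I.A I.b h)}

end StripInstance

/-- A packing of `n` items together with a list of boxes: item `i` has its lower corner at
`pos i` and is assigned to the box with number `boxOf i`. -/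
structure BoxedPacking (m q n : ℕ) where
  height : ℝ
  boxes : List (Cuboid (Coord m q))
  boxOf : Fin n → ℕ
  pos : Fin n → Coord m q → ℝ

/-- All items are packed into the container over the base `A × (B + ŝ)` whose height is that of
the packing; the boxes lie in this container and do not overlap; every item lies in the box it is
assigned to; and every box, with the items assigned to it, is an N-Box or a V-Box. -/
structure IsValidFor {m q : ℕ} (I : StripInstance m q) (P : BoxedPacking m q I.n) : Prop where
  packing : IsPacking I.size P.pos (container I.A (fun j => I.b j + I.maxSize) P.height)
  boxes_subset : ∀ C ∈ P.boxes,
    C.toSet ⊆ container I.A (fun j => I.b j + I.maxSize) P.height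
  boxes_nonOverlapping : P.boxes.Pairwise Cuboid.NonOverlapping
  item_in_box : ∀ i, ∃ h : P.boxOf i < P.boxes.length,
    (cube (P.pos i) (I.size i)).toSet ⊆ P.boxes[P.boxOf i].toSet
  box_type : ∀ (t : ℕ) (h : t < P.boxes.length),
    IsNBox I.size {i | P.boxOf i = t} P.boxes[t] ∨ IsVBox I.size {i | P.boxOf i = t} P.boxes[t]

/-- `P` is a packing of all items of `I` over the base `A × (B + ŝ)` into at most `M` N-Boxes and
V-Boxes, of height at most `(1 + δ) OPT + C ŝ`. -/
def IsGoodPacking {m q : ℕ} (I : StripInstance m q) (δ C : ℝ) (M : ℕ)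
    (P : BoxedPacking m q I.n) : Prop :=
  IsValidFor I P ∧ P.boxes.length ≤ M ∧ P.height ≤ (1 + δ) * I.opt + C * I.maxSize

/-! ### Finite descriptions of rational instances and packings, for use by an algorithm -/

/-- A rational instance, all of whose numbers are written with one common denominator `D + 1`:
`D`, the numerators of the item sizes, the numerators of the grid boundaries in each dimension,
the index tuples of the grid cells, the numerators of the side lengths of `B`. -/
abbrev InstanceCode (m q : ℕ) : Type :=
  ℕ × List ℕ × (Fin m → List ℤ) × List (Fin m → ℕ) × (Fin q → ℕ)

/-- The numerators of the coordinates of a rational point. -/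
abbrev PointCode (m q : ℕ) : Type := (Fin m → ℤ) × (Fin q → ℤ) × ℤ

/-- A rational packing, all of whose numbers are written with one common denominator `D + 1`:
`D`, the numerator of the height, the lower corners and the side lengths of the boxes, and, for
every item, the number of its box and its lower corner. -/
abbrev PackingCode (m q : ℕ) : Type :=
  ℕ × ℕ × List (PointCode m q × PointCode m q) × List (ℕ × PointCode m q)

def decodeInstance {m q : ℕ} : InstanceCode m q → StripInstance m q
  | (D, sizes, bdry, cells, b) =>
    { n := sizes.length
      size := fun i => (sizes[i] : ℝ) / (D + 1)
      A :=
        { layers := fun i => (bdry i).length - 1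
          bdry := fun i j => ((bdry i).getD j 0 : ℝ) / (D + 1)
          cells := cells.toFinset }
      b := fun j => (b j : ℝ) / (D + 1) }

def decodePoint {m q : ℕ} (D : ℕ) : PointCode m q → Coord m q → ℝ
  | (x, y, z) => Sum.elim (fun i => (x i : ℝ) / (D + 1))
      (Sum.elim (fun j => (y j : ℝ) / (D + 1)) fun _ => (z : ℝ) / (D + 1))

def decodePacking {m q : ℕ} (n : ℕ) : PackingCode m q → BoxedPacking m q n
  | (D, h, boxes, items) =>
    { height := (h : ℝ) / (D + 1)
      boxes := boxes.map fun C => ⟨decodePoint D C.1, decodePoint D C.2⟩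
      boxOf := fun i => (items.getD i (0, 0, 0, 0)).1
      pos := fun i => decodePoint D (items.getD i (0, 0, 0, 0)).2 }

end HypercubeStrip

end

open HypercubeStrip

noncomputable section

namespace HypercubeStrip

/-! ### Packing items into a hypercuboid -/

/-! Let `m = d - k` be the number of short coordinates, `q = k - 1` the number of long ones, `S` the
largest item size and `β` the volume of `B`. A packing of height `h` has, over every point of `B ×
[0, h]`, a section: a set `J` of items whose projections are disjoint cubes in the grid. If `x J` is
the measure of the set of points with section `J`, then every item has total measure `s(i)^(q+1)`
and the `x J` sum to `β h` (`IsPacking.exists_sections`). This is a fractional solution of a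
configuration problem. Conversely, a section used with measure `y` becomes a slab of height `y/β +
S` made of columns over its cubes; the extra `S` in the height and in the long directions absorbs
the rounding to whole numbers of items (`le_columnCapacity`).

To bound the number of slabs, items are split at `μ S < δ S` into small, medium and large ones. The
large items are grouped linearly. At most `P` of them lie in one section, so there are at most
`(P+1)^G` types of sections, and one representative per type suffices (`exists_representatives`).
The places of each group receive the next group, whose items are no larger, in N-Boxes
(`exists_slots`); the first group gets a box of its own. The rest of the base of a slab is cut into
cubes of side `θ S` (`exists_free_cubes`), and small items fill the columns over these as V-Boxes
(`exists_fill`), by a layer packing in the style of Meir and Moser (`exists_packs_of_height`). The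
remaining small items and the medium items go into one more V-Box. Pigeonhole over finitely many
scales finds `δ` and `μ` for which the medium items have little volume
(`exists_boxable_of_sections`).

For the algorithm it matters that the box sides are multiples of item sizes. After multiplication by
the common denominator all lengths are integers, so rounding every coordinate down keeps a packing
valid (`Boxable.exists_isPlan`). Validity of an integral packing is a primitive recursive predicate
with bounded data, and a search for the least height (`exists_partrec_minimal`) does at least as
well as the packing shown to exist. -/

/-- Two hypercuboids are separated along some coordinate axis. -/
def Cuboid.Separated {κ : Type} (C D : Cuboid κ) : Prop :=
  ∃ j, C.lower j + C.side j ≤ D.lower j ∨ D.lower j + D.side j ≤ C.lower j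

theorem Cuboid.Separated.symm {κ : Type} {C D : Cuboid κ} (h : C.Separated D) :
    D.Separated C := by
  obtain ⟨j, hj⟩ := h
  exact ⟨j, hj.symm⟩

/-- A separated pair stays separated when both members shrink. -/
theorem Cuboid.Separated.mono {κ : Type} {C D C' D' : Cuboid κ} (h : C.Separated D)
    (hC : ∀ j, C.lower j ≤ C'.lower j ∧ C'.lower j + C'.side j ≤ C.lower j + C.side j)
    (hD : ∀ j, D.lower j ≤ D'.lower j ∧ D'.lower j + D'.side j ≤ D.lower j + D.side j) :
    C'.Separated D' := by
  obtain ⟨j, hj⟩ := h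
  have h1 := hC j
  have h2 := hD j
  exact ⟨j, hj.imp (fun h => by linarith) (fun h => by linarith)⟩

theorem Cuboid.interior_toSet {κ : Type} [Fintype κ] (C : Cuboid κ) :
    interior C.toSet = Set.univ.pi fun j => Set.Ioo (C.lower j) (C.lower j + C.side j) := by
  rw [Cuboid.toSet, ← Set.pi_univ_Icc, interior_pi_set Set.finite_univ]
  simp [interior_Icc]

theorem Cuboid.Separated.nonOverlapping {κ : Type} [Fintype κ] {C D : Cuboid κ}
    (h : C.Separated D) : C.NonOverlapping D := by
  obtain ⟨j, hj⟩ := h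
  rw [Cuboid.NonOverlapping, Cuboid.interior_toSet, Cuboid.interior_toSet, Set.disjoint_left]
  intro x hx hy
  have h1 := hx j (Set.mem_univ j)
  have h2 := hy j (Set.mem_univ j)
  rcases hj with hj | hj <;> linarith [h1.1, h1.2, h2.1, h2.2]

/-- If no axis separates them, the side intervals overlap in every coordinate, and the midpoints of
the overlaps form a point of both interiors. Positive sides are needed to make the overlaps
nondegenerate. -/
theorem Cuboid.NonOverlapping.separated {κ : Type} [Fintype κ] {C D : Cuboid κ}
    (h : C.NonOverlapping D) (hC : ∀ j, 0 < C.side j) (hD : ∀ j, 0 < D.side j) :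
    C.Separated D := by
  by_contra hcon
  simp only [Cuboid.Separated, not_exists, not_or, not_le] at hcon
  rw [Cuboid.NonOverlapping, Cuboid.interior_toSet, Cuboid.interior_toSet,
    Set.disjoint_left] at h
  refine h (a := fun j => (max (C.lower j) (D.lower j) +
    min (C.lower j + C.side j) (D.lower j + D.side j)) / 2) (fun j _ => ?_) (fun j _ => ?_) <;>
  · have h1 := hcon j
    have h2 := hC j
    have h3 := hD j
    have : max (C.lower j) (D.lower j) < min (C.lower j + C.side j) (D.lower j + D.side j) := by
      simp only [max_lt_iff, lt_min_iff]
      refine ⟨⟨?_, ?_⟩, ?_, ?_⟩ <;> linarith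
    have h4 := le_max_left (C.lower j) (D.lower j)
    have h5 := le_max_right (C.lower j) (D.lower j)
    have h6 := min_le_left (C.lower j + C.side j) (D.lower j + D.side j)
    have h7 := min_le_right (C.lower j + C.side j) (D.lower j + D.side j)
    constructor <;> linarith

theorem Cuboid.mem_toSet {κ : Type} {C : Cuboid κ} {x : κ → ℝ} :
    x ∈ C.toSet ↔ ∀ j, C.lower j ≤ x j ∧ x j ≤ C.lower j + C.side j := by
  simp only [Cuboid.toSet, Set.mem_Icc, Pi.le_def, Pi.add_apply, forall_and]

theorem Cuboid.toSet_subset {κ : Type} {C D : Cuboid κ}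
    (h : ∀ j, D.lower j ≤ C.lower j ∧ C.lower j + C.side j ≤ D.lower j + D.side j) :
    C.toSet ⊆ D.toSet := by
  intro x hx
  rw [Cuboid.mem_toSet] at hx ⊢
  exact fun j => ⟨(h j).1.trans (hx j).1, (hx j).2.trans (h j).2⟩

section Packs

variable {κ : Type} {n : ℕ}

/-- `pos` places the items in `Q` without overlap into `C`. -/
def Packs (size : Fin n → ℝ) (Q : Finset (Fin n)) (C : Cuboid κ) (pos : Fin n → κ → ℝ) : Prop :=
  (∀ i ∈ Q, ∀ j, C.lower j ≤ pos i j ∧ pos i j + size i ≤ C.lower j + C.side j) ∧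
    ∀ i ∈ Q, ∀ i' ∈ Q, i ≠ i' → (cube (pos i) (size i)).Separated (cube (pos i') (size i'))

theorem Packs.mono {size : Fin n → ℝ} {Q Q' : Finset (Fin n)} {C : Cuboid κ}
    {pos : Fin n → κ → ℝ} (h : Packs size Q C pos) (hQ : Q' ⊆ Q) : Packs size Q' C pos :=
  ⟨fun i hi => h.1 i (hQ hi), fun i hi i' hi' => h.2 i (hQ hi) i' (hQ hi')⟩

variable [Fintype κ] [DecidableEq κ]

/-- Items of side length at most `σ` can be packed into the cells of a regular grid. -/
theorem exists_packs_of_card_le (size : Fin n → ℝ) (Q : Finset (Fin n)) (C : Cuboid κ) (σ : ℝ)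
    (hσ : 0 ≤ σ) (c : κ → ℕ) (hs : ∀ i ∈ Q, size i ≤ σ) (hC : ∀ j, c j * σ ≤ C.side j)
    (hcard : Q.card ≤ ∏ j, c j) : ∃ pos, Packs size Q C pos := by
  classical
  obtain ⟨⟨f, hf⟩⟩ : Nonempty (Q ↪ (∀ j, Fin (c j))) := by
    apply Function.Embedding.nonempty_of_card_le
    simpa using hcard
  refine ⟨fun i j => C.lower j + (if h : i ∈ Q then ((f ⟨i, h⟩ j : ℕ) : ℝ) else 0) * σ, ?_, ?_⟩
  · intro i hi j
    simp only [hi, dif_pos]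
    have h1 : ((f ⟨i, hi⟩ j : ℕ) : ℝ) + 1 ≤ c j := by exact_mod_cast (f ⟨i, hi⟩ j).2
    have h2 := hs i hi
    have h3 := hC j
    have h4 : 0 ≤ ((f ⟨i, hi⟩ j : ℕ) : ℝ) := Nat.cast_nonneg _
    constructor <;> nlinarith
  · intro i hi i' hi' hne
    have hne' : f ⟨i, hi⟩ ≠ f ⟨i', hi'⟩ := fun h => hne (by simpa using hf h)
    obtain ⟨j, hj⟩ := Function.ne_iff.1 hne'
    refine ⟨j, ?_⟩
    simp only [cube, hi, hi', dif_pos]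
    have h1 := hs i hi
    have h2 := hs i' hi'
    rcases lt_or_gt_of_ne hj with h | h
    · left
      have : ((f ⟨i, hi⟩ j : ℕ) : ℝ) + 1 ≤ (f ⟨i', hi'⟩ j : ℕ) := by exact_mod_cast h
      nlinarith
    · right
      have : ((f ⟨i', hi'⟩ j : ℕ) : ℝ) + 1 ≤ (f ⟨i, hi⟩ j : ℕ) := by exact_mod_cast h
      nlinarith

/-- The `c` largest items of `Q`. -/
theorem exists_largest_subset (size : Fin n → ℝ) (Q : Finset (Fin n)) (c : ℕ) (hc : c ≤ Q.card) :
    ∃ Q₁ ⊆ Q, Q₁.card = c ∧ ∀ i ∈ Q₁, ∀ i' ∈ Q \ Q₁, size i' ≤ size i := by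
  classical
  induction c with
  | zero => exact ⟨∅, by simp, by simp, by simp⟩
  | succ c ih =>
    obtain ⟨Q₁, h1, h2, h3⟩ := ih (by omega)
    have hne : (Q \ Q₁).Nonempty := by
      rw [← Finset.card_pos, Finset.card_sdiff_of_subset h1]
      omega
    obtain ⟨a, ha, hmax⟩ := Finset.exists_max_image _ size hne
    have ha' := Finset.mem_sdiff.1 ha
    refine ⟨insert a Q₁, Finset.insert_subset ha'.1 h1, ?_, ?_⟩
    · rw [Finset.card_insert_of_notMem ha'.2, h2]
    · intro i hi i' hi'
      have hi'2 : i' ∈ Q \ Q₁ := by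
        simp only [Finset.mem_sdiff, Finset.mem_insert, not_or] at hi' ⊢
        exact ⟨hi'.1, hi'.2.2⟩
      rcases Finset.mem_insert.1 hi with rfl | hi
      · exact hmax _ hi'2
      · exact h3 i hi i' hi'2

/-- The items are packed in layers along the axis `e`: if the largest remaining item has size `h`, a
layer of height `h` takes as many of the largest items as a regular grid of `h`-cubes offers. The
term `σ / η` is a potential that pays for layers in which the sizes drop sharply; all other layers
are paid for by the volume they hold. -/
theorem exists_packs_of_height (size : Fin n → ℝ) (hpos : ∀ i, 0 < size i) (e : κ) (a : κ → ℝ)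
    (η : ℝ) (hη : 0 < η) (hη1 : η < 1) (Q : Finset (Fin n)) :
    ∀ (σ : ℝ) (l : κ → ℝ) (H : ℝ), 0 ≤ σ → (∀ i ∈ Q, size i ≤ σ) → (∀ j, j ≠ e → σ ≤ η * a j) →
      (∀ j, j ≠ e → 0 < a j) →
      σ / η + (∑ i ∈ Q, size i ^ Fintype.card κ) /
        ((1 - η) ^ (2 * Fintype.card κ) * ∏ j ∈ Finset.univ.erase e, a j) ≤ H →
      ∃ pos, Packs size Q ⟨l, Function.update a e H⟩ pos := by
  classical
  set d := Fintype.card κ with hd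
  have hd1 : (Finset.univ.erase e).card = d - 1 := by
    rw [Finset.card_erase_of_mem (Finset.mem_univ e), Finset.card_univ]
  have hd0 : 0 < d := Fintype.card_pos_iff.2 ⟨e⟩
  induction hN : Q.card using Nat.strong_induction_on generalizing Q with
  | _ N ih =>
  intro σ l H hσ hs ha ha0 hH
  set A := ∏ j ∈ Finset.univ.erase e, a j with hA
  have hApos : 0 < A := Finset.prod_pos fun j hj => ha0 j (Finset.ne_of_mem_erase hj)
  have h1η : 0 < 1 - η := by linarith
  set W := (1 - η) ^ (2 * d) * A with hW
  have hWpos : 0 < W := by positivity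
  rcases Q.eq_empty_or_nonempty with rfl | hne
  · exact ⟨fun _ => l, by simp [Packs]⟩
  obtain ⟨i0, hi0, hmax⟩ := Finset.exists_max_image Q size hne
  set h := size i0 with hh
  have hh0 : 0 < h := hpos i0
  have hhσ : h ≤ σ := hs i0 hi0
  have hσ0 : 0 < σ := hh0.trans_le hhσ
  have hση : σ ≤ σ / η := by rw [le_div_iff₀ hη]; nlinarith
  have hsum0 : ∀ R : Finset (Fin n), 0 ≤ (∑ i ∈ R, size i ^ d) / W := fun R =>
    div_nonneg (Finset.sum_nonneg fun i _ => pow_nonneg (hpos i).le _) hWpos.le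
  have hhH : h ≤ H := by linarith [hsum0 Q]
  set c : κ → ℕ := fun j => if j = e then 1 else ⌊a j / h⌋₊ with hc
  have hch : ∀ H', h ≤ H' → ∀ j, c j * h ≤ Function.update a e H' j := by
    intro H' hH' j
    by_cases hj : j = e
    · subst hj; simpa [hc] using hH'
    · simp only [hc, hj, if_false, Function.update_of_ne, ne_eq, not_false_eq_true]
      calc (⌊a j / h⌋₊ : ℝ) * h ≤ a j / h * h := by
            gcongr
            exact Nat.floor_le (div_nonneg (ha0 j hj).le hh0.le)
        _ = a j := by field_simp
  by_cases hcard : Q.card ≤ ∏ j, c j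
  · exact exists_packs_of_card_le size Q _ h hh0.le c (fun i hi => hmax i hi) (hch H hhH) hcard
  obtain ⟨Q₁, hQ1, hQc, hQs⟩ := exists_largest_subset size Q (∏ j, c j) (by omega)
  obtain ⟨pos₁, hp1⟩ := exists_packs_of_card_le size Q₁ ⟨l, Function.update a e h⟩ h hh0.le c
    (fun i hi => hmax i (hQ1 hi)) (hch h le_rfl) hQc.le
  have hR : (Q \ Q₁).Nonempty := by
    rw [← Finset.card_pos, Finset.card_sdiff_of_subset hQ1]
    omega
  obtain ⟨i1, hi1, hmax1⟩ := Finset.exists_max_image _ size hR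
  set h' := size i1 with hh'
  have hh'0 : 0 < h' := hpos i1
  have hh'h : h' ≤ h := hmax i1 (Finset.mem_sdiff.1 hi1).1
  have hprod : (1 - η) ^ (d - 1) * A ≤ (∏ j, c j : ℕ) * h ^ (d - 1) := by
    rw [← Finset.mul_prod_erase _ _ (Finset.mem_univ e)]
    simp only [hc, if_true, one_mul]
    rw [Nat.cast_prod, hA, ← hd1, ← Finset.prod_const, ← Finset.prod_const,
      ← Finset.prod_mul_distrib, ← Finset.prod_mul_distrib]
    apply Finset.prod_le_prod
    · intro j hj
      exact mul_nonneg h1η.le (ha0 j (Finset.ne_of_mem_erase hj)).le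
    · intro j hj
      have hj' := Finset.ne_of_mem_erase hj
      simp only [hj', if_false]
      have h2 := Nat.lt_floor_add_one (a j / h)
      rw [div_lt_iff₀ hh0] at h2
      have h3 := ha j hj'
      nlinarith
  have hcpos : 0 < ∏ j, c j := by
    by_contra hcon
    have : (∏ j, c j : ℕ) = 0 := by omega
    rw [this] at hprod
    have : 0 < (1 - η) ^ (d - 1) * A := by positivity
    simp at hprod
    linarith
  have hsplit : ∑ i ∈ Q, size i ^ d = ∑ i ∈ Q₁, size i ^ d + ∑ i ∈ Q \ Q₁, size i ^ d := by
    rw [add_comm, Finset.sum_sdiff hQ1]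
  have hH' : h' / η + (∑ i ∈ Q \ Q₁, size i ^ d) / W ≤ H - h := by
    rw [hsplit, add_div] at hH
    have h5 : h / η ≤ σ / η := by gcongr
    by_cases hcase : (1 - η) * h ≤ h'
    -- Here all items of the layer are at least `(1 - η) h`, so the layer is densely filled and its
    -- volume accounts for its height `h`. In the other case `h' < (1 - η) h`, and the potential
    -- drops by at least `h`.
    · have hV : h ≤ (∑ i ∈ Q₁, size i ^ d) / W := by
        rw [le_div_iff₀ hWpos]
        calc h * W = (1 - η) ^ d * h * ((1 - η) ^ (d - 1) * A) * (1 - η) := by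
              rw [hW]
              have : 2 * d = d + (d - 1) + 1 := by omega
              rw [this, pow_add, pow_add]; ring
          _ ≤ (1 - η) ^ d * h * ((1 - η) ^ (d - 1) * A) * 1 := by
              gcongr; linarith
          _ ≤ (1 - η) ^ d * h * ((∏ j, c j : ℕ) * h ^ (d - 1)) * 1 := by gcongr
          _ = (∏ j, c j : ℕ) * ((1 - η) * h) ^ d := by
              have : h ^ d = h ^ (d - 1) * h := by rw [← pow_succ]; congr 1; omega
              rw [mul_pow, this]; ring
          _ ≤ (∏ j, c j : ℕ) * h' ^ d := by gcongr
          _ = ∑ i ∈ Q₁, h' ^ d := by rw [Finset.sum_const, hQc, nsmul_eq_mul]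
          _ ≤ ∑ i ∈ Q₁, size i ^ d := by
              apply Finset.sum_le_sum
              intro i hi
              have := hQs i hi i1 hi1
              gcongr
      have h6 : h' / η ≤ h / η := by gcongr
      linarith
    · push Not at hcase
      have h6 : h' / η ≤ h / η - h := by
        have : h' / η ≤ ((1 - η) * h) / η := by gcongr
        refine this.trans (le_of_eq ?_)
        field_simp
      linarith [hsum0 Q₁]
  obtain ⟨pos₂, hp2⟩ := ih _ (by
      rw [← hN]
      apply Finset.card_lt_card
      refine ⟨Finset.sdiff_subset, fun hsub => ?_⟩
      obtain ⟨b, hb⟩ : Q₁.Nonempty := by rw [← Finset.card_pos, hQc]; exact hcpos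
      exact (Finset.mem_sdiff.1 (hsub (hQ1 hb))).2 hb) (Q \ Q₁) rfl h' (Function.update l e (l e + h))
    (H - h) hh'0.le hmax1 (fun j hj => (hh'h.trans hhσ).trans (ha j hj)) ha0 hH'
  have hp1e : ∀ i ∈ Q₁, pos₁ i e + size i ≤ l e + h := fun i hi => by
    simpa using (hp1.1 i hi e).2
  have hp2e : ∀ i ∈ Q \ Q₁, l e + h ≤ pos₂ i e := fun i hi => by
    simpa using (hp2.1 i hi e).1
  refine ⟨fun i => if i ∈ Q₁ then pos₁ i else pos₂ i, ?_, ?_⟩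
  · intro i hi j
    by_cases h1 : i ∈ Q₁
    · simp only [h1, if_true]
      have := hp1.1 i h1 j
      by_cases hj : j = e
      · subst hj
        simp only [Function.update_self] at this ⊢
        exact ⟨this.1, this.2.trans (by linarith)⟩
      · simpa [hj] using this
    · simp only [h1, if_false]
      have := hp2.1 i (Finset.mem_sdiff.2 ⟨hi, h1⟩) j
      by_cases hj : j = e
      · subst hj
        simp only [Function.update_self] at this ⊢
        constructor <;> linarith
      · simpa [hj] using this
  · intro i hi i' hi' hne
    by_cases h1 : i ∈ Q₁ <;> by_cases h2 : i' ∈ Q₁ <;> simp only [h1, h2, if_true, if_false]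
    · exact hp1.2 i h1 i' h2 hne
    · refine ⟨e, Or.inl ?_⟩
      exact (hp1e i h1).trans (hp2e i' (Finset.mem_sdiff.2 ⟨hi', h2⟩))
    · refine ⟨e, Or.inr ?_⟩
      exact (hp1e i' h2).trans (hp2e i (Finset.mem_sdiff.2 ⟨hi, h1⟩))
    · exact hp2.2 i (Finset.mem_sdiff.2 ⟨hi, h1⟩) i' (Finset.mem_sdiff.2 ⟨hi', h2⟩) hne

/-- A hypercuboid all of whose sides are large multiples of `σ` can be filled up to a fraction
close to one with items of side length at most `σ`. -/
theorem exists_packs_of_sum_le (size : Fin n → ℝ) (hpos : ∀ i, 0 < size i) (e : κ)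
    (η : ℝ) (hη : 0 < η) (hη1 : η < 1) (Q : Finset (Fin n)) (C : Cuboid κ) (σ : ℝ) (c : κ → ℕ)
    (hC : HasBoxSides size Q C σ c) (hc : ∀ j, 1 ≤ η ^ 2 * c j)
    (hV : ∑ i ∈ Q, size i ^ Fintype.card κ ≤ (1 - (2 * Fintype.card κ + 1) * η) * C.vol) :
    (∃ pos, Packs size Q C pos) ∧
      ∑ i ∈ Q, size i ^ Fintype.card κ ≤ C.vol - σ * (C.surf / 2) := by
  obtain ⟨hσ, hs, hside⟩ := hC
  set d := Fintype.card κ with hd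
  have h1η : 0 < 1 - η := by linarith
  have hσside : ∀ j, σ ≤ η ^ 2 * C.side j := fun j => by
    rw [(hside j).2]
    nlinarith [hc j]
  have hsidepos : ∀ j, 0 < C.side j := fun j => by
    rw [(hside j).2]
    have : (0 : ℝ) < c j := by exact_mod_cast (hside j).1
    positivity
  have hvol0 : 0 < C.vol := Finset.prod_pos fun j _ => hsidepos j
  have hvole : ∀ i, C.side i * ∏ j ∈ Finset.univ.erase i, C.side j = C.vol := fun i =>
    Finset.mul_prod_erase _ _ (Finset.mem_univ i)
  have herase0 : ∀ i, 0 < ∏ j ∈ Finset.univ.erase i, C.side j := fun i =>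
    Finset.prod_pos fun j _ => hsidepos j
  constructor
  · have := exists_packs_of_height size hpos e C.side η hη hη1 Q σ C.lower (C.side e) hσ.le hs
      (fun j _ => (hσside j).trans (by
        have := hsidepos j
        have : η ^ 2 ≤ η := by nlinarith
        gcongr)) (fun j _ => hsidepos j) ?_
    · simpa using this
    · have hW : 0 < (1 - η) ^ (2 * d) * ∏ j ∈ Finset.univ.erase e, C.side j :=
        mul_pos (by positivity) (herase0 e)
      -- After cancelling `(1 - η)^(2d)`, one factor `1 - η` remains: the volume term uses a share
      -- `1 - η` of the height, and the share `η` is left for the term `σ / η`.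
      have hbern : 1 - (2 * d + 1) * η ≤ (1 - η) ^ (2 * d + 1) := by
        have := one_add_mul_le_pow (a := -η) (by linarith) (2 * d + 1)
        push_cast at this
        rw [← sub_eq_add_neg] at this
        linarith
      have h1 : σ / η ≤ η * C.side e := by
        rw [div_le_iff₀ hη]
        nlinarith [hσside e]
      have h2 : (∑ i ∈ Q, size i ^ d) / ((1 - η) ^ (2 * d) * ∏ j ∈ Finset.univ.erase e, C.side j)
          ≤ (1 - η) * C.side e := by
        rw [div_le_iff₀ hW]
        calc _ ≤ (1 - (2 * d + 1) * η) * C.vol := hV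
          _ ≤ (1 - η) ^ (2 * d + 1) * C.vol := by gcongr
          _ = _ := by rw [← hvole e, pow_succ]; ring
      linarith
  · have hsurf : σ * (C.surf / 2) ≤ d * (η ^ 2 * C.vol) := by
      rw [Cuboid.surf, mul_div_cancel_left₀ _ (two_ne_zero), Finset.mul_sum]
      calc _ ≤ ∑ i : κ, η ^ 2 * C.vol := by
            apply Finset.sum_le_sum
            intro i _
            rw [← hvole i, ← mul_assoc]
            exact mul_le_mul_of_nonneg_right (hσside i) (herase0 i).le
        _ = _ := by rw [Finset.sum_const, Finset.card_univ, nsmul_eq_mul]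
    have : η ^ 2 ≤ η := by nlinarith
    have h3 : (d : ℝ) * (η ^ 2 * C.vol) ≤ d * (η * C.vol) := by gcongr
    have h4 : 0 ≤ (d : ℝ) * (η * C.vol) := by positivity
    have h5 : 0 ≤ η * C.vol := by positivity
    nlinarith

end Packs

/-! ### Packings into boxes -/

section Boxable

variable {m q : ℕ}

/-- The items of `Q` can be packed into `C`, and `C` becomes an N-Box or a V-Box whose side lengths
are multiples of the size of an item. -/
def GoodBox {κ : Type} [Fintype κ] [DecidableEq κ] {n : ℕ} (size : Fin n → ℝ)
    (Q : Finset (Fin n)) (C : Cuboid κ) : Prop :=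
  (∃ i₀ c, HasBoxSides size Q C (size i₀) c ∧ (Q.card ≤ ∏ j, c j ∨
    ∑ i ∈ Q, size i ^ Fintype.card κ ≤ C.vol - size i₀ * (C.surf / 2))) ∧
    ∃ pos, Packs size Q C pos

theorem GoodBox.mono {κ : Type} [Fintype κ] [DecidableEq κ] {n : ℕ} {size : Fin n → ℝ}
    (hpos : ∀ i, 0 < size i) {Q Q' : Finset (Fin n)} {C : Cuboid κ} (h : GoodBox size Q C)
    (hQ : Q' ⊆ Q) : GoodBox size Q' C := by
  obtain ⟨⟨i₀, c, ⟨h1, h2, h3⟩, h4⟩, pos, h5⟩ := h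
  refine ⟨⟨i₀, c, ⟨h1, fun i hi => h2 i (hQ hi), h3⟩, ?_⟩, pos, h5.mono hQ⟩
  refine h4.imp (fun h => (Finset.card_le_card hQ).trans h) (fun h => le_trans ?_ h)
  exact Finset.sum_le_sum_of_subset_of_nonneg hQ fun i _ _ => pow_nonneg (hpos i).le _

theorem GoodBox.side_pos {κ : Type} [Fintype κ] [DecidableEq κ] {n : ℕ} {size : Fin n → ℝ}
    {Q : Finset (Fin n)} {C : Cuboid κ} (h : GoodBox size Q C) (j : κ) : 0 < C.side j := by
  obtain ⟨⟨i₀, c, ⟨h1, h2, h3⟩, h4⟩, pos, h5⟩ := h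
  rw [(h3 j).2]
  have : (0 : ℝ) < c j := by exact_mod_cast (h3 j).1
  positivity

/-- The projection of a hypercuboid to the short coordinates. -/
def Cuboid.short (C : Cuboid (Coord m q)) : Cuboid (Fin m) :=
  ⟨fun i => C.lower (Sum.inl i), fun i => C.side (Sum.inl i)⟩

/-- The hypercuboid `C` lies above the base `A × (B + ŝ)` between the heights `z` and `z'`. -/
structure StripInstance.Holds (I : StripInstance m q) (z z' : ℝ) (C : Cuboid (Coord m q)) :
    Prop where
  short : C.short.toSet ⊆ I.A.region
  long : ∀ j, 0 ≤ C.lower (.inr (.inl j)) ∧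
    C.lower (.inr (.inl j)) + C.side (.inr (.inl j)) ≤ I.b j + I.maxSize
  bot : z ≤ C.lower (.inr (.inr ()))
  top : C.lower (.inr (.inr ())) + C.side (.inr (.inr ())) ≤ z'

theorem StripInstance.Holds.toSet_subset {I : StripInstance m q} {h : ℝ}
    {C : Cuboid (Coord m q)} (H : I.Holds 0 h C) :
    C.toSet ⊆ container I.A (fun j => I.b j + I.maxSize) h := by
  intro x hx
  rw [Cuboid.mem_toSet] at hx
  refine ⟨H.short ?_, ?_, ?_⟩
  · rw [Cuboid.mem_toSet]
    exact fun j => hx (.inl j)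
  · rw [Set.mem_Icc, Pi.le_def, Pi.le_def]
    exact ⟨fun j => (H.long j).1.trans (hx _).1, fun j => (hx _).2.trans (H.long j).2⟩
  · exact ⟨H.bot.trans (hx _).1, (hx _).2.trans H.top⟩

/-- The items of `Q` can be packed into at most `M` good boxes of total height `h`. -/
def Boxable (I : StripInstance m q) (Q : Finset (Fin I.n)) (h : ℝ) (M : ℕ) : Prop :=
  ∀ z : ℝ, ∃ (ι : Type) (_ : Fintype ι) (box : ι → Cuboid (Coord m q))
    (R : ι → Finset (Fin I.n)), Fintype.card ι ≤ M ∧ (∀ t, I.Holds z (z + h) (box t)) ∧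
    (∀ t t', t ≠ t' → (box t).Separated (box t')) ∧ (∀ t, GoodBox I.size (R t) (box t)) ∧
    ∀ i ∈ Q, ∃ t, i ∈ R t

theorem Boxable.mono {I : StripInstance m q} {Q Q' : Finset (Fin I.n)} {h h' : ℝ} {M M' : ℕ}
    (H : Boxable I Q h M) (hQ : Q' ⊆ Q) (hh : h ≤ h') (hM : M ≤ M') : Boxable I Q' h' M' := by
  intro z
  obtain ⟨ι, x, box, R, h1, h2, h3, h4, h5⟩ := H z
  exact ⟨ι, x, box, R, h1.trans hM, fun t => ⟨(h2 t).short, (h2 t).long, (h2 t).bot,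
    (h2 t).top.trans (by linarith)⟩, h3, h4, fun i hi => h5 i (hQ hi)⟩

theorem Boxable.empty (I : StripInstance m q) : Boxable I ∅ 0 0 := fun _ =>
  ⟨Empty, inferInstance, fun t => t.elim, fun t => t.elim, by simp, fun t => t.elim,
    fun t => t.elim, fun t => t.elim, by simp⟩

theorem Boxable.union {I : StripInstance m q} {Q Q' : Finset (Fin I.n)} {h h' : ℝ} {M M' : ℕ}
    (H : Boxable I Q h M) (H' : Boxable I Q' h' M') (hh : 0 ≤ h) (hh' : 0 ≤ h') :
    Boxable I (Q ∪ Q') (h + h') (M + M') := by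
  intro z
  obtain ⟨ι, x, box, R, h1, h2, h3, h4, h5⟩ := H z
  obtain ⟨ι', x', box', R', h1', h2', h3', h4', h5'⟩ := H' (z + h)
  refine ⟨ι ⊕ ι', inferInstance, Sum.elim box box', Sum.elim R R', ?_, ?_, ?_, ?_, ?_⟩
  · rw [Fintype.card_sum]; omega
  · rintro (t | t)
    · exact ⟨(h2 t).short, (h2 t).long, (h2 t).bot, (h2 t).top.trans (by linarith)⟩
    · exact ⟨(h2' t).short, (h2' t).long, (by linarith : z ≤ z + h).trans (h2' t).bot,
        (h2' t).top.trans (by linarith)⟩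
  · rintro (t | t) (t' | t') hne
    · exact h3 t t' (by simpa using hne)
    · exact ⟨.inr (.inr ()), Or.inl ((h2 t).top.trans (h2' t').bot)⟩
    · exact ⟨.inr (.inr ()), Or.inr ((h2 t').top.trans (h2' t).bot)⟩
    · exact h3' t t' (by simpa using hne)
  · rintro (t | t)
    exacts [h4 t, h4' t]
  · intro i hi
    rcases Finset.mem_union.1 hi with hi | hi
    · obtain ⟨t, ht⟩ := h5 i hi
      exact ⟨.inl t, ht⟩
    · obtain ⟨t, ht⟩ := h5' i hi
      exact ⟨.inr t, ht⟩

theorem Boxable.biUnion {I : StripInstance m q} {τ : Type*} [DecidableEq τ] (s : Finset τ)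
    (Q : τ → Finset (Fin I.n)) (h : τ → ℝ) (M : τ → ℕ) (hh : ∀ t ∈ s, 0 ≤ h t)
    (H : ∀ t ∈ s, Boxable I (Q t) (h t) (M t)) :
    Boxable I (s.biUnion Q) (∑ t ∈ s, h t) (∑ t ∈ s, M t) := by
  induction s using Finset.induction_on with
  | empty => simpa using Boxable.empty I
  | insert a s ha ih =>
    rw [Finset.biUnion_insert, Finset.sum_insert ha, Finset.sum_insert ha]
    refine (H a (Finset.mem_insert_self _ _)).union
      (ih (fun t ht => hh t (Finset.mem_insert_of_mem ht))
        fun t ht => H t (Finset.mem_insert_of_mem ht)) (hh a (Finset.mem_insert_self _ _)) ?_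
    exact Finset.sum_nonneg fun t ht => hh t (Finset.mem_insert_of_mem ht)

/-- A packing into good boxes is a valid packing in the sense of `IsValidFor`. -/
theorem Boxable.exists_isValidFor {I : StripInstance m q} {h : ℝ} {M : ℕ}
    (hpos : ∀ i, 0 < I.size i) (H : Boxable I Finset.univ h M) :
    ∃ P : BoxedPacking m q I.n, IsValidFor I P ∧ P.boxes.length ≤ M ∧ P.height = h := by
  classical
  obtain ⟨ι, x, box, R, h1, h2, h3, h4, h5⟩ := H 0
  simp only [zero_add] at h2
  -- The sets `R t` may overlap. Each item is assigned to one chosen box, and a good box stays good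
  -- when it loses items.
  choose t ht using fun i => h5 i (Finset.mem_univ i)
  choose pos hp using fun t => (h4 t).2
  set e := Fintype.equivFin ι
  have hin : ∀ i, (cube (pos (t i) i) (I.size i)).toSet ⊆ (box (t i)).toSet := fun i =>
    Cuboid.toSet_subset fun j => (hp (t i)).1 i (ht i) j
  have hsub : ∀ t, (box t).toSet ⊆ container I.A (fun j => I.b j + I.maxSize) h :=
    fun t => (h2 t).toSet_subset
  refine ⟨⟨h, List.ofFn fun k => box (e.symm k), fun i => e (t i), fun i => pos (t i) i⟩,
    ⟨⟨fun i => (hin i).trans (hsub _), ?_⟩, ?_, ?_, ?_, ?_⟩, by simpa using h1, rfl⟩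
  · intro i i' hne
    apply Cuboid.Separated.nonOverlapping
    by_cases htt : t i = t i'
    · have := (hp (t i)).2 i (ht i) i' (by rw [htt]; exact ht i') hne
      simpa only [htt] using this
    · exact (h3 _ _ htt).mono (fun j => (hp (t i)).1 i (ht i) j)
        (fun j => (hp (t i')).1 i' (ht i') j)
  · intro C hC
    obtain ⟨k, rfl⟩ := (List.mem_ofFn' _ _).1 hC
    exact hsub _
  · rw [List.pairwise_ofFn]
    intro k k' hk
    exact (h3 _ _ fun h => hk.ne (e.symm.injective h)).nonOverlapping
  · intro i
    refine ⟨by simp, ?_⟩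
    simpa using hin i
  · intro k hk
    simp only [List.length_ofFn] at hk
    obtain ⟨⟨i₀, c, h6, h7⟩, -⟩ := (h4 (e.symm ⟨k, hk⟩)).mono hpos
      (Q' := {i | (e (t i) : ℕ) = k}) (by
        intro i hi
        simp only [Finset.mem_filter, Finset.mem_univ, true_and] at hi
        have : e.symm ⟨k, hk⟩ = t i := by rw [Equiv.symm_apply_eq]; exact Fin.ext hi.symm
        rw [this]
        exact ht i)
    simp only [List.getElem_ofFn]
    exact h7.imp (fun h => ⟨_, c, h6, h⟩) (fun h => ⟨_, c, h6, h⟩)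

end Boxable

/-! ### Columns -/

section Columns

variable {m q : ℕ}

theorem StripInstance.size_le_maxSize (I : StripInstance m q) (i : Fin I.n) :
    I.size i ≤ I.maxSize :=
  le_ciSup (Set.finite_range I.size).bddAbove i

theorem StripInstance.exists_size_eq_maxSize (I : StripInstance m q) (h : 0 < I.n) :
    ∃ i, I.size i = I.maxSize := by
  have : Nonempty (Fin I.n) := ⟨⟨0, h⟩⟩
  exact exists_eq_ciSup_of_finite

namespace StripInstance.IsAdmissible

variable {I : StripInstance m q} {N : ℕ} {α : ℝ}

theorem maxSize_pos (h : I.IsAdmissible N α) : 0 < I.maxSize :=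
  (h.size_pos ⟨0, h.nonempty⟩).trans_le (I.size_le_maxSize _)

theorem maxSize_le_b (h : I.IsAdmissible N α) (hN : 1 ≤ N) (hα : 1 ≤ α) (j : Fin q) :
    I.maxSize ≤ I.b j := by
  refine le_trans ?_ (h.long j)
  have h1 : (1 : ℝ) ≤ N := by exact_mod_cast hN
  have h2 : (1 : ℝ) ≤ α ^ m := one_le_pow₀ hα
  have h3 := h.maxSize_pos
  nlinarith [mul_le_mul h1 h2 zero_le_one (by linarith)]

end StripInstance.IsAdmissible

/-- Above any `m`-dimensional hypercube with side length `ρ` inside the grid, there is a good box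
of height at most `H` holding the items in `Q`. -/
def ColumnHolds (I : StripInstance m q) (ρ H : ℝ) (Q : Finset (Fin I.n)) : Prop :=
  ∃ side : Coord m q → ℝ, (∀ lower, GoodBox I.size Q ⟨lower, side⟩) ∧
    (∀ j, side (.inl j) ≤ ρ) ∧ (∀ j, side (.inr (.inl j)) ≤ I.b j + I.maxSize) ∧
    side (.inr (.inr ())) ≤ H

/-- Columns over separated base cubes inherit the separation in a short coordinate, so they can all
start at the same height `z` and share one slab. -/
theorem boxable_of_columns {I : StripInstance m q} {H : ℝ} {ι : Type} [Fintype ι]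
    (p : ι → Fin m → ℝ) (ρ : ι → ℝ) (R : ι → Finset (Fin I.n))
    (hsep : ∀ t t', t ≠ t' → (cube (p t) (ρ t)).Separated (cube (p t') (ρ t')))
    (hsub : ∀ t, (cube (p t) (ρ t)).toSet ⊆ I.A.region)
    (hcol : ∀ t, ColumnHolds I (ρ t) H (R t)) (Q : Finset (Fin I.n))
    (hQ : ∀ i ∈ Q, ∃ t, i ∈ R t) : Boxable I Q H (Fintype.card ι) := by
  intro z
  choose side h1 h2 h3 h4 using hcol
  refine ⟨ι, inferInstance, fun t => ⟨Sum.elim (p t) (Sum.elim 0 fun _ => z), side t⟩, R, le_rfl,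
    fun t => ⟨?_, ?_, ?_, ?_⟩, ?_, fun t => h1 t _, hQ⟩
  · refine Set.Subset.trans (Cuboid.toSet_subset fun j => ?_) (hsub t)
    have := h2 t j
    exact ⟨le_rfl, by simp only [cube, Cuboid.short, Sum.elim_inl]; linarith⟩
  · intro j
    simpa using h3 t j
  · simp
  · simpa using h4 t
  · intro t t' hne
    obtain ⟨j, hj⟩ := hsep t t' hne
    refine ⟨.inl j, ?_⟩
    have := h2 t j
    have := h2 t' j
    simp only [cube, Sum.elim_inl] at hj ⊢
    exact hj.imp (fun h => by linarith) (fun h => by linarith)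

theorem Fintype.prod_coord {R : Type*} [CommMonoid R] (f : Coord m q → R) :
    ∏ j, f j = (∏ j, f (.inl j)) * ((∏ j, f (.inr (.inl j))) * f (.inr (.inr ()))) := by
  simp [Fintype.prod_sum_type]

theorem one_le_floor_div {a s : ℝ} (hs : 0 < s) (h : s ≤ a) : 0 < ⌊a / s⌋₊ := by
  rw [Nat.floor_pos, le_div_iff₀ hs]
  linarith

theorem floor_div_mul_le {a s : ℝ} (hs : 0 < s) (ha : 0 ≤ a) : (⌊a / s⌋₊ : ℝ) * s ≤ a := by
  have := Nat.floor_le (div_nonneg ha hs.le)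
  calc _ ≤ a / s * s := by gcongr
    _ = a := by field_simp

theorem sub_le_floor_div_mul {a s : ℝ} (hs : 0 < s) : a - s ≤ (⌊a / s⌋₊ : ℝ) * s := by
  have := Nat.lt_floor_add_one (a / s)
  rw [div_lt_iff₀ hs] at this
  linarith

/-- The number of hypercubes of side length `s` that fit into a column of height `H`. -/
def columnCapacity (I : StripInstance m q) (s H : ℝ) : ℕ :=
  (∏ j, ⌊(I.b j + I.maxSize) / s⌋₊) * ⌊H / s⌋₊

/-- An N-Box that is one item wide in the short directions and is filled with cells of side `I.size
i₀` in the others. -/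
theorem columnHolds_of_card_le {I : StripInstance m q} (hb : ∀ j, 0 ≤ I.b j)
    (hpos : ∀ i, 0 < I.size i) (i₀ : Fin I.n) {ρ H : ℝ} {Q : Finset (Fin I.n)}
    (hQ : ∀ i ∈ Q, I.size i ≤ I.size i₀) (hρ : I.size i₀ ≤ ρ) (hH : I.size i₀ ≤ H)
    (hcard : Q.card ≤ columnCapacity I (I.size i₀) H) : ColumnHolds I ρ H Q := by
  set s := I.size i₀ with hs
  have hs0 : 0 < s := hpos i₀
  have hsS : s ≤ I.maxSize := I.size_le_maxSize i₀
  set c : Coord m q → ℕ := Sum.elim (fun _ => 1)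
    (Sum.elim (fun j => ⌊(I.b j + I.maxSize) / s⌋₊) fun _ => ⌊H / s⌋₊) with hc
  have hc0 : ∀ j, 0 < c j := by
    rintro (j | j | j)
    · simp [hc]
    · exact one_le_floor_div hs0 (by linarith [hb j])
    · exact one_le_floor_div hs0 hH
  have hprod : Q.card ≤ ∏ j, c j := by
    rw [Fintype.prod_coord]
    simpa [hc, columnCapacity] using hcard
  refine ⟨fun j => c j * s, fun lower => ⟨⟨i₀, c, ⟨hs0, hQ, fun j => ⟨hc0 j, rfl⟩⟩,
    Or.inl hprod⟩, exists_packs_of_card_le _ _ _ s hs0.le c hQ (fun _ => le_rfl) hprod⟩,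
    ?_, ?_, ?_⟩
  · intro j; simpa [hc] using hρ
  · intro j; exact floor_div_mul_le hs0 (by linarith [hb j])
  · exact floor_div_mul_le hs0 (by linarith)

/-- Rounding a length down to a multiple of `s` loses at most `s ≤ ŝ`, which is what was added to
each long side and to the height. Hence a column over a section of measure `(∏ b) x` has room for
that measure in units of `s^(q+1)`, without loss. -/
theorem le_columnCapacity {I : StripInstance m q} (hb : ∀ j, 0 ≤ I.b j) {s x : ℝ} (hs : 0 < s)
    (hsS : s ≤ I.maxSize) (hx : 0 ≤ x) :
    (∏ j, I.b j) * x ≤ columnCapacity I s (x + I.maxSize) * s ^ (q + 1) := by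
  have h1 : ∏ j, I.b j ≤ ∏ j, ((⌊(I.b j + I.maxSize) / s⌋₊ : ℝ) * s) :=
    Finset.prod_le_prod (fun j _ => hb j) fun j _ => by
      have := sub_le_floor_div_mul (a := I.b j + I.maxSize) hs
      linarith
  have h2 := sub_le_floor_div_mul (a := x + I.maxSize) hs
  rw [Finset.prod_mul_distrib, Finset.prod_const, Finset.card_univ, Fintype.card_fin] at h1
  calc (∏ j, I.b j) * x ≤ ((∏ j, (⌊(I.b j + I.maxSize) / s⌋₊ : ℝ)) * s ^ q) *
        (⌊(x + I.maxSize) / s⌋₊ * s) :=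
        mul_le_mul h1 (by linarith) hx (by positivity)
    _ = _ := by rw [columnCapacity]; push_cast; ring

/-- Since `ρ ≥ 2 s / η²` and no other side is shorter than `ρ`, every side has at least `1 / η²`
multiples of `s`, as the dense packing needs. Rounding costs a factor `1 - η` per short direction;
elsewhere the added `ŝ` absorbs it. -/
theorem columnHolds_of_sum_le {I : StripInstance m q} (hb : ∀ j, I.maxSize ≤ I.b j)
    (hpos : ∀ i, 0 < I.size i) (i₀ : Fin I.n) {ρ H η : ℝ} {Q : Finset (Fin I.n)}
    (hη : 0 < η) (hη1 : (2 * Fintype.card (Coord m q) + 1) * η ≤ 1)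
    (hQ : ∀ i ∈ Q, I.size i ≤ I.size i₀) (hρ : 2 * I.size i₀ ≤ η ^ 2 * ρ) (hρS : ρ ≤ I.maxSize)
    (hH : I.maxSize ≤ H)
    (hV : ∑ i ∈ Q, I.size i ^ Fintype.card (Coord m q) ≤
      (1 - (2 * Fintype.card (Coord m q) + 1) * η) *
        (((1 - η) * ρ) ^ m * ((∏ j, I.b j) * (H - I.maxSize)))) : ColumnHolds I ρ H Q := by
  set d := Fintype.card (Coord m q)
  set s := I.size i₀ with hs
  have hs0 : 0 < s := hpos i₀
  have hsS : s ≤ I.maxSize := I.size_le_maxSize i₀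
  have hd : (1 : ℝ) ≤ d := by
    have : 0 < d := Fintype.card_pos_iff.2 ⟨.inr (.inr ())⟩
    exact_mod_cast this
  have hη2 : η < 1 := by nlinarith
  have hρ0 : 0 < ρ := by
    by_contra h
    nlinarith [mul_nonneg (sq_nonneg η) (neg_nonneg.2 (not_lt.1 h))]
  have hηη : η ^ 2 ≤ η := by nlinarith
  have hsη : s ≤ η * ρ := by nlinarith
  set c : Coord m q → ℕ := Sum.elim (fun _ => ⌊ρ / s⌋₊)
    (Sum.elim (fun j => ⌊(I.b j + I.maxSize) / s⌋₊) fun _ => ⌊H / s⌋₊) with hc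
  have hlarge : ∀ a, ρ ≤ a → 1 ≤ η ^ 2 * ⌊a / s⌋₊ := by
    intro a ha
    have h1 := sub_le_floor_div_mul (a := a) hs0
    have h2 : η ^ 2 * ρ - s ≤ η ^ 2 * (⌊a / s⌋₊ * s) := by
      have : η ^ 2 * (ρ - s) ≤ η ^ 2 * (⌊a / s⌋₊ * s) := by gcongr; linarith
      nlinarith
    have h3 : s ≤ (η ^ 2 * ⌊a / s⌋₊) * s := by linarith
    exact le_of_mul_le_mul_right (by linarith) hs0
  have hc1 : ∀ j, 1 ≤ η ^ 2 * c j := by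
    rintro (j | j | j)
    · exact hlarge _ le_rfl
    · exact hlarge _ (by linarith [hb j])
    · exact hlarge _ (by linarith)
  have hc0 : ∀ j, 0 < c j := by
    intro j
    by_contra h
    have h0 : c j = 0 := by omega
    have := hc1 j
    rw [h0] at this
    norm_num at this
  have hvol : ((1 - η) * ρ) ^ m * ((∏ j, I.b j) * (H - I.maxSize)) ≤ ∏ j, (c j * s) := by
    have hb0 : ∀ j, 0 ≤ I.b j := fun j => by linarith [hb j]
    rw [Fintype.prod_coord]
    have e1 : ((1 - η) * ρ) ^ m ≤ ∏ j : Fin m, ((c (.inl j) : ℝ) * s) := by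
      rw [← Fin.prod_const]
      refine Finset.prod_le_prod (fun j _ => mul_nonneg (by linarith) hρ0.le) fun j _ => ?_
      have := sub_le_floor_div_mul (a := ρ) hs0
      simp only [hc, Sum.elim_inl]
      linarith
    have e2 : ∏ j, I.b j ≤ ∏ j : Fin q, ((c (.inr (.inl j)) : ℝ) * s) :=
      Finset.prod_le_prod (fun j _ => hb0 j) fun j _ => by
        have := sub_le_floor_div_mul (a := I.b j + I.maxSize) hs0
        simp only [hc, Sum.elim_inl, Sum.elim_inr]
        linarith
    have e3 : H - I.maxSize ≤ (c (.inr (.inr ())) : ℝ) * s := by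
      have := sub_le_floor_div_mul (a := H) hs0
      simp only [hc, Sum.elim_inr]
      linarith
    have e4 : 0 ≤ ∏ j, I.b j := Finset.prod_nonneg fun j _ => hb0 j
    exact mul_le_mul e1 (mul_le_mul e2 e3 (by linarith) (e4.trans e2))
      (mul_nonneg e4 (by linarith)) (Finset.prod_nonneg fun j _ => by positivity)
  refine ⟨fun j => c j * s, fun lower => ?_, ?_, ?_, ?_⟩
  · have hbox : HasBoxSides I.size Q (⟨lower, fun j => c j * s⟩ : Cuboid (Coord m q)) s c :=
      ⟨hs0, hQ, fun j => ⟨hc0 j, rfl⟩⟩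
    obtain ⟨h1, h2⟩ := exists_packs_of_sum_le I.size hpos (.inr (.inr ())) η hη hη2 Q _ s c hbox hc1
      (hV.trans (mul_le_mul_of_nonneg_left hvol (by linarith)))
    exact ⟨⟨i₀, c, hbox, Or.inr h2⟩, h1⟩
  · intro j; exact floor_div_mul_le hs0 hρ0.le
  · intro j; exact floor_div_mul_le hs0 (by linarith [hb j])
  · exact floor_div_mul_le hs0 (by linarith)

end Columns

/-! ### Distributing items to boxes of given capacities -/

theorem exists_distribution_of_card_le {ι τ : Type*} [DecidableEq ι] [DecidableEq τ]
    (s : Finset τ) (cap : τ → ℕ) (Q : Finset ι) (h : Q.card ≤ ∑ t ∈ s, cap t) :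
    ∃ R : τ → Finset ι, (∀ t, R t ⊆ Q ∧ (R t).card ≤ cap t) ∧ ∀ i ∈ Q, ∃ t ∈ s, i ∈ R t := by
  induction s using Finset.induction_on generalizing Q with
  | empty =>
    refine ⟨fun _ => ∅, by simp, fun i hi => ?_⟩
    have : Q = ∅ := by simpa using h
    simp [this] at hi
  | insert a s ha ih =>
    rw [Finset.sum_insert ha] at h
    obtain ⟨Q₁, h1, h2⟩ := Finset.exists_subset_card_eq (s := Q) (n := min (cap a) Q.card)
      (min_le_right _ _)
    obtain ⟨R, h3, h4⟩ := ih (Q \ Q₁) (by rw [Finset.card_sdiff_of_subset h1]; omega)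
    refine ⟨Function.update R a Q₁, fun t => ?_, fun i hi => ?_⟩
    · by_cases hta : t = a
      · subst hta
        simp only [Function.update_self]
        exact ⟨h1, by omega⟩
      · simp only [ne_eq, hta, not_false_eq_true, Function.update_of_ne]
        exact ⟨(h3 t).1.trans Finset.sdiff_subset, (h3 t).2⟩
    · by_cases hi1 : i ∈ Q₁
      · exact ⟨a, Finset.mem_insert_self _ _, by simpa using hi1⟩
      · obtain ⟨t, ht, hit⟩ := h4 i (Finset.mem_sdiff.2 ⟨hi, hi1⟩)
        refine ⟨t, Finset.mem_insert_of_mem ht, ?_⟩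
        rwa [Function.update_of_ne (by rintro rfl; exact ha ht)]

/-- A subset of largest cardinality within the capacity: if an item is left over, it did not fit, so
less than `w` is free. -/
theorem exists_subset_sum_le {ι : Type*} [DecidableEq ι] (Q : Finset ι) (v : ι → ℝ) (w cap : ℝ)
    (hv : ∀ i ∈ Q, v i ≤ w) (hcap : 0 ≤ cap) :
    ∃ R ⊆ Q, ∑ i ∈ R, v i ≤ cap ∧ (R = Q ∨ cap - w ≤ ∑ i ∈ R, v i) := by
  obtain ⟨R, hR, hmax⟩ := Finset.exists_max_image
    (Q.powerset.filter fun R => ∑ i ∈ R, v i ≤ cap) Finset.card ⟨∅, by simpa using hcap⟩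
  simp only [Finset.mem_filter, Finset.mem_powerset] at hR hmax
  refine ⟨R, hR.1, hR.2, ?_⟩
  by_contra hcon
  push Not at hcon
  obtain ⟨a, ha, haR⟩ : ∃ a ∈ Q, a ∉ R := by
    by_contra h
    push Not at h
    exact hcon.1 (hR.1.antisymm h)
  have := hmax (insert a R) ⟨Finset.insert_subset ha hR.1, by
    rw [Finset.sum_insert haR]
    linarith [hv a ha, hcon.2]⟩
  rw [Finset.card_insert_of_notMem haR] at this
  omega

/-- Greedy filling. A box that does not take everything that is left is filled up to `w`, so either
nothing remains or every box has absorbed at least `cap t - w`. -/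
theorem exists_distribution_of_sum {ι τ : Type*} [DecidableEq ι] [DecidableEq τ]
    (s : Finset τ) (cap : τ → ℝ) (hcap : ∀ t, 0 ≤ cap t) (Q : Finset ι) (v : ι → ℝ) (w : ℝ)
    (hv : ∀ i ∈ Q, v i ≤ w) :
    ∃ (R : τ → Finset ι) (L : Finset ι), L ⊆ Q ∧
      (∀ t, R t ⊆ Q ∧ ∑ i ∈ R t, v i ≤ cap t) ∧
      (∀ i ∈ Q, i ∈ L ∨ ∃ t ∈ s, i ∈ R t) ∧
      (L = ∅ ∨ ∑ i ∈ L, v i ≤ ∑ i ∈ Q, v i - ∑ t ∈ s, (cap t - w)) := by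
  induction s using Finset.induction_on generalizing Q with
  | empty =>
    exact ⟨fun _ => ∅, Q, le_rfl, fun t => ⟨by simp, by simpa using hcap t⟩,
      fun i hi => Or.inl hi, Or.inr (by simp)⟩
  | insert a s ha ih =>
    obtain ⟨Q₁, h1, h2, h3⟩ := exists_subset_sum_le Q v w (cap a) hv (hcap a)
    obtain ⟨R, L, h4, h5, h6, h7⟩ := ih (Q \ Q₁) fun i hi => hv i (Finset.sdiff_subset hi)
    refine ⟨Function.update R a Q₁, L, h4.trans Finset.sdiff_subset, fun t => ?_, fun i hi => ?_,
      ?_⟩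
    · by_cases hta : t = a
      · subst hta
        simp only [Function.update_self]
        exact ⟨h1, h2⟩
      · simp only [ne_eq, hta, not_false_eq_true, Function.update_of_ne]
        exact ⟨(h5 t).1.trans Finset.sdiff_subset, (h5 t).2⟩
    · by_cases hi1 : i ∈ Q₁
      · exact Or.inr ⟨a, Finset.mem_insert_self _ _, by simpa using hi1⟩
      · refine (h6 i (Finset.mem_sdiff.2 ⟨hi, hi1⟩)).imp_right ?_
        rintro ⟨t, ht, hit⟩
        refine ⟨t, Finset.mem_insert_of_mem ht, ?_⟩
        rwa [Function.update_of_ne (by rintro rfl; exact ha ht)]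
    · rcases h3 with rfl | h3
      · left
        simpa using h4
      · refine h7.imp_right fun h => h.trans ?_
        rw [Finset.sum_insert ha, ← Finset.sum_sdiff h1]
        linarith

/-! ### Volumes and sections -/

open MeasureTheory

theorem Cuboid.volume_interior {κ : Type} [Fintype κ] [DecidableEq κ] {C : Cuboid κ} :
    volume (interior C.toSet) = ∏ j, ENNReal.ofReal (C.side j) := by
  rw [Cuboid.interior_toSet, Real.volume_pi_Ioo]
  simp

/-- The total volume of separated hypercuboids is at most that of hypercuboids covering them. -/
theorem sum_vol_le_of_subset {κ ι τ : Type} [Fintype κ] [DecidableEq κ]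
    (s : Finset ι) (C : ι → Cuboid κ) (t : Finset τ) (D : τ → Cuboid κ)
    (hC : ∀ i ∈ s, ∀ j, 0 ≤ (C i).side j) (hD : ∀ i ∈ t, ∀ j, 0 ≤ (D i).side j)
    (hsep : ∀ i ∈ s, ∀ i' ∈ s, i ≠ i' → (C i).Separated (C i'))
    (hsub : ∀ i ∈ s, (C i).toSet ⊆ ⋃ k ∈ t, (D k).toSet) :
    ∑ i ∈ s, (C i).vol ≤ ∑ k ∈ t, (D k).vol := by
  have h1 : ∑ i ∈ s, volume (interior (C i).toSet) ≤ ∑ k ∈ t, volume (D k).toSet := by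
    rw [← measure_biUnion_finset]
    · refine le_trans (measure_mono ?_) (measure_biUnion_finset_le t fun k => (D k).toSet)
      exact Set.iUnion₂_subset fun i hi => interior_subset.trans (hsub i hi)
    · intro i hi i' hi' hne
      exact (hsep i hi i' hi' hne).nonOverlapping
    · exact fun i _ => isOpen_interior.measurableSet
  have h2 : ∀ k, volume (D k).toSet = ∏ j, ENNReal.ofReal ((D k).side j) := fun k => by
    rw [Cuboid.toSet, Real.volume_Icc_pi]
    simp
  have h3 : ∑ i ∈ s, volume (interior (C i).toSet) = ENNReal.ofReal (∑ i ∈ s, (C i).vol) := by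
    rw [ENNReal.ofReal_sum_of_nonneg fun i hi => show 0 ≤ (C i).vol from
      Finset.prod_nonneg fun j _ => hC i hi j]
    refine Finset.sum_congr rfl fun i hi => ?_
    rw [Cuboid.volume_interior, Cuboid.vol, ENNReal.ofReal_prod_of_nonneg fun j _ => hC i hi j]
  have h4 : ∑ k ∈ t, volume (D k).toSet = ENNReal.ofReal (∑ k ∈ t, (D k).vol) := by
    rw [ENNReal.ofReal_sum_of_nonneg fun i hi => show 0 ≤ (D i).vol from
      Finset.prod_nonneg fun j _ => hD i hi j]
    refine Finset.sum_congr rfl fun i hi => ?_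
    rw [h2, Cuboid.vol, ENNReal.ofReal_prod_of_nonneg fun j _ => hD i hi j]
  rw [h3, h4] at h1
  exact (ENNReal.ofReal_le_ofReal_iff (Finset.sum_nonneg fun k hk =>
    Finset.prod_nonneg fun j _ => hD k hk j)).1 h1

theorem vol_cube {m : ℕ} (p : Fin m → ℝ) (s : ℝ) : (cube p s).vol = s ^ m := by
  simp [Cuboid.vol, cube]

section Sections

variable {m q : ℕ}

/-- The short coordinates of a point. -/
def shortPart (p : Coord m q → ℝ) : Fin m → ℝ := fun i => p (.inl i)

/-- A packing is described by its sections with the `m`-dimensional fibres over the long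
coordinates: `x J` is the measure of the set of points over which exactly the items in `J` lie. -/
theorem IsPacking.exists_sections {n : ℕ} {size : Fin n → ℝ} {pos : Fin n → Coord m q → ℝ}
    {A : Grid m} {b : Fin q → ℝ} {h : ℝ} (H : IsPacking size pos (container A b h))
    (hpos : ∀ i, 0 < size i) (hb : ∀ j, 0 ≤ b j) (hh : 0 ≤ h) :
    (∀ i, (cube (shortPart (pos i)) (size i)).toSet ⊆ A.region) ∧
    ∃ x : Finset (Fin n) → ℝ, (∀ J, 0 ≤ x J) ∧
      (∀ J, x J ≠ 0 → ∀ i ∈ J, ∀ i' ∈ J, i ≠ i' →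
        (cube (shortPart (pos i)) (size i)).Separated (cube (shortPart (pos i')) (size i'))) ∧
      (∀ i, ∑ J ∈ Finset.univ.filter (i ∈ ·), x J = size i ^ (q + 1)) ∧
      ∑ J, x J = (∏ j, b j) * h := by
  classical
  -- Half-open projections: items that only touch have no common point over the long coordinates and
  -- the height.
  set Pr : Fin n → Set (Fin q ⊕ Unit → ℝ) := fun i =>
    Set.univ.pi fun j => Set.Ico (pos i (.inr j)) (pos i (.inr j) + size i) with hPr
  set top : Fin q ⊕ Unit → ℝ := Sum.elim b fun _ => h with htop
  set Z : Set (Fin q ⊕ Unit → ℝ) := Set.Icc 0 top with hZ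
  have htop0 : 0 ≤ top := by
    rintro (j | j)
    exacts [hb j, hh]
  have hcorner : ∀ i, ∀ x : Coord m q → ℝ, (∀ j, pos i j ≤ x j ∧ x j ≤ pos i j + size i) →
      x ∈ container A b h := fun i x hx => H.1 i (Cuboid.mem_toSet.2 hx)
  have hself : ∀ i j, pos i j ≤ pos i j ∧ pos i j ≤ pos i j + size i :=
    fun i j => ⟨le_rfl, by linarith [hpos i]⟩
  have hself' : ∀ i j, pos i j ≤ pos i j + size i ∧ pos i j + size i ≤ pos i j + size i :=
    fun i j => ⟨by linarith [hpos i], le_rfl⟩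
  have hPrZ : ∀ i, Pr i ⊆ Z := by
    intro i y hy
    have h1 := hcorner i _ (hself i)
    have h2 := hcorner i _ (hself' i)
    rw [hZ, Set.mem_Icc, Pi.le_def, Pi.le_def]
    have hy' : ∀ j, pos i (.inr j) ≤ y j ∧ y j < pos i (.inr j) + size i :=
      fun j => hy j (Set.mem_univ j)
    constructor
    · rintro (j | j)
      · exact (h1.2.1.1 j).trans (hy' (.inl j)).1
      · exact h1.2.2.1.trans (hy' (.inr ())).1
    · rintro (j | j)
      · exact (hy' (.inl j)).2.le.trans (h2.2.1.2 j)
      · exact (hy' (.inr ())).2.le.trans h2.2.2.2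
  have hPrm : ∀ i, MeasurableSet (Pr i) := fun i =>
    MeasurableSet.univ_pi fun j => measurableSet_Ico
  set sec : (Fin q ⊕ Unit → ℝ) → Finset (Fin n) := fun y => Finset.univ.filter (y ∈ Pr ·) with hsec
  have hmem : ∀ y i, i ∈ sec y ↔ y ∈ Pr i := fun y i => by simp [hsec]
  have hsecm : ∀ J, MeasurableSet (sec ⁻¹' {J}) := by
    intro J
    have : sec ⁻¹' {J} = ⋂ i, if i ∈ J then Pr i else (Pr i)ᶜ := by
      ext y
      simp only [Set.mem_preimage, Set.mem_singleton_iff, Set.mem_iInter, Finset.ext_iff, hmem]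
      refine forall_congr' fun i => ?_
      by_cases hi : i ∈ J <;> simp [hi]
    rw [this]
    refine MeasurableSet.iInter fun i => ?_
    split_ifs
    exacts [hPrm i, (hPrm i).compl]
  have hZfin : volume Z ≠ ⊤ := by
    rw [hZ, Real.volume_Icc_pi]
    exact ENNReal.prod_ne_top fun _ _ => ENNReal.ofReal_ne_top
  have hZvol : (volume Z).toReal = (∏ j, b j) * h := by
    rw [hZ, Real.volume_Icc_pi_toReal htop0]
    simp [htop, Fintype.prod_sum_type]
  set μ := (volume : Measure (Fin q ⊕ Unit → ℝ)).restrict Z with hμ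
  have hfin : ∀ S, μ S ≠ ⊤ := fun S =>
    ne_top_of_le_ne_top hZfin ((measure_mono (Set.subset_univ S)).trans (by simp [hμ]))
  have hsum : ∀ F : Finset (Finset (Fin n)), ∑ J ∈ F, (μ (sec ⁻¹' {J})).toReal =
      (μ (sec ⁻¹' (F : Set (Finset (Fin n))))).toReal := by
    intro F
    rw [← ENNReal.toReal_sum fun J _ => hfin _]
    rw [sum_measure_preimage_singleton F fun J _ => hsecm J]
  refine ⟨fun i x hx => ?_, fun J => (μ (sec ⁻¹' {J})).toReal, fun J => ENNReal.toReal_nonneg,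
    ?_, ?_, ?_⟩
  · rw [Cuboid.mem_toSet] at hx
    exact (hcorner i (Sum.elim x fun j => pos i (.inr j)) (by
      rintro (j | j)
      exacts [hx j, hself i _])).1
  -- A section of nonzero measure occurs at some point `y`. The half-open projections of both items
  -- contain `y`, so no long coordinate and not the height can separate them; the separating axis is
  -- a short one.
  · intro J hJ i hi i' hi' hne
    obtain ⟨y, hy⟩ : (sec ⁻¹' {J}).Nonempty := by
      rw [Set.nonempty_iff_ne_empty]
      rintro h0
      simp [h0] at hJ
    have hy : sec y = J := hy
    rw [← hy, hmem] at hi hi'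
    obtain ⟨j, hj⟩ := (H.2 i i' hne).separated (fun _ => hpos i) (fun _ => hpos i')
    rcases j with j | j
    · exact ⟨j, hj⟩
    · have h1 := hi j (Set.mem_univ j)
      have h2 := hi' j (Set.mem_univ j)
      simp only [cube, Set.mem_Ico] at hj h1 h2
      rcases hj with hj | hj <;> linarith
  · intro i
    rw [hsum]
    have : sec ⁻¹' ((Finset.univ.filter (i ∈ ·) : Finset (Finset (Fin n))) :
        Set (Finset (Fin n))) = Pr i := by
      ext y
      simp [hmem]
    rw [this, hμ, Measure.restrict_apply (hPrm i), Set.inter_eq_left.2 (hPrZ i), hPr,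
      Real.volume_pi_Ico_toReal (fun j => by linarith [hpos i])]
    simp
  · rw [hsum]
    simp [hμ, hZvol]

end Sections

/-! ### Linear grouping -/

/-- The `g` largest items form group `0`, the next `g` form group `1`, and so on; every group before
the group of some item is full. The bound `grp i * g ≤ Q.card` limits the number of groups. -/
theorem exists_grouping {n : ℕ} (size : Fin n → ℝ) (g : ℕ) (hg : 0 < g) (Q : Finset (Fin n)) :
    ∃ grp : Fin n → ℕ, (∀ i ∈ Q, grp i * g ≤ Q.card) ∧
      (∀ j, (Q.filter (grp · = j)).card ≤ g) ∧
      (∀ i ∈ Q, ∀ j < grp i, (Q.filter (grp · = j)).card = g) ∧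
      ∀ i ∈ Q, ∀ i' ∈ Q, grp i < grp i' → size i' ≤ size i := by
  classical
  induction hN : Q.card using Nat.strong_induction_on generalizing Q with
  | _ N ih =>
  by_cases hQ : Q.card ≤ g
  · exact ⟨fun _ => 0, by simp, fun j => (Finset.card_filter_le _ _).trans hQ, by simp, by simp⟩
  push Not at hQ
  obtain ⟨Q₁, h1, h2, h3⟩ := exists_largest_subset size Q g hQ.le
  have hc := Finset.card_sdiff_of_subset h1
  obtain ⟨grp, h4, h5, h6, h7⟩ := ih _ (by omega) (Q \ Q₁) rfl
  set grp' : Fin n → ℕ := fun i => if i ∈ Q₁ then 0 else grp i + 1 with hgrp'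
  have hf0 : Q.filter (grp' · = 0) = Q₁ := by
    ext i
    simp only [hgrp', Finset.mem_filter]
    by_cases hi : i ∈ Q₁
    · simp [hi, h1 hi]
    · simp [hi]
  have hfs : ∀ j, Q.filter (grp' · = j + 1) = (Q \ Q₁).filter (grp · = j) := by
    intro j
    ext i
    simp only [hgrp', Finset.mem_filter, Finset.mem_sdiff]
    by_cases hi : i ∈ Q₁ <;> simp [hi]
  refine ⟨grp', fun i hi => ?_, fun j => ?_, fun i hi j hj => ?_, fun i hi i' hi' hlt => ?_⟩
  · by_cases hi1 : i ∈ Q₁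
    · simp [hgrp', hi1]
    · have := h4 i (Finset.mem_sdiff.2 ⟨hi, hi1⟩)
      simp only [hgrp', hi1, if_false, add_mul, one_mul]
      omega
  · cases j with
    | zero => rw [hf0, h2]
    | succ j => rw [hfs]; exact h5 j
  · by_cases hi1 : i ∈ Q₁
    · simp [hgrp', hi1] at hj
    · cases j with
      | zero => rw [hf0, h2]
      | succ j =>
        rw [hfs]
        refine h6 i (Finset.mem_sdiff.2 ⟨hi, hi1⟩) j ?_
        simp only [hgrp', hi1, if_false] at hj
        omega
  · have hi'1 : i' ∉ Q₁ := fun h => by simp [hgrp', h] at hlt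
    by_cases hi1 : i ∈ Q₁
    · exact h3 i hi1 i' (Finset.mem_sdiff.2 ⟨hi', hi'1⟩)
    · simp only [hgrp', hi1, hi'1, if_false] at hlt
      exact h7 i (Finset.mem_sdiff.2 ⟨hi, hi1⟩) i' (Finset.mem_sdiff.2 ⟨hi', hi'1⟩) (by omega)

/-! ### Free cubes -/

/-- Telescoping over the factors: replacing one factor changes the product by at most `τ` times a
power of `D`. It bounds the volume lost when each side of a cuboid shrinks by at most `τ`. -/
theorem prod_sub_prod_le {ι : Type*} (s : Finset ι) (a x : ι → ℝ) {τ D : ℝ} (hD : 0 < D)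
    (h : ∀ i ∈ s, 0 ≤ x i ∧ x i ≤ a i ∧ a i ≤ x i + τ ∧ a i ≤ D) :
    ∏ i ∈ s, a i - ∏ i ∈ s, x i ≤ s.card * (τ / D) * D ^ s.card := by
  classical
  induction s using Finset.induction_on with
  | empty => simp
  | insert i s hi ih =>
    have ih' := ih fun k hk => h k (Finset.mem_insert_of_mem hk)
    obtain ⟨h1, h2, h3, h4⟩ := h i (Finset.mem_insert_self _ _)
    rw [Finset.prod_insert hi, Finset.prod_insert hi, Finset.card_insert_of_notMem hi]
    have hs : ∀ k ∈ s, 0 ≤ x k ∧ x k ≤ a k ∧ a k ≤ D := fun k hk =>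
      ⟨(h k (Finset.mem_insert_of_mem hk)).1, (h k (Finset.mem_insert_of_mem hk)).2.1,
        (h k (Finset.mem_insert_of_mem hk)).2.2.2⟩
    have hX : ∏ k ∈ s, x k ≤ D ^ s.card := by
      rw [← Finset.prod_const]
      exact Finset.prod_le_prod (fun k hk => (hs k hk).1) fun k hk => (hs k hk).2.1.trans (hs k hk).2.2
    have hX0 : 0 ≤ ∏ k ∈ s, x k := Finset.prod_nonneg fun k hk => (hs k hk).1
    have hXA : ∏ k ∈ s, x k ≤ ∏ k ∈ s, a k :=
      Finset.prod_le_prod (fun k hk => (hs k hk).1) fun k hk => (hs k hk).2.1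
    have hτ : 0 ≤ τ := by linarith
    calc a i * ∏ k ∈ s, a k - x i * ∏ k ∈ s, x k
        = a i * (∏ k ∈ s, a k - ∏ k ∈ s, x k) + (a i - x i) * ∏ k ∈ s, x k := by ring
      _ ≤ D * (s.card * (τ / D) * D ^ s.card) + τ * D ^ s.card := by
          gcongr
          linarith
      _ = _ := by push_cast; field_simp; ring

namespace Grid

variable {m : ℕ}

/-- The sum of the volumes of the cells. -/
def vol (A : Grid m) : ℝ := ∑ c ∈ A.cells, (A.cell c).vol

theorem IsGrid.cell_side_pos {A : Grid m} (h : A.IsGrid) {c : Fin m → ℕ} (hc : c ∈ A.cells)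
    (i : Fin m) : 0 < (A.cell c).side i := by
  have h1 := h.2.2 c hc i
  have := h.2.1 i (Set.mem_Iic.2 h1.le) (Set.mem_Iic.2 (Nat.succ_le_of_lt h1)) (Nat.lt_succ_self _)
  simp only [cell]
  linarith

theorem IsGrid.cell_separated {A : Grid m} (h : A.IsGrid) {c c' : Fin m → ℕ} (hc : c ∈ A.cells)
    (hc' : c' ∈ A.cells) (hne : c ≠ c') : (A.cell c).Separated (A.cell c') := by
  obtain ⟨i, hi⟩ := Function.ne_iff.1 hne
  refine ⟨i, ?_⟩
  have h1 := h.2.2 c hc i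
  have h2 := h.2.2 c' hc' i
  simp only [cell, add_sub_cancel]
  rcases lt_or_gt_of_ne hi with hlt | hlt
  · left
    exact (h.2.1 i).monotoneOn (Set.mem_Iic.2 h1) (Set.mem_Iic.2 h2.le) hlt
  · right
    exact (h.2.1 i).monotoneOn (Set.mem_Iic.2 h2) (Set.mem_Iic.2 h1.le) hlt

/-- The grid contains many separated cubes of side length `τ` that avoid given cubes. -/
theorem IsGrid.exists_free_cubes {A : Grid m} (h : A.IsGrid) {D S τ : ℝ} (hτ : 0 < τ) (hS : τ ≤ S)
    (hSD : S ≤ D) (hD : ∀ c ∈ A.cells, ∀ i, (A.cell c).side i ≤ D) {ι : Type}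
    (Bl : Finset ι) (p : ι → Fin m → ℝ) (r : ι → ℝ) (hr : ∀ i ∈ Bl, 0 ≤ r i ∧ r i ≤ S) :
    ∃ (F : Finset ((Fin m → ℕ) × (Fin m → ℕ))) (v : (Fin m → ℕ) × (Fin m → ℕ) → Fin m → ℝ),
      (∀ t ∈ F, (cube (v t) τ).toSet ⊆ A.region) ∧
      (∀ t ∈ F, ∀ t' ∈ F, t ≠ t' → (cube (v t) τ).Separated (cube (v t') τ)) ∧
      (∀ t ∈ F, ∀ i ∈ Bl, (cube (v t) τ).Separated (cube (p i) (r i))) ∧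
      F.card ≤ A.cells.card * ⌊D / τ⌋₊ ^ m ∧
      A.vol - ∑ i ∈ Bl, r i ^ m - A.cells.card * (m * (τ / S) * D ^ m)
        - Bl.card * (m * (τ / S) * (3 * S) ^ m) ≤ F.card * τ ^ m := by
  classical
  have hSpos : 0 < S := hτ.trans_le hS
  have hDpos : 0 < D := hSpos.trans_le hSD
  set nn : (Fin m → ℕ) → Fin m → ℕ := fun c i => ⌊(A.cell c).side i / τ⌋₊ with hnn
  set ts : (Fin m → ℕ) → Finset (Fin m → ℕ) := fun c => Fintype.piFinset fun i =>
    Finset.range (nn c i) with hts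
  set E : Finset ((Fin m → ℕ) × (Fin m → ℕ)) :=
    (A.cells.sigma ts).map (Equiv.sigmaEquivProd _ _).toEmbedding with hE
  set v : (Fin m → ℕ) × (Fin m → ℕ) → Fin m → ℝ := fun t i =>
    (A.cell t.1).lower i + t.2 i * τ with hv
  have hmemE : ∀ t, t ∈ E ↔ t.1 ∈ A.cells ∧ ∀ i, t.2 i < nn t.1 i := by
    rintro ⟨c, t⟩
    simp only [hE, Finset.mem_map_equiv, Finset.mem_sigma, hts, Fintype.mem_piFinset,
      Finset.mem_range]
    rfl
  have hcardE : E.card = ∑ c ∈ A.cells, ∏ i, nn c i := by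
    rw [hE, Finset.card_map, Finset.card_sigma]
    simp [hts]
  have hin : ∀ t ∈ E, ∀ i, (A.cell t.1).lower i ≤ v t i ∧
      v t i + τ ≤ (A.cell t.1).lower i + (A.cell t.1).side i := by
    intro t ht i
    obtain ⟨h1, h2⟩ := (hmemE t).1 ht
    have h3 := floor_div_mul_le hτ (h.cell_side_pos h1 i).le
    have h4 : (t.2 i : ℝ) + 1 ≤ nn t.1 i := by exact_mod_cast h2 i
    have h5 : (0 : ℝ) ≤ t.2 i := Nat.cast_nonneg _
    have h6 : ((t.2 i : ℝ) + 1) * τ ≤ nn t.1 i * τ := by gcongr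
    simp only [hv]
    simp only [hnn] at h6
    constructor <;> nlinarith
  have hEsep : ∀ t ∈ E, ∀ t' ∈ E, t ≠ t' → (cube (v t) τ).Separated (cube (v t') τ) := by
    intro t ht t' ht' hne
    obtain ⟨h1, h2⟩ := (hmemE t).1 ht
    obtain ⟨h1', h2'⟩ := (hmemE t').1 ht'
    by_cases hc : t.1 = t'.1
    · have : t.2 ≠ t'.2 := fun h => hne (Prod.ext hc h)
      obtain ⟨i, hi⟩ := Function.ne_iff.1 this
      refine ⟨i, ?_⟩
      simp only [cube, hv, hc]
      rcases lt_or_gt_of_ne hi with hlt | hlt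
      · left
        have : (t.2 i : ℝ) + 1 ≤ t'.2 i := by exact_mod_cast hlt
        nlinarith
      · right
        have : (t'.2 i : ℝ) + 1 ≤ t.2 i := by exact_mod_cast hlt
        nlinarith
    · exact (h.cell_separated h1 h1' hc).mono (hin t ht) (hin t' ht')
  set F := E.filter fun t => ∀ i ∈ Bl, (cube (v t) τ).Separated (cube (p i) (r i)) with hF
  refine ⟨F, v, fun t ht => ?_, fun t ht t' ht' => ?_, fun t ht => ?_, ?_, ?_⟩
  · have ht' := (Finset.mem_filter.1 ht).1
    have h1 : (A.cell t.1).toSet ⊆ A.region :=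
      Set.subset_biUnion_of_mem (u := fun c => (A.cell c).toSet) ((hmemE t).1 ht').1
    exact (Cuboid.toSet_subset (hin t ht')).trans h1
  · exact hEsep t (Finset.mem_filter.1 ht).1 t' (Finset.mem_filter.1 ht').1
  · exact (Finset.mem_filter.1 ht).2
  · refine (Finset.card_filter_le _ _).trans ?_
    rw [hcardE, ← smul_eq_mul]
    refine Finset.sum_le_card_nsmul _ _ _ fun c hc => ?_
    have := Finset.prod_le_pow_card Finset.univ (nn c) ⌊D / τ⌋₊ fun i _ => by
      apply Nat.floor_le_floor
      gcongr
      exact hD c hc i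
    simpa using this
  · have hcells : A.vol - A.cells.card * (m * (τ / S) * D ^ m) ≤ E.card * τ ^ m := by
      have : ∀ c ∈ A.cells, (A.cell c).vol - (m * (τ / S) * D ^ m) ≤ (∏ i, nn c i : ℕ) * τ ^ m := by
        intro c hc
        have h1 := prod_sub_prod_le Finset.univ (A.cell c).side (fun i => nn c i * τ) (τ := τ) hDpos
          fun i _ => ⟨by positivity, floor_div_mul_le hτ (h.cell_side_pos hc i).le, by
            have := sub_le_floor_div_mul (a := (A.cell c).side i) hτ
            simp only [hnn]; linarith, hD c hc i⟩
        have h2 : ((m : ℝ) * (τ / D) * D ^ m) ≤ m * (τ / S) * D ^ m := by gcongr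
        simp only [Finset.card_univ, Fintype.card_fin, Finset.prod_mul_distrib,
          Finset.prod_const] at h1
        push_cast
        simp only [Cuboid.vol]
        linarith
      calc _ = ∑ c ∈ A.cells, ((A.cell c).vol - (m * (τ / S) * D ^ m)) := by
            rw [Finset.sum_sub_distrib, Finset.sum_const, nsmul_eq_mul, Grid.vol]
        _ ≤ _ := by
            rw [hcardE, Nat.cast_sum, Finset.sum_mul]
            exact Finset.sum_le_sum this
    -- Small cubes that are not separated from a blocking cube of side `r` lie in its enlargement by
    -- `τ` on all sides, of side `r + 2 τ ≤ 3 S`. Being disjoint, they have total volume at most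
    -- that of the enlargement.
    have hbl : ∀ i ∈ Bl, ((E.filter fun t => ¬ (cube (v t) τ).Separated (cube (p i) (r i))).card : ℝ)
        * τ ^ m ≤ r i ^ m + m * (τ / S) * (3 * S) ^ m := by
      intro i hi
      have h1 := sum_vol_le_of_subset
        (E.filter fun t => ¬ (cube (v t) τ).Separated (cube (p i) (r i)))
        (fun t => cube (v t) τ) {()} (fun _ => cube (fun j => p i j - τ) (r i + 2 * τ))
        (fun _ _ _ => hτ.le) (fun _ _ _ => by simp only [cube]; linarith [(hr i hi).1])
        (fun t ht t' ht' => hEsep t (Finset.mem_filter.1 ht).1 t' (Finset.mem_filter.1 ht').1)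
        (fun t ht => by
          refine Set.Subset.trans (Cuboid.toSet_subset fun j => ?_) (Set.subset_biUnion_of_mem
            (u := fun _ : Unit => (cube (fun j => p i j - τ) (r i + 2 * τ)).toSet)
            (Finset.mem_singleton_self ()))
          have := (Finset.mem_filter.1 ht).2
          simp only [Cuboid.Separated, not_exists, not_or, not_le, cube] at this ⊢
          have := this j
          constructor <;> linarith)
      simp only [vol_cube, Finset.sum_const, nsmul_eq_mul, Finset.card_singleton, Nat.cast_one,
        one_mul] at h1
      have h2 := prod_sub_prod_le (Finset.univ : Finset (Fin m)) (fun _ => r i + 2 * τ)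
        (fun _ => r i) (τ := 2 * τ) (D := 3 * S) (by linarith)
        fun _ _ => ⟨(hr i hi).1, by linarith, le_rfl, by linarith [(hr i hi).2]⟩
      simp only [Finset.card_univ, Fintype.card_fin, Finset.prod_const] at h2
      have h3 : (m : ℝ) * (2 * τ / (3 * S)) * (3 * S) ^ m ≤ m * (τ / S) * (3 * S) ^ m := by
        gcongr (m : ℝ) * ?_ * _
        rw [div_le_div_iff₀ (by linarith) hSpos]
        nlinarith
      linarith
    have hcover : (E.card : ℝ) ≤ F.card +
        ∑ i ∈ Bl, ((E.filter fun t => ¬ (cube (v t) τ).Separated (cube (p i) (r i))).card : ℝ) := by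
      have : E ⊆ F ∪ Bl.biUnion fun i =>
          E.filter fun t => ¬ (cube (v t) τ).Separated (cube (p i) (r i)) := by
        intro t ht
        by_cases hb : ∀ i ∈ Bl, (cube (v t) τ).Separated (cube (p i) (r i))
        · exact Finset.mem_union_left _ (Finset.mem_filter.2 ⟨ht, hb⟩)
        · push Not at hb
          obtain ⟨i, hi, hb⟩ := hb
          exact Finset.mem_union_right _ (Finset.mem_biUnion.2 ⟨i, hi, Finset.mem_filter.2 ⟨ht, hb⟩⟩)
      have h1 := (Finset.card_le_card this).trans (Finset.card_union_le _ _)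
      have h2 := h1.trans (Nat.add_le_add_left Finset.card_biUnion_le _)
      exact_mod_cast h2
    have h4 : (E.card : ℝ) * τ ^ m ≤ F.card * τ ^ m +
        ∑ i ∈ Bl, (r i ^ m + m * (τ / S) * (3 * S) ^ m) := by
      refine (mul_le_mul_of_nonneg_right hcover (by positivity)).trans ?_
      rw [add_mul, Finset.sum_mul]
      gcongr with i hi
      exact hbl i hi
    rw [Finset.sum_add_distrib, Finset.sum_const, nsmul_eq_mul] at h4
    linarith

end Grid

/-! ### Sections of admissible instances, and single additional boxes. -/

section Sections

variable {m q : ℕ}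

/-- The sections of a packing of height `h`: the measure `x J` of the set of points of
`B × [0, h]` over which exactly the items in `J` lie, and the positions `p` of the items in the
short coordinates. -/
structure Sections (I : StripInstance m q) (h : ℝ) where
  p : Fin I.n → Fin m → ℝ
  x : Finset (Fin I.n) → ℝ
  sub : ∀ i, (cube (p i) (I.size i)).toSet ⊆ I.A.region
  nonneg : ∀ J, 0 ≤ x J
  sep : ∀ J, x J ≠ 0 → ∀ i ∈ J, ∀ i' ∈ J, i ≠ i' →
    (cube (p i) (I.size i)).Separated (cube (p i') (I.size i'))
  cover : ∀ i, ∑ J ∈ Finset.univ.filter (i ∈ ·), x J = I.size i ^ (q + 1)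
  total : ∑ J, x J = (∏ j, I.b j) * h

theorem card_coord : Fintype.card (Coord m q) = m + (q + 1) := by
  simp [Coord]

namespace StripInstance.IsAdmissible

variable {I : StripInstance m q} {N : ℕ} {α : ℝ}

theorem b_pos (h : I.IsAdmissible N α) (hN : 1 ≤ N) (hα : 1 ≤ α) (j : Fin q) : 0 < I.b j :=
  h.maxSize_pos.trans_le (h.maxSize_le_b hN hα j)

theorem prod_b_pos (h : I.IsAdmissible N α) (hN : 1 ≤ N) (hα : 1 ≤ α) : 0 < ∏ j, I.b j :=
  Finset.prod_pos fun j _ => h.b_pos hN hα j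

theorem pow_maxSize_le (h : I.IsAdmissible N α) (hN : 1 ≤ N) (hα : 1 ≤ α) :
    I.maxSize ^ q ≤ ∏ j, I.b j := by
  rw [← Fin.prod_const]
  exact Finset.prod_le_prod (fun _ _ => h.maxSize_pos.le) fun j _ => h.maxSize_le_b hN hα j

theorem vol_le (h : I.IsAdmissible N α) (hα : 1 ≤ α) :
    I.A.vol ≤ N * α ^ m * I.maxSize ^ m := by
  have hS := h.maxSize_pos
  calc I.A.vol ≤ ∑ c ∈ I.A.cells, (α * I.maxSize) ^ m := by
        refine Finset.sum_le_sum fun c hc => ?_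
        rw [← Fin.prod_const]
        exact Finset.prod_le_prod (fun i _ => (h.isGrid.cell_side_pos hc i).le)
          fun i _ => h.short c hc i
    _ = I.A.cells.card * (α * I.maxSize) ^ m := by rw [Finset.sum_const, nsmul_eq_mul]
    _ ≤ N * (α * I.maxSize) ^ m := by
        gcongr
        exact h.card_cells
    _ = _ := by rw [mul_pow]; ring

theorem exists_base_cube (h : I.IsAdmissible N α) :
    ∃ p : Fin m → ℝ, (cube p I.maxSize).toSet ⊆ I.A.region := by
  obtain ⟨i, hi⟩ := I.exists_size_eq_maxSize h.nonempty
  obtain ⟨p, hp⟩ := h.fits i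
  refine ⟨shortPart p, fun x hx => ?_⟩
  have : Sum.elim x (fun j => p (.inr j)) ∈ (cube p (I.size i)).toSet := by
    rw [Cuboid.mem_toSet] at hx ⊢
    rintro (j | j)
    · rw [hi]
      exact hx j
    · simpa [cube] using (h.size_pos i).le
  exact (hp this).1

/-- Small items can be packed into one additional box. -/
theorem boxable_of_size_le (h : I.IsAdmissible N α) (hN : 1 ≤ N) (hα : 1 ≤ α)
    (L : Finset (Fin I.n)) {δ : ℝ}
    (hδ : 2 * δ ≤ (1 / (2 * (2 * Fintype.card (Coord m q) + 1))) ^ 2)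
    (hL : ∀ i ∈ L, I.size i ≤ δ * I.maxSize) :
    Boxable I L (4 * (∑ i ∈ L, I.size i ^ Fintype.card (Coord m q)) /
      (I.maxSize ^ m * ∏ j, I.b j) + I.maxSize) 1 := by
  classical
  set d := Fintype.card (Coord m q) with hd
  set V := ∑ i ∈ L, I.size i ^ d
  have hS := h.maxSize_pos
  have hβ := h.prod_b_pos hN hα
  have hV : 0 ≤ V := Finset.sum_nonneg fun i _ => pow_nonneg (h.size_pos i).le _
  have hV' : 0 ≤ 4 * V / (I.maxSize ^ m * ∏ j, I.b j) := by positivity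
  rcases L.eq_empty_or_nonempty with rfl | hne
  · exact (Boxable.empty I).mono le_rfl (by linarith) (by omega)
  obtain ⟨i₀, hi₀, hmax⟩ := Finset.exists_max_image L I.size hne
  obtain ⟨p, hp⟩ := h.exists_base_cube
  have hcol : ColumnHolds I I.maxSize (4 * V / (I.maxSize ^ m * ∏ j, I.b j) + I.maxSize) L := by
    -- With this value the density factor is `1/2`, and `(1 - η)^m ≥ 1/2` by Bernoulli, so at least
    -- a quarter of the volume is usable. This is the origin of the factor `4` in the height.
    set η : ℝ := 1 / (2 * (2 * d + 1)) with hη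
    have hη0 : 0 < η := by positivity
    have hη1 : (2 * (d : ℝ) + 1) * η = 1 / 2 := by rw [hη]; field_simp
    refine columnHolds_of_sum_le (h.maxSize_le_b hN hα) h.size_pos i₀ hη0 (by rw [hη1]; norm_num)
      hmax ?_ le_rfl (by linarith) ?_
    · have := hL i₀ hi₀
      nlinarith
    · rw [hη1, add_sub_cancel_right]
      have hm : (m : ℝ) ≤ d := by rw [hd, card_coord]; push_cast; linarith [(Nat.cast_nonneg q : (0:ℝ) ≤ q)]
      have hmη : 1 / 2 ≤ (1 - η) ^ m := by
        have := one_add_mul_le_pow (a := -η) (by nlinarith) m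
        rw [← sub_eq_add_neg] at this
        nlinarith
      have : (1 - 1 / 2) * (((1 - η) * I.maxSize) ^ m * ((∏ j, I.b j) *
          (4 * V / (I.maxSize ^ m * ∏ j, I.b j)))) = 2 * V * (1 - η) ^ m := by
        rw [mul_pow]; field_simp; ring
      rw [this]
      nlinarith
  have := boxable_of_columns (ι := Unit) (fun _ => p) (fun _ => I.maxSize) (fun _ => L)
    (fun t t' hne => absurd rfl hne) (fun _ => hp) (fun _ => hcol) L fun i hi => ⟨(), hi⟩
  simpa using this

/-- A few items can be packed into one additional box. -/
theorem boxable_of_card_le (h : I.IsAdmissible N α) (hN : 1 ≤ N) (hα : 1 ≤ α)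
    (L : Finset (Fin I.n)) {g : ℝ} (hg : L.card ≤ g) :
    Boxable I L (g * I.maxSize ^ (q + 1) / (∏ j, I.b j) + I.maxSize) 1 := by
  classical
  have hS := h.maxSize_pos
  have hβ := h.prod_b_pos hN hα
  obtain ⟨i₀, hi₀⟩ := I.exists_size_eq_maxSize h.nonempty
  obtain ⟨p, hp⟩ := h.exists_base_cube
  have hg0 : 0 ≤ g := (Nat.cast_nonneg _).trans hg
  have hx0 : 0 ≤ g * I.maxSize ^ (q + 1) / (∏ j, I.b j) := by positivity
  have hcol : ColumnHolds I I.maxSize (g * I.maxSize ^ (q + 1) / (∏ j, I.b j) + I.maxSize) L := by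
    refine columnHolds_of_card_le (fun j => (h.b_pos hN hα j).le) h.size_pos i₀
      (fun i _ => hi₀ ▸ I.size_le_maxSize i) hi₀.le (by linarith) ?_
    have := le_columnCapacity (I := I) (fun j => (h.b_pos hN hα j).le) hS le_rfl hx0
    rw [mul_div_cancel₀ _ hβ.ne'] at this
    have := le_of_mul_le_mul_right this (by positivity)
    rw [hi₀]
    exact_mod_cast hg.trans this
  have := boxable_of_columns (ι := Unit) (fun _ => p) (fun _ => I.maxSize) (fun _ => L)
    (fun t t' hne => absurd rfl hne) (fun _ => hp) (fun _ => hcol) L fun i hi => ⟨(), hi⟩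
  simpa using this

end StripInstance.IsAdmissible

namespace Sections

variable {I : StripInstance m q} {N : ℕ} {α h : ℝ}

/-- Double counting: `s(i)^(q+1)` is the total measure of the sections containing `i`. Through this
identity, sums over items become averages over sections. -/
theorem sum_mul_pow (X : Sections I h) (Q : Finset (Fin I.n)) (f : Fin I.n → ℝ) :
    ∑ i ∈ Q, f i * I.size i ^ (q + 1) = ∑ J, X.x J * ∑ i ∈ Q.filter (· ∈ J), f i := by
  simp_rw [← X.cover, Finset.mul_sum]
  rw [Finset.sum_comm' (t' := Finset.univ) (s' := fun J => Q.filter (· ∈ J))]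
  · exact Finset.sum_congr rfl fun J _ => Finset.sum_congr rfl fun i _ => mul_comm _ _
  · intro i J
    simp

/-- The short projections of the items of an occurring section are disjoint cubes inside the grid.
-/
theorem sum_pow_le_vol (X : Sections I h) (hI : I.IsAdmissible N α) {J : Finset (Fin I.n)} (hJ : X.x J ≠ 0) :
    ∑ i ∈ J, I.size i ^ m ≤ I.A.vol := by
  have := sum_vol_le_of_subset J (fun i => cube (X.p i) (I.size i)) I.A.cells I.A.cell
    (fun i _ _ => (hI.size_pos i).le) (fun c hc j => (hI.isGrid.cell_side_pos hc j).le)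
    (X.sep J hJ) (fun i _ => X.sub i)
  simpa [vol_cube, Grid.vol] using this

theorem sum_pow_le (X : Sections I h) (hI : I.IsAdmissible N α) (hα : 1 ≤ α) :
    ∑ i, I.size i ^ Fintype.card (Coord m q) ≤
      N * α ^ m * (I.maxSize ^ m * ((∏ j, I.b j) * h)) := by
  simp_rw [card_coord, pow_add _ m]
  rw [X.sum_mul_pow]
  calc _ ≤ ∑ J, X.x J * (N * α ^ m * I.maxSize ^ m) := by
        refine Finset.sum_le_sum fun J _ => ?_
        by_cases hJ : X.x J = 0
        · simp [hJ]
        · refine mul_le_mul_of_nonneg_left ?_ (X.nonneg J)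
          refine le_trans ?_ ((X.sum_pow_le_vol hI hJ).trans (hI.vol_le hα))
          rw [Finset.filter_mem_eq_inter, Finset.univ_inter]
    _ = _ := by rw [← Finset.sum_mul, X.total]; ring

/-- Each large item takes base volume at least `(δ ŝ)^m` out of at most `N α^m ŝ^m`. The resulting
bound does not depend on the instance and makes the number of section types finite. -/
theorem card_large_le (X : Sections I h) (hI : I.IsAdmissible N α) (hα : 1 ≤ α) {δ : ℝ} (hδ : 0 < δ)
    {J : Finset (Fin I.n)} (hJ : X.x J ≠ 0) :
    (J.filter (δ * I.maxSize ≤ I.size ·)).card ≤ ⌊N * α ^ m / δ ^ m⌋₊ := by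
  apply Nat.le_floor
  have hS := hI.maxSize_pos
  rw [le_div_iff₀ (by positivity)]
  have h1 : ((J.filter (δ * I.maxSize ≤ I.size ·)).card : ℝ) * (δ * I.maxSize) ^ m ≤
      N * α ^ m * I.maxSize ^ m := by
    rw [← nsmul_eq_mul]
    refine (Finset.card_nsmul_le_sum _ (fun i => I.size i ^ m) _ fun i hi => ?_).trans
      (le_trans ?_ ((X.sum_pow_le_vol hI hJ).trans (hI.vol_le hα)))
    · have := (Finset.mem_filter.1 hi).2
      gcongr
    · exact Finset.sum_le_sum_of_subset_of_nonneg (Finset.filter_subset _ _)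
        fun i _ _ => pow_nonneg (hI.size_pos i).le _
  rw [mul_pow, ← mul_assoc] at h1
  exact le_of_mul_le_mul_right h1 (by positivity)

end Sections

theorem IsPacking.nonempty_sections {I : StripInstance m q} {N : ℕ} {α h : ℝ}
    (hI : I.IsAdmissible N α) (hN : 1 ≤ N) (hα : 1 ≤ α) {pos : Fin I.n → Coord m q → ℝ}
    (H : IsPacking I.size pos (container I.A I.b h)) : 0 ≤ h ∧ Nonempty (Sections I h) := by
  have hh : 0 ≤ h := by
    have : pos ⟨0, hI.nonempty⟩ ∈ container I.A I.b h :=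
      H.1 ⟨0, hI.nonempty⟩ (Cuboid.mem_toSet.2 fun j =>
        ⟨le_rfl, by simp only [cube]; linarith [hI.size_pos ⟨0, hI.nonempty⟩]⟩)
    exact this.2.2.1.trans this.2.2.2
  obtain ⟨h1, x, h2, h3, h4, h5⟩ :=
    H.exists_sections hI.size_pos (fun j => (hI.b_pos hN hα j).le) hh
  exact ⟨hh, ⟨⟨fun i => shortPart (pos i), x, h1, h2, h3, h4, h5⟩⟩⟩

end Sections

/-! ### Representative sections, and the room they offer to large and small items. -/

namespace Sections

variable {m q : ℕ} {I : StripInstance m q} {N : ℕ} {α h : ℝ}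

theorem sum_group_eq_sum_card {n : ℕ} (T : Finset (Fin n)) (grp : Fin n → ℕ) (G : ℕ)
    (hG : ∀ i ∈ T, grp i < G) (f : ℕ → ℝ) :
    ∑ i ∈ T, f (grp i) = ∑ j ∈ Finset.range G, (T.filter (grp · = j)).card * f j := by
  rw [← Finset.sum_fiberwise_of_maps_to (g := grp) (t := Finset.range G)
    fun i hi => Finset.mem_range.2 (hG i hi)]
  refine Finset.sum_congr rfl fun j _ => ?_
  rw [← nsmul_eq_mul, ← Finset.sum_const]
  exact Finset.sum_congr rfl fun i hi => by rw [(Finset.mem_filter.1 hi).2]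

/-- Sections with the same number of items in every group are represented by one of them. -/
theorem exists_representatives (X : Sections I h) (Lg : Finset (Fin I.n)) (grp : Fin I.n → ℕ)
    (G P : ℕ) (hG : ∀ i ∈ Lg, grp i < G)
    (hP : ∀ J, X.x J ≠ 0 → (Lg.filter (· ∈ J)).card ≤ P) :
    ∃ (T : Finset (Finset (Fin I.n))) (y : Finset (Fin I.n) → ℝ), T.card ≤ (P + 1) ^ G ∧
      (∀ J ∈ T, X.x J ≠ 0) ∧ (∀ J, 0 ≤ y J) ∧ ∑ J ∈ T, y J = ∑ J, X.x J ∧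
      ∀ f : ℕ → ℝ, ∑ J ∈ T, y J * ∑ i ∈ Lg.filter (· ∈ J), f (grp i) =
        ∑ J, X.x J * ∑ i ∈ Lg.filter (· ∈ J), f (grp i) := by
  classical
  set s := (Finset.univ : Finset (Finset (Fin I.n))).filter fun J => X.x J ≠ 0 with hs
  -- The type of a section counts its items in each group. The `min P` only serves to land in `Fin
  -- (P + 1)`; it never cuts off a section of nonzero measure.
  set typ : Finset (Fin I.n) → Fin G → Fin (P + 1) := fun J j =>
    ⟨min P ((Lg.filter (· ∈ J)).filter (grp · = j)).card, by omega⟩ with htyp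
  set pick : (Fin G → Fin (P + 1)) → Finset (Fin I.n) := fun t =>
    if H : ∃ J ∈ s, typ J = t then H.choose else ∅ with hpick
  have hpick1 : ∀ J ∈ s, pick (typ J) ∈ s ∧ typ (pick (typ J)) = typ J := by
    intro J hJ
    have H : ∃ J' ∈ s, typ J' = typ J := ⟨J, hJ, rfl⟩
    simp only [hpick, dif_pos H]
    exact H.choose_spec
  have hsx : ∀ J, J ∈ s ↔ X.x J ≠ 0 := fun J => by simp [hs]
  have hmaps : ∀ J ∈ s, pick (typ J) ∈ (s.image typ).image pick := fun J hJ =>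
    Finset.mem_image_of_mem _ (Finset.mem_image_of_mem _ hJ)
  have hcard : ∀ J ∈ s, ∀ j < G, ((Lg.filter (· ∈ pick (typ J))).filter (grp · = j)).card =
      ((Lg.filter (· ∈ J)).filter (grp · = j)).card := by
    intro J hJ j hj
    have h1 := congrFun (hpick1 J hJ).2 ⟨j, hj⟩
    simp only [htyp, Fin.mk.injEq] at h1
    have h2 := (Finset.card_filter_le _ (grp · = j)).trans (hP J ((hsx J).1 hJ))
    have h3 := (Finset.card_filter_le _ (grp · = j)).trans (hP _ ((hsx _).1 (hpick1 J hJ).1))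
    rwa [min_eq_right h2, min_eq_right h3] at h1
  -- The representative receives the total measure of its type, so averages of functions depending
  -- only on the type do not change.
  have hsum : ∀ F : Finset (Fin I.n) → ℝ, (∀ J ∈ s, F (pick (typ J)) = F J) →
      ∑ J ∈ (s.image typ).image pick, (∑ J' ∈ s.filter (fun J' => pick (typ J') = J), X.x J') * F J =
        ∑ J, X.x J * F J := by
    intro F hF
    have h1 : ∑ J, X.x J * F J = ∑ J ∈ s, X.x J * F J := by
      symm
      refine Finset.sum_subset (Finset.subset_univ _) fun J _ hJ => ?_
      rw [hsx, not_not] at hJ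
      rw [hJ, zero_mul]
    rw [h1, ← Finset.sum_fiberwise_of_maps_to hmaps]
    refine Finset.sum_congr rfl fun J _ => ?_
    rw [Finset.sum_mul]
    refine Finset.sum_congr rfl fun J' hJ' => ?_
    obtain ⟨h2, h3⟩ := Finset.mem_filter.1 hJ'
    rw [← hF J' h2, h3]
  refine ⟨(s.image typ).image pick,
    fun J => ∑ J' ∈ s.filter (fun J' => pick (typ J') = J), X.x J', ?_, ?_, ?_, ?_, ?_⟩
  · refine Finset.card_image_le.trans ((Finset.card_le_univ _).trans ?_)
    simp
  · intro J hJ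
    simp only [Finset.mem_image] at hJ
    obtain ⟨t, ⟨J', hJ', rfl⟩, rfl⟩ := hJ
    exact (hsx _).1 (hpick1 J' hJ').1
  · exact fun J => Finset.sum_nonneg fun J' _ => X.nonneg J'
  · simpa using hsum (fun _ => 1) fun _ _ => rfl
  · intro f
    refine hsum (fun J => ∑ i ∈ Lg.filter (· ∈ J), f (grp i)) fun J hJ => ?_
    rw [sum_group_eq_sum_card _ grp G (fun i hi => hG i (Finset.mem_filter.1 hi).1),
      sum_group_eq_sum_card _ grp G (fun i hi => hG i (Finset.mem_filter.1 hi).1)]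
    exact Finset.sum_congr rfl fun j hj => by rw [hcard J hJ j (Finset.mem_range.1 hj)]

/-- Every group of items but the first fits into the places of the group before it. -/
theorem exists_slots (X : Sections I h) (hI : I.IsAdmissible N α) (hN : 1 ≤ N) (hα : 1 ≤ α)
    (Lg : Finset (Fin I.n)) (grp : Fin I.n → ℕ) (g : ℕ)
    (hg1 : ∀ j, (Lg.filter (grp · = j)).card ≤ g)
    (hg2 : ∀ i ∈ Lg, ∀ j < grp i, (Lg.filter (grp · = j)).card = g)
    (hg3 : ∀ i ∈ Lg, ∀ i' ∈ Lg, grp i < grp i' → I.size i' ≤ I.size i)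
    (a : ℕ → Fin I.n) (ha : ∀ j, (Lg.filter (grp · = j + 1)).Nonempty →
      a j ∈ Lg.filter (grp · = j + 1))
    (T : Finset (Finset (Fin I.n))) (y : Finset (Fin I.n) → ℝ) (hy : ∀ J, 0 ≤ y J)
    (hf : ∀ f : ℕ → ℝ, ∑ J ∈ T, y J * ∑ i ∈ Lg.filter (· ∈ J), f (grp i) =
        ∑ J, X.x J * ∑ i ∈ Lg.filter (· ∈ J), f (grp i)) :
    ∃ R : Finset (Fin I.n) → Fin I.n → Finset (Fin I.n),
      (∀ J i, (Lg.filter (grp · = grp i + 1)).Nonempty → R J i ⊆ Lg.filter (grp · = grp i + 1) ∧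
        (R J i).card ≤ columnCapacity I (I.size (a (grp i))) (y J / (∏ j, I.b j) + I.maxSize)) ∧
      ∀ i' ∈ Lg, 0 < grp i' → ∃ J ∈ T, ∃ i ∈ Lg, i ∈ J ∧
        (Lg.filter (grp · = grp i + 1)).Nonempty ∧ i' ∈ R J i := by
  classical
  have hβ := hI.prod_b_pos hN hα
  have key : ∀ j, (Lg.filter (grp · = j + 1)).Nonempty →
      ∃ R : (_ : Finset (Fin I.n)) × Fin I.n → Finset (Fin I.n),
        (∀ t, R t ⊆ Lg.filter (grp · = j + 1) ∧
          (R t).card ≤ columnCapacity I (I.size (a j)) (y t.1 / (∏ j, I.b j) + I.maxSize)) ∧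
        ∀ i' ∈ Lg.filter (grp · = j + 1), ∃ t ∈ T.sigma fun J =>
          (Lg.filter (· ∈ J)).filter (grp · = j), i' ∈ R t := by
    intro j hj
    refine exists_distribution_of_card_le _
      (fun t : (_ : Finset (Fin I.n)) × Fin I.n => columnCapacity I (I.size (a j)) (y t.1 / (∏ j, I.b j) + I.maxSize)) _ ?_
    set r := I.size (a j) with hr
    have hr0 : 0 < r := hI.size_pos _
    obtain ⟨haL, haj⟩ := Finset.mem_filter.1 (ha j hj)
    -- Group `j` precedes a nonempty group, so it is full and at least as numerous as group `j + 1`.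
    have hcard : (Lg.filter (grp · = j + 1)).card ≤ (Lg.filter (grp · = j)).card := by
      rw [hg2 _ haL j (by omega)]
      exact hg1 _
    -- Capacities are compared in units of `r^(q+1)`. The items of group `j` are no smaller than
    -- `r`, so their total measure, which is the measure of their places in the representatives, is
    -- at least `r^(q+1)` per item; the columns over these places offer at least as much.
    have h1 : ((Lg.filter (grp · = j)).card : ℝ) * r ^ (q + 1) ≤
        ∑ i ∈ Lg.filter (grp · = j), 1 * I.size i ^ (q + 1) := by
      rw [← nsmul_eq_mul]
      refine Finset.card_nsmul_le_sum _ _ _ fun i hi => ?_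
      obtain ⟨hiL, hij⟩ := Finset.mem_filter.1 hi
      have := hg3 i hiL (a j) haL (by omega)
      rw [one_mul]
      gcongr
    rw [X.sum_mul_pow] at h1
    have h2 := hf fun k => if k = j then 1 else 0
    have h3 : ∀ J : Finset (Fin I.n), ∑ i ∈ Lg.filter (· ∈ J), (if grp i = j then (1 : ℝ) else 0) =
        ((Lg.filter (· ∈ J)).filter (grp · = j)).card := fun J => by
      rw [Finset.sum_boole]
    have h4 : ∀ J : Finset (Fin I.n), ∑ i ∈ (Lg.filter (grp · = j)).filter (· ∈ J), (1 : ℝ) =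
        ((Lg.filter (· ∈ J)).filter (grp · = j)).card := fun J => by
      rw [Finset.sum_const, nsmul_eq_mul, mul_one, Finset.filter_comm]
    simp_rw [h3] at h2
    simp_rw [h4] at h1
    rw [← h2] at h1
    have h5 : ∑ J ∈ T, y J * (((Lg.filter (· ∈ J)).filter (grp · = j)).card : ℝ) ≤
        (∑ t ∈ T.sigma fun J => (Lg.filter (· ∈ J)).filter (grp · = j),
          columnCapacity I r (y t.1 / (∏ j, I.b j) + I.maxSize) : ℕ) * r ^ (q + 1) := by
      rw [Finset.sum_sigma, Nat.cast_sum, Finset.sum_mul]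
      refine Finset.sum_le_sum fun J _ => ?_
      have h6 := le_columnCapacity (I := I) (fun j => (hI.b_pos hN hα j).le) hr0
        (I.size_le_maxSize _) (div_nonneg (hy J) hβ.le)
      rw [mul_div_cancel₀ _ hβ.ne'] at h6
      simp only [Finset.sum_const, smul_eq_mul]
      rw [Nat.cast_mul, mul_comm (y J), mul_assoc]
      gcongr
    have h7 := le_of_mul_le_mul_right (h1.trans h5) (by positivity)
    exact hcard.trans (by exact_mod_cast h7)
  choose! R hR1 hR2 using key
  refine ⟨fun J i => R (grp i) ⟨J, i⟩, fun J i hi => hR1 (grp i) hi ⟨J, i⟩, fun i' hi' h0 => ?_⟩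
  obtain ⟨j, hj⟩ : ∃ j, grp i' = j + 1 := ⟨grp i' - 1, by omega⟩
  have hmem : i' ∈ Lg.filter (grp · = j + 1) := Finset.mem_filter.2 ⟨hi', hj⟩
  obtain ⟨⟨J, i⟩, ht, hiR⟩ := hR2 j ⟨i', hmem⟩ i' hmem
  simp only [Finset.mem_sigma, Finset.mem_filter] at ht
  obtain ⟨hJ, ⟨hiL, hiJ⟩, rfl⟩ := ht
  exact ⟨J, hJ, i, hiL, hiJ, ⟨i', hmem⟩, hiR⟩

/-- The space that the rounded large items leave free suffices for the small items. -/
theorem sum_small_le (X : Sections I h) (hI : I.IsAdmissible N α)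
    (Lg Sm : Finset (Fin I.n)) (hdisj : Disjoint Lg Sm) (grp : Fin I.n → ℕ) (f : ℕ → ℝ)
    (hfs : ∀ i ∈ Lg, f (grp i) ≤ I.size i ^ m)
    (T : Finset (Finset (Fin I.n))) (y : Finset (Fin I.n) → ℝ) (hy : ∀ J, 0 ≤ y J)
    (hsum : ∑ J ∈ T, y J = ∑ J, X.x J)
    (hf : ∀ f : ℕ → ℝ, ∑ J ∈ T, y J * ∑ i ∈ Lg.filter (· ∈ J), f (grp i) =
        ∑ J, X.x J * ∑ i ∈ Lg.filter (· ∈ J), f (grp i)) (free : Finset (Fin I.n) → ℝ) (loss : ℝ)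
    (hfree : ∀ J ∈ T, I.A.vol - ∑ i ∈ Lg.filter (· ∈ J), f (grp i) - loss ≤ free J) :
    ∑ i ∈ Sm, I.size i ^ Fintype.card (Coord m q) ≤
      ∑ J ∈ T, y J * free J + loss * ((∏ j, I.b j) * h) := by
  classical
  have h1 : ∑ J ∈ T, y J * (I.A.vol - ∑ i ∈ Lg.filter (· ∈ J), f (grp i) - loss) ≤
      ∑ J ∈ T, y J * free J :=
    Finset.sum_le_sum fun J hJ => mul_le_mul_of_nonneg_left (hfree J hJ) (hy J)
  have h2 : ∑ J ∈ T, y J * (I.A.vol - ∑ i ∈ Lg.filter (· ∈ J), f (grp i) - loss) =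
      ∑ J, X.x J * (I.A.vol - ∑ i ∈ Lg.filter (· ∈ J), f (grp i)) -
        loss * ((∏ j, I.b j) * h) := by
    simp_rw [mul_sub, Finset.sum_sub_distrib]
    rw [hf f, ← Finset.sum_mul, ← Finset.sum_mul, ← Finset.sum_mul, hsum, X.total]
    ring
  -- In every occurring section large and small cubes share the base, so the small ones have at most
  -- the volume not taken by the large ones, and a fortiori at most that not taken by the
  -- rounded-down ones.
  have h3 : ∑ i ∈ Sm, I.size i ^ Fintype.card (Coord m q) ≤
      ∑ J, X.x J * (I.A.vol - ∑ i ∈ Lg.filter (· ∈ J), f (grp i)) := by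
    simp_rw [card_coord, pow_add _ m]
    rw [X.sum_mul_pow]
    refine Finset.sum_le_sum fun J _ => ?_
    by_cases hJ : X.x J = 0
    · simp [hJ]
    refine mul_le_mul_of_nonneg_left ?_ (X.nonneg J)
    have h4 := X.sum_pow_le_vol hI hJ
    have h5 : ∑ i ∈ Lg.filter (· ∈ J), f (grp i) ≤ ∑ i ∈ Lg.filter (· ∈ J), I.size i ^ m :=
      Finset.sum_le_sum fun i hi => hfs i (Finset.mem_filter.1 hi).1
    have h6 : ∑ i ∈ Lg.filter (· ∈ J), I.size i ^ m + ∑ i ∈ Sm.filter (· ∈ J), I.size i ^ m ≤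
        ∑ i ∈ J, I.size i ^ m := by
      rw [← Finset.sum_union (hdisj.mono (Finset.filter_subset _ _) (Finset.filter_subset _ _))]
      refine Finset.sum_le_sum_of_subset_of_nonneg ?_ fun i _ _ => pow_nonneg (hI.size_pos i).le _
      intro i hi
      simp only [Finset.mem_union, Finset.mem_filter] at hi
      tauto
    linarith
  linarith

end Sections

/-! ### The main construction. -/

namespace Sections

variable {m q : ℕ} {I : StripInstance m q} {N : ℕ} {α h : ℝ}

/-- The small items fill the free cubes above the base, up to a remainder `L`. -/
theorem exists_fill (hI : I.IsAdmissible N α) (hN : 1 ≤ N) (hα : 1 ≤ α)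
    (Sm : Finset (Fin I.n)) {μ η θ : ℝ} (hη : 0 < η)
    (hη1 : (2 * Fintype.card (Coord m q) + 1) * η ≤ 1) (hθ : 0 < θ) (hθ1 : θ ≤ 1)
    (hμ : 2 * μ ≤ η ^ 2 * θ) (hSm : ∀ i ∈ Sm, I.size i ≤ μ * I.maxSize)
    (T : Finset (Finset (Fin I.n))) (y : Finset (Fin I.n) → ℝ) (hy : ∀ J, 0 ≤ y J)
    {γ : Type} [DecidableEq γ] (F : Finset (Fin I.n) → Finset γ) (K : ℕ)
    (hK : ∑ J ∈ T, (F J).card ≤ K) (V W : ℝ) (hSmV : ∑ i ∈ Sm, I.size i ^ Fintype.card (Coord m q) ≤ V)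
    (hF : ∑ i ∈ Sm, I.size i ^ Fintype.card (Coord m q) ≤
      ∑ J ∈ T, y J * ((F J).card * (θ * I.maxSize) ^ m) + W) (hW : 0 ≤ W) :
    ∃ (F' : Finset (Fin I.n) → Finset γ) (R : Finset (Fin I.n) → γ → Finset (Fin I.n))
      (L : Finset (Fin I.n)), (∀ J, F' J ⊆ F J) ∧ L ⊆ Sm ∧
      (∀ J, ∀ t ∈ F' J,
        ColumnHolds I (θ * I.maxSize) (y J / (∏ j, I.b j) + I.maxSize) (R J t)) ∧
      (∀ i ∈ Sm, i ∈ L ∨ ∃ J ∈ T, ∃ t ∈ F' J, i ∈ R J t) ∧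
      ∑ i ∈ L, I.size i ^ Fintype.card (Coord m q) ≤
        (1 - (1 - (2 * Fintype.card (Coord m q) + 1) * η) * (1 - η) ^ m) * V + W +
          K * I.maxSize ^ Fintype.card (Coord m q) := by
  classical
  set d := Fintype.card (Coord m q) with hd
  have hS := hI.maxSize_pos
  have hβ := hI.prod_b_pos hN hα
  have hd1 : (1 : ℝ) ≤ d := by
    have : 0 < d := Fintype.card_pos_iff.2 ⟨.inr (.inr ())⟩
    exact_mod_cast this
  have hη2 : η < 1 := by nlinarith
  set c₂ := (1 - (2 * (d : ℝ) + 1) * η) * (1 - η) ^ m with hc₂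
  have hc0 : 0 ≤ c₂ := mul_nonneg (by linarith) (pow_nonneg (by linarith) _)
  have hc1 : c₂ ≤ 1 := mul_le_one₀ (by nlinarith) (pow_nonneg (by linarith) _)
    (pow_le_one₀ (by linarith) (by linarith))
  have hv0 : 0 ≤ ∑ i ∈ Sm, I.size i ^ d := Finset.sum_nonneg fun i _ => pow_nonneg (hI.size_pos i).le _
  have hV0 : 0 ≤ V := hv0.trans hSmV
  have hr0 : 0 ≤ (1 - c₂) * V + W + K * I.maxSize ^ d := by
    have : 0 ≤ (1 - c₂) * V := mul_nonneg (by linarith) hV0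
    positivity
  rcases Sm.eq_empty_or_nonempty with rfl | hne
  -- Without small items there is no item size to measure the V-Boxes by, so all free cubes are
  -- dropped. This is why `F'` may differ from `F`.
  · exact ⟨fun _ => ∅, fun _ _ => ∅, ∅, by simp, by simp, by simp, by simp, by simpa using hr0⟩
  obtain ⟨i₀, hi₀, hmax⟩ := Finset.exists_max_image Sm I.size hne
  obtain ⟨R, L, h1, h2, h3, h4⟩ := exists_distribution_of_sum (T.sigma F)
    (fun t => c₂ * ((θ * I.maxSize) ^ m * y t.1))
    (fun t => mul_nonneg hc0 (mul_nonneg (by positivity) (hy _))) Sm (fun i => I.size i ^ d)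
    (I.maxSize ^ d) (fun i _ => by
      have := I.size_le_maxSize i
      have := (hI.size_pos i).le
      gcongr)
  refine ⟨F, fun J t => R ⟨J, t⟩, L, fun J => le_rfl, h1, fun J t _ => ?_, fun i hi => ?_, ?_⟩
  · refine columnHolds_of_sum_le (hI.maxSize_le_b hN hα) hI.size_pos i₀ hη hη1
      (fun i hi => hmax i ((h2 _).1 hi)) ?_ (by nlinarith)
      (by have := div_nonneg (hy J) hβ.le; linarith) ?_
    · have := hSm i₀ hi₀
      nlinarith
    · refine (h2 ⟨J, t⟩).2.trans (le_of_eq ?_)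
      rw [add_sub_cancel_right, mul_div_cancel₀ _ hβ.ne', mul_pow (1 - η), hc₂]
      ring
  · refine (h3 i hi).imp_right ?_
    rintro ⟨⟨J, t⟩, ht, hit⟩
    rw [Finset.mem_sigma] at ht
    exact ⟨J, ht.1, t, ht.2, hit⟩
  · rcases h4 with rfl | h4
    · simpa using hr0
    · refine h4.trans ?_
      rw [Finset.sum_sub_distrib, Finset.sum_const, Finset.card_sigma, Finset.sum_sigma]
      have e1 : ∑ J ∈ T, ∑ _t ∈ F J, c₂ * ((θ * I.maxSize) ^ m * y J) =
          c₂ * ∑ J ∈ T, y J * ((F J).card * (θ * I.maxSize) ^ m) := by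
        rw [Finset.mul_sum]
        refine Finset.sum_congr rfl fun J _ => ?_
        rw [Finset.sum_const, nsmul_eq_mul]
        ring
      rw [e1, nsmul_eq_mul]
      have e2 : ((∑ J ∈ T, (F J).card : ℕ) : ℝ) * I.maxSize ^ d ≤ K * I.maxSize ^ d := by
        gcongr
      have e3 : (1 - c₂) * ∑ i ∈ Sm, I.size i ^ d ≤ (1 - c₂) * V :=
        mul_le_mul_of_nonneg_left hSmV (by linarith)
      have e4 := mul_le_mul_of_nonneg_left hF hc0
      have e5 : c₂ * W ≤ W := by nlinarith
      rw [mul_add] at e4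
      linarith

/-- Each large item has volume at least `(δ ŝ)^d`, and the total volume is bounded in terms of `h`.
A box of height `g ŝ^(q+1) / ∏ b`, up to an additive `ŝ`, holds `g` items, so a small fraction of
the large items costs only a small fraction of `h`. -/
theorem card_mul_pow_le (X : Sections I h) (hI : I.IsAdmissible N α) (hα : 1 ≤ α) {δ : ℝ}
    (hδ : 0 < δ) :
    ((Finset.univ.filter fun i => δ * I.maxSize ≤ I.size i).card : ℝ) * I.maxSize ^ (q + 1) ≤
      N * α ^ m / δ ^ Fintype.card (Coord m q) * h * ∏ j, I.b j := by
  set d := Fintype.card (Coord m q) with hd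
  have hS := hI.maxSize_pos
  have h1 : ((Finset.univ.filter fun i => δ * I.maxSize ≤ I.size i).card : ℝ) *
      (δ * I.maxSize) ^ d ≤ N * α ^ m * (I.maxSize ^ m * ((∏ j, I.b j) * h)) := by
    rw [← nsmul_eq_mul]
    refine (Finset.card_nsmul_le_sum _ (fun i => I.size i ^ d) _ fun i hi => ?_).trans
      ((Finset.sum_le_sum_of_subset_of_nonneg (Finset.subset_univ _)
        fun i _ _ => pow_nonneg (hI.size_pos i).le _).trans (X.sum_pow_le hI hα))
    have := (Finset.mem_filter.1 hi).2
    gcongr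
  rw [div_mul_eq_mul_div, div_mul_eq_mul_div, le_div_iff₀ (by positivity)]
  refine le_of_mul_le_mul_left (a := I.maxSize ^ m) ?_ (by positivity)
  rw [mul_pow] at h1
  nth_rewrite 2 [hd] at h1
  rw [card_coord, pow_add I.maxSize] at h1
  calc _ = _ := by ring
    _ ≤ _ := h1
    _ = _ := by ring

set_option maxHeartbeats 1000000 in
/-- The main construction, with explicit parameters. -/
theorem boxable_univ (X : Sections I h) (hI : I.IsAdmissible N α) (hN : 1 ≤ N) (hα : 1 ≤ α)
    {δ μ η θ γ : ℝ} (hδ : 0 < δ)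
    (hδ1 : 2 * δ ≤ (1 / (2 * (2 * Fintype.card (Coord m q) + 1))) ^ 2) (hμδ : μ < δ)
    (hη : 0 < η) (hη1 : (2 * Fintype.card (Coord m q) + 1) * η ≤ 1) (hθ : 0 < θ) (hθ1 : θ ≤ 1)
    (hμ : 2 * μ ≤ η ^ 2 * θ) (hγ : 0 < γ) (P G F K : ℕ) (hP : P = ⌊N * α ^ m / δ ^ m⌋₊)
    (hG : G = ⌊1 / γ⌋₊ + 1) (hFc : F = N * ⌊α / θ⌋₊ ^ m) (hK : K = (P + 1) ^ G) (Φ : ℝ)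
    (hΦ : Φ = I.maxSize ^ m * ∏ j, I.b j) (hh : 0 ≤ h) :
    Boxable I Finset.univ ((h + K * I.maxSize) +
      ((γ * (N * α ^ m / δ ^ Fintype.card (Coord m q) * h)) + 2 * I.maxSize) +
      (4 * (∑ i with μ * I.maxSize < I.size i ∧ I.size i < δ * I.maxSize,
            I.size i ^ Fintype.card (Coord m q) +
          (((1 - (1 - (2 * Fintype.card (Coord m q) + 1) * η) * (1 - η) ^ m) * (N * α ^ m) +
            (m * θ * (N * α ^ m) + P * (m * θ * 3 ^ m))) * (Φ * h) +
            (K * F : ℕ) * I.maxSize ^ Fintype.card (Coord m q))) / Φ + I.maxSize))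
      (K * (P + F) + 1 + 1) := by
  classical
  set d := Fintype.card (Coord m q) with hd
  set S := I.maxSize with hSdef
  set β := ∏ j, I.b j with hβdef
  have hS : 0 < S := hI.maxSize_pos
  have hβ : 0 < β := hI.prod_b_pos hN hα
  have hΦ0 : 0 < Φ := by rw [hΦ]; positivity
  set V₀ : ℝ := N * α ^ m with hV₀
  have hV₀0 : 0 < V₀ := by
    have : (0 : ℝ) < N := by exact_mod_cast hN
    positivity
  set Lg := Finset.univ.filter fun i => δ * S ≤ I.size i with hLg
  set Sm := Finset.univ.filter fun i => I.size i ≤ μ * S with hSm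
  have hdisj : Disjoint Lg Sm := by
    rw [Finset.disjoint_left]
    intro i hi hi'
    have h1 := (Finset.mem_filter.1 hi).2
    have h2 := (Finset.mem_filter.1 hi').2
    nlinarith
  -- Groups of at least `γ |Lg|` items, hence at most `1/γ + 1` groups. The `+ 1` keeps `g` positive
  -- when there are no large items.
  set g := ⌊γ * Lg.card⌋₊ + 1 with hg
  have hg0 : γ * Lg.card ≤ g := by
    rw [hg]; push_cast; exact (Nat.lt_floor_add_one _).le
  have hg1 : (g : ℝ) ≤ γ * Lg.card + 1 := by
    rw [hg]; push_cast
    have := Nat.floor_le (show 0 ≤ γ * Lg.card by positivity)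
    linarith
  obtain ⟨grp, hgrp1, hgrp2, hgrp3, hgrp4⟩ := exists_grouping I.size g (by omega) Lg
  have hgrpG : ∀ i ∈ Lg, grp i < G := by
    intro i hi
    rw [hG, Nat.lt_add_one_iff]
    apply Nat.le_floor
    rw [le_div_iff₀ hγ]
    have h1 : (grp i : ℝ) * g ≤ Lg.card := by exact_mod_cast hgrp1 i hi
    have h2 : (0 : ℝ) < Lg.card := by exact_mod_cast Finset.card_pos.2 ⟨i, hi⟩
    have h3 : (grp i : ℝ) * (γ * Lg.card) ≤ grp i * g := by gcongr
    nlinarith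
  have hLgP : ∀ J, X.x J ≠ 0 → (Lg.filter (· ∈ J)).card ≤ P := by
    intro J hJ
    rw [hP]
    refine le_trans (le_of_eq ?_) (X.card_large_le hI hα hδ hJ)
    congr 1
    ext i
    simp [hLg, hSdef, and_comm]
  obtain ⟨T, y, hT, hTx, hy, hysum, hyf⟩ := X.exists_representatives Lg grp G P hgrpG hLgP
  rw [← hK] at hT
  -- `a j` is a largest item of group `j + 1`; its size is the width of the columns standing in the
  -- places of group `j`. If group `j + 1` is empty, the value is arbitrary and never used.
  have hact : ∀ j, ∃ a : Fin I.n, (Lg.filter (grp · = j + 1)).Nonempty →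
      a ∈ Lg.filter (grp · = j + 1) ∧ ∀ i ∈ Lg.filter (grp · = j + 1), I.size i ≤ I.size a := by
    intro j
    by_cases hj : (Lg.filter (grp · = j + 1)).Nonempty
    · obtain ⟨a, ha, hmax⟩ := Finset.exists_max_image _ I.size hj
      exact ⟨a, fun _ => ⟨ha, hmax⟩⟩
    · exact ⟨⟨0, hI.nonempty⟩, fun h => absurd h hj⟩
  choose a ha using hact
  obtain ⟨RN, hRN1, hRN2⟩ := X.exists_slots hI hN hα Lg grp g hgrp2 hgrp3 hgrp4 a
    (fun j hj => (ha j hj).1) T y hy hyf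
  have hasize : ∀ i ∈ Lg, (Lg.filter (grp · = grp i + 1)).Nonempty →
      I.size (a (grp i)) ≤ I.size i := by
    intro i hi hne
    obtain ⟨h1, h2⟩ := Finset.mem_filter.1 (ha _ hne).1
    exact hgrp4 i hi _ h1 (by omega)
  -- The base volume kept occupied by a place of group `j`: none if there is no next group, since
  -- then the place is free for small items.
  set f : ℕ → ℝ := fun j => if (Lg.filter (grp · = j + 1)).Nonempty then I.size (a j) ^ m else 0
    with hf
  have hfs : ∀ i ∈ Lg, f (grp i) ≤ I.size i ^ m := by
    intro i hi
    simp only [hf]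
    split_ifs with hne
    · exact pow_le_pow_left₀ (hI.size_pos _).le (hasize i hi hne) _
    · exact pow_nonneg (hI.size_pos _).le _
  set Bl : Finset (Fin I.n) → Finset (Fin I.n) := fun J =>
    (Lg.filter (· ∈ J)).filter fun i => (Lg.filter (grp · = grp i + 1)).Nonempty with hBl
  have hBlf : ∀ J, ∑ i ∈ Bl J, I.size (a (grp i)) ^ m = ∑ i ∈ Lg.filter (· ∈ J), f (grp i) :=
    fun J => by rw [hBl, Finset.sum_filter]
  have hBlP : ∀ J ∈ T, (Bl J).card ≤ P := fun J hJ =>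
    (Finset.card_filter_le _ _).trans (hLgP J (hTx J hJ))
  -- Base volume wasted by cutting into cubes of side `θ S`: the first term comes from the borders
  -- of at most `N` cells of sides at most `α S`, the second from the surroundings of at most `P`
  -- columns of large items.
  set loss : ℝ := (m * θ * V₀ + P * (m * θ * 3 ^ m)) * S ^ m with hloss
  have hloss0 : 0 ≤ loss := by positivity
  have hfree : ∀ J, ∃ (Fr : Finset ((Fin m → ℕ) × (Fin m → ℕ)))
      (v : (Fin m → ℕ) × (Fin m → ℕ) → Fin m → ℝ),
      (∀ t ∈ Fr, (cube (v t) (θ * S)).toSet ⊆ I.A.region) ∧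
      (∀ t ∈ Fr, ∀ t' ∈ Fr, t ≠ t' → (cube (v t) (θ * S)).Separated (cube (v t') (θ * S))) ∧
      (∀ t ∈ Fr, ∀ i ∈ Bl J,
        (cube (v t) (θ * S)).Separated (cube (X.p i) (I.size (a (grp i))))) ∧
      Fr.card ≤ F ∧
      (J ∈ T → I.A.vol - ∑ i ∈ Lg.filter (· ∈ J), f (grp i) - loss ≤ Fr.card * (θ * S) ^ m) := by
    intro J
    obtain ⟨Fr, v, h1, h2, h3, h4, h5⟩ := hI.isGrid.exists_free_cubes (D := α * S) (S := S)
      (τ := θ * S) (by positivity) (by nlinarith) (by nlinarith) hI.short (Bl J) X.p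
      (fun i => I.size (a (grp i))) (fun i _ => ⟨(hI.size_pos _).le, I.size_le_maxSize _⟩)
    have e1 : α * S / (θ * S) = α / θ := by field_simp
    have e2 : θ * S / S = θ := by field_simp
    have hcells : (I.A.cells.card : ℝ) ≤ N := by exact_mod_cast hI.card_cells
    refine ⟨Fr, v, h1, h2, h3, ?_, fun hJ => le_trans ?_ h5⟩
    · rw [hFc]
      refine h4.trans ?_
      rw [e1]
      exact Nat.mul_le_mul_right _ hI.card_cells
    · rw [e2, hBlf, hloss]
      have hB : ((Bl J).card : ℝ) ≤ P := by exact_mod_cast hBlP J hJ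
      have h6 : (I.A.cells.card : ℝ) * (m * θ * (α * S) ^ m) ≤ N * (m * θ * (α * S) ^ m) := by
        gcongr
      have h7 : ((Bl J).card : ℝ) * (m * θ * (3 * S) ^ m) ≤ P * (m * θ * (3 * S) ^ m) := by
        gcongr
      have e3 : (N : ℝ) * (m * θ * (α * S) ^ m) + P * (m * θ * (3 * S) ^ m) =
          (m * θ * V₀ + P * (m * θ * 3 ^ m)) * S ^ m := by
        rw [mul_pow, mul_pow, hV₀]; ring
      linarith
  choose Fr v hFr1 hFr2 hFr3 hFr4 hFr5 using hfree
  have hsmall := X.sum_small_le hI Lg Sm hdisj grp f hfs T y hy hysum hyf _ loss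
    fun J hJ => hFr5 J hJ
  have hVtot := X.sum_pow_le hI hα
  have hSmV : ∑ i ∈ Sm, I.size i ^ d ≤ V₀ * (S ^ m * (β * h)) :=
    (Finset.sum_le_sum_of_subset_of_nonneg (Finset.subset_univ _)
      fun i _ _ => pow_nonneg (hI.size_pos i).le _).trans hVtot
  obtain ⟨Fr', RV, L, hFr', hLSm, hcol, hcov, hLsum⟩ := exists_fill hI hN hα Sm hη hη1 hθ hθ1 hμ
    (fun i hi => (Finset.mem_filter.1 hi).2) T y hy Fr (K * F) (by
      refine (Finset.sum_le_card_nsmul _ _ F fun J _ => hFr4 J).trans ?_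
      rw [smul_eq_mul]
      exact Nat.mul_le_mul_right _ hT) _ (loss * (β * h)) hSmV hsmall (by positivity)
  -- One slab per representative: N-Boxes in the places of its large items, which shrink in place
  -- and so stay separated, and V-Boxes over the free cubes.
  have hslab : ∀ J ∈ T, Boxable I ((Bl J).biUnion (RN J) ∪ (Fr' J).biUnion (RV J)) (y J / β + S)
      (P + F) := by
    intro J hJ
    have hBlm : ∀ i : {i // i ∈ Bl J}, i.1 ∈ Lg ∧ i.1 ∈ J ∧
        (Lg.filter (grp · = grp i.1 + 1)).Nonempty := fun i => by
      have := i.2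
      simp only [hBl, Finset.mem_filter] at this
      rw [← and_assoc]
      simpa using this
    have hyβ : 0 ≤ y J / β := div_nonneg (hy J) hβ.le
    have := boxable_of_columns (I := I) (H := y J / β + S) (ι := {i // i ∈ Bl J} ⊕ {t // t ∈ Fr' J})
      (Sum.elim (fun i => X.p i.1) fun t => v J t.1)
      (Sum.elim (fun i => I.size (a (grp i.1))) fun _ => θ * S)
      (Sum.elim (fun i => RN J i.1) fun t => RV J t.1) ?_ ?_ ?_
      ((Bl J).biUnion (RN J) ∪ (Fr' J).biUnion (RV J)) ?_
    · refine this.mono le_rfl le_rfl ?_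
      rw [Fintype.card_sum, Fintype.card_coe, Fintype.card_coe]
      exact add_le_add (hBlP J hJ) ((Finset.card_le_card (hFr' J)).trans (hFr4 J))
    · rintro (i | t) (i' | t') hne
      · simp only [Sum.elim_inl]
        refine (X.sep J (hTx J hJ) i.1 (hBlm i).2.1 i'.1 (hBlm i').2.1
          fun h => hne (by rw [Subtype.ext h])).mono (fun j => ⟨le_rfl, ?_⟩) (fun j => ⟨le_rfl, ?_⟩)
        · have := hasize _ (hBlm i).1 (hBlm i).2.2
          simpa [cube] using this
        · have := hasize _ (hBlm i').1 (hBlm i').2.2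
          simpa [cube] using this
      · exact (hFr3 J t'.1 (hFr' J t'.2) i.1 i.2).symm
      · exact hFr3 J t.1 (hFr' J t.2) i'.1 i'.2
      · exact hFr2 J t.1 (hFr' J t.2) t'.1 (hFr' J t'.2) fun h => hne (by rw [Subtype.ext h])
    · rintro (i | t)
      · refine Set.Subset.trans (Cuboid.toSet_subset (D := cube (X.p i.1) (I.size i.1))
          fun j => ⟨le_rfl, ?_⟩) (X.sub i.1)
        simpa [cube] using hasize _ (hBlm i).1 (hBlm i).2.2
      · exact hFr1 J t.1 (hFr' J t.2)
    · rintro (i | t)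
      · obtain ⟨h1, h2⟩ := hRN1 J i.1 (hBlm i).2.2
        refine columnHolds_of_card_le (fun j => (hI.b_pos hN hα j).le) hI.size_pos (a (grp i.1))
          (fun k hk => (ha _ (hBlm i).2.2).2 k (h1 hk)) le_rfl ?_ h2
        have := I.size_le_maxSize (a (grp i.1))
        linarith
      · exact hcol J t.1 t.2
    · intro i hi
      simp only [Finset.mem_union, Finset.mem_biUnion] at hi
      rcases hi with ⟨k, hk, hik⟩ | ⟨t, ht, hit⟩
      · exact ⟨.inl ⟨k, hk⟩, hik⟩
      · exact ⟨.inr ⟨t, ht⟩, hit⟩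
  have hslabs := Boxable.biUnion T _ _ (fun _ => P + F)
    (fun J _ => add_nonneg (div_nonneg (hy J) hβ.le) hS.le) hslab
  have hfirst := hI.boxable_of_card_le hN hα (Lg.filter (grp · = 0)) (g := γ * Lg.card + 1)
    (le_trans (by exact_mod_cast hgrp2 0) hg1)
  have hrest := hI.boxable_of_size_le hN hα
    ((Finset.univ.filter fun i => μ * S < I.size i ∧ I.size i < δ * S) ∪ L) hδ1 (by
      intro i hi
      rcases Finset.mem_union.1 hi with hi | hi
      · exact (Finset.mem_filter.1 hi).2.2.le
      · have := (Finset.mem_filter.1 (hLSm hi)).2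
        nlinarith)
  have hh1 : ∑ J ∈ T, (y J / β + S) ≤ h + K * S := by
    rw [Finset.sum_add_distrib, ← Finset.sum_div, hysum, X.total, Finset.sum_const, nsmul_eq_mul,
      mul_div_cancel_left₀ _ hβ.ne']
    gcongr
  -- Since `β ≥ S^q`, the surplus of one item in the size of the first group costs at most an
  -- additive `S` in height.
  have hSq : S ^ (q + 1) ≤ S * β := by
    rw [pow_succ, mul_comm]
    gcongr
    exact hI.pow_maxSize_le hN hα
  have hnL := X.card_mul_pow_le hI hα hδ
  have hh2 : (γ * Lg.card + 1) * S ^ (q + 1) / β + S ≤ γ * (V₀ / δ ^ d * h) + 2 * S := by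
    have h1 : (γ * Lg.card + 1) * S ^ (q + 1) / β ≤ γ * (V₀ / δ ^ d * h) + S := by
      rw [div_le_iff₀ hβ]
      have := mul_le_mul_of_nonneg_left hnL hγ.le
      linarith
    linarith
  have hh3 : 4 * (∑ i ∈ (Finset.univ.filter fun i => μ * S < I.size i ∧ I.size i < δ * S) ∪ L,
      I.size i ^ d) / (S ^ m * β) + S ≤
      4 * (∑ i with μ * S < I.size i ∧ I.size i < δ * S, I.size i ^ d +
          (((1 - (1 - (2 * (d : ℝ) + 1) * η) * (1 - η) ^ m) * V₀ +
            (m * θ * V₀ + P * (m * θ * 3 ^ m))) * (Φ * h) + (K * F : ℕ) * S ^ d)) / Φ + S := by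
    rw [← hΦ]
    gcongr
    have hun : ∑ i ∈ (Finset.univ.filter fun i => μ * S < I.size i ∧ I.size i < δ * S) ∪ L,
        I.size i ^ d ≤ ∑ i with μ * S < I.size i ∧ I.size i < δ * S, I.size i ^ d +
          ∑ i ∈ L, I.size i ^ d := by
      rw [← Finset.sum_union_inter]
      have : 0 ≤ ∑ i ∈ (Finset.univ.filter fun i => μ * S < I.size i ∧ I.size i < δ * S) ∩ L,
          I.size i ^ d := Finset.sum_nonneg fun i _ => pow_nonneg (hI.size_pos i).le _
      linarith
    refine hun.trans (add_le_add le_rfl (hLsum.trans (le_of_eq ?_)))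
    rw [hΦ, hloss]
    ring
  have hS2 : 0 ≤ (γ * Lg.card + 1) * S ^ (q + 1) / β + S := by positivity
  have hS3 : 0 ≤ 4 * (∑ i ∈ (Finset.univ.filter fun i => μ * S < I.size i ∧ I.size i < δ * S) ∪ L,
      I.size i ^ d) / (S ^ m * β) + S := by
    have := Finset.sum_nonneg (s := (Finset.univ.filter fun i => μ * S < I.size i ∧
      I.size i < δ * S) ∪ L) fun i _ => pow_nonneg (hI.size_pos i).le d
    positivity
  have hS1 : 0 ≤ ∑ J ∈ T, (y J / β + S) :=
    Finset.sum_nonneg fun J _ => add_nonneg (div_nonneg (hy J) hβ.le) hS.le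
  refine ((hslabs.union hfirst hS1 hS2).union hrest (add_nonneg hS1 hS2) hS3).mono ?_
    (add_le_add (add_le_add hh1 hh2) hh3) ?_
  · intro i _
    simp only [Finset.mem_union]
    by_cases hi : i ∈ Lg
    · left
      by_cases h0 : grp i = 0
      · exact Or.inr (Finset.mem_filter.2 ⟨hi, h0⟩)
      · left
        obtain ⟨J, hJ, k, hk, hkJ, hne, hik⟩ := hRN2 i hi (Nat.pos_of_ne_zero h0)
        refine Finset.mem_biUnion.2 ⟨J, hJ, Finset.mem_union_left _ (Finset.mem_biUnion.2 ⟨k, ?_, hik⟩)⟩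
        exact Finset.mem_filter.2 ⟨Finset.mem_filter.2 ⟨hk, hkJ⟩, hne⟩
    · by_cases hi2 : i ∈ Sm
      · rcases hcov i hi2 with h1 | ⟨J, hJ, t, ht, hit⟩
        · exact Or.inr (Or.inr h1)
        · exact Or.inl (Or.inl (Finset.mem_biUnion.2 ⟨J, hJ, Finset.mem_union_right _
            (Finset.mem_biUnion.2 ⟨t, ht, hit⟩)⟩))
      · refine Or.inr (Or.inl (Finset.mem_filter.2 ⟨Finset.mem_univ _, ?_, ?_⟩))
        · by_contra hc
          exact hi2 (Finset.mem_filter.2 ⟨Finset.mem_univ _, not_lt.1 hc⟩)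
        · by_contra hc
          exact hi (Finset.mem_filter.2 ⟨Finset.mem_univ _, not_lt.1 hc⟩)
  · rw [Finset.sum_const, smul_eq_mul]
    gcongr

end Sections

/-! ### Choice of the parameters, and the bound in terms of the optimum. -/

variable {m q : ℕ}

/-- The items of size strictly between `μ ŝ` and `δ ŝ`. -/
def StripInstance.medium (I : StripInstance m q) (μ δ : ℝ) : Finset (Fin I.n) :=
  {i | μ * I.maxSize < I.size i ∧ I.size i < δ * I.maxSize}

theorem StripInstance.IsAdmissible.pow_card_div_le {I : StripInstance m q} {N : ℕ} {α : ℝ}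
    (hI : I.IsAdmissible N α) (hN : 1 ≤ N) (hα : 1 ≤ α) :
    I.maxSize ^ Fintype.card (Coord m q) / (I.maxSize ^ m * ∏ j, I.b j) ≤ I.maxSize := by
  have hS := hI.maxSize_pos
  have hβ := hI.prod_b_pos hN hα
  rw [div_le_iff₀ (by positivity), card_coord, pow_add, pow_succ]
  have := hI.pow_maxSize_le hN hα
  calc I.maxSize ^ m * (I.maxSize ^ q * I.maxSize) ≤
        I.maxSize ^ m * ((∏ j, I.b j) * I.maxSize) := by gcongr
    _ = _ := by ring

/-- The parameters depend on each other in the order `δ`, `P`, then `η` and `θ`, then `μ`, which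
must not exceed `η² θ / 2`; hence the unavoidable gap of medium items, whose volume stays in the
bound. The filling and cutting losses are at most `ε/16` each and enter with the factor `4`; the
first group costs `ε/4`. Together this is less than `ε`. -/
theorem exists_boxable_add_medium (m q N : ℕ) (α ε : ℝ) (hN : 1 ≤ N) (hα : 1 ≤ α) (hε : 0 < ε)
    {δ : ℝ} (hδ : 0 < δ) (hδ1 : 2 * δ ≤ (1 / (2 * (2 * Fintype.card (Coord m q) + 1))) ^ 2) :
    ∃ μ : ℝ, (0 < μ ∧ μ < δ) ∧ ∃ (C : ℝ) (M : ℕ), 0 ≤ C ∧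
      ∀ I : StripInstance m q, I.IsAdmissible N α → ∀ h, 0 ≤ h → Sections I h →
        Boxable I Finset.univ ((1 + ε) * h + C * I.maxSize +
          4 * (∑ i ∈ I.medium μ δ, I.size i ^ Fintype.card (Coord m q)) /
            (I.maxSize ^ m * ∏ j, I.b j)) M := by
  set d := Fintype.card (Coord m q) with hd
  set V₀ : ℝ := N * α ^ m with hV₀
  have hV₀0 : 0 < V₀ := by
    have : (0 : ℝ) < N := by exact_mod_cast hN
    positivity
  set P := ⌊N * α ^ m / δ ^ m⌋₊ with hP
  obtain ⟨η, hη, hη1, hη2⟩ : ∃ η : ℝ, 0 < η ∧ (2 * (d : ℝ) + 1) * η ≤ 1 ∧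
      (1 - (1 - (2 * (d : ℝ) + 1) * η) * (1 - η) ^ m) * V₀ ≤ ε / 16 := by
    have h1 : 0 < 1 / (2 * (d : ℝ) + 1) := by positivity
    have h2 : 0 < ε / (16 * ((2 * d + 1 + m) * V₀)) := by positivity
    set η := min (1 / (2 * (d : ℝ) + 1)) (ε / (16 * ((2 * d + 1 + m) * V₀))) with hη
    have h3 : (2 * (d : ℝ) + 1) * η ≤ 1 := by
      have := min_le_left (1 / (2 * (d : ℝ) + 1)) (ε / (16 * ((2 * d + 1 + m) * V₀)))
      rw [← hη, le_div_iff₀ (by positivity)] at this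
      linarith
    have h4 : η * (16 * ((2 * d + 1 + m) * V₀)) ≤ ε := by
      have := min_le_right (1 / (2 * (d : ℝ) + 1)) (ε / (16 * ((2 * d + 1 + m) * V₀)))
      rwa [← hη, le_div_iff₀ (by positivity)] at this
    have h0 : 0 < η := lt_min h1 h2
    refine ⟨η, h0, h3, ?_⟩
    have hd0 : (0 : ℝ) ≤ d := Nat.cast_nonneg _
    have h5 := one_add_mul_le_pow (a := -η) (by nlinarith) m
    rw [← sub_eq_add_neg] at h5
    have h6 : (1 - (2 * (d : ℝ) + 1) * η) * (1 + m * -η) ≤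
        (1 - (2 * (d : ℝ) + 1) * η) * (1 - η) ^ m := mul_le_mul_of_nonneg_left h5 (by linarith)
    have h7 : 1 - (1 - (2 * (d : ℝ) + 1) * η) * (1 - η) ^ m ≤ (2 * d + 1 + m) * η := by
      have : 0 ≤ (2 * (d : ℝ) + 1) * η * (m * η) := by positivity
      nlinarith
    have h8 := mul_le_mul_of_nonneg_right h7 hV₀0.le
    linarith
  obtain ⟨θ, hθ, hθ1, hθ2⟩ : ∃ θ : ℝ, 0 < θ ∧ θ ≤ 1 ∧
      m * θ * V₀ + P * (m * θ * 3 ^ m) ≤ ε / 16 := by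
    have h1 : 0 < 16 * (m * V₀ + P * (m * 3 ^ m) + 1) := by positivity
    refine ⟨min 1 (ε / (16 * (m * V₀ + P * (m * 3 ^ m) + 1))), lt_min one_pos (by positivity),
      min_le_left _ _, ?_⟩
    set θ := min 1 (ε / (16 * (m * V₀ + P * (m * 3 ^ m) + 1))) with hθ
    have h2 : θ * (16 * (m * V₀ + P * (m * 3 ^ m) + 1)) ≤ ε := by
      rw [← le_div_iff₀ h1]
      exact min_le_right _ _
    have h3 : 0 < θ := lt_min one_pos (by positivity)
    nlinarith
  -- Chosen so that the first group costs `γ V₀ / δ^d · h = ε/4 · h`.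
  set γ := ε * δ ^ d / (4 * V₀) with hγ
  have hγ0 : 0 < γ := by positivity
  set G := ⌊1 / γ⌋₊ + 1 with hG
  set F := N * ⌊α / θ⌋₊ ^ m with hF
  set K := (P + 1) ^ G with hK
  refine ⟨min (η ^ 2 * θ / 2) (δ / 2), ⟨lt_min (by positivity) (by positivity),
    (min_le_right _ _).trans_lt (by linarith)⟩, K + 3 + 4 * (K * F : ℕ), K * (P + F) + 1 + 1,
    by positivity, fun I hI h hh X => ?_⟩
  have hμ : 2 * min (η ^ 2 * θ / 2) (δ / 2) ≤ η ^ 2 * θ := by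
    have := min_le_left (η ^ 2 * θ / 2) (δ / 2)
    linarith
  have hμδ : min (η ^ 2 * θ / 2) (δ / 2) < δ := (min_le_right _ _).trans_lt (by linarith)
  refine (X.boxable_univ hI hN hα hδ hδ1 hμδ hη hη1 hθ hθ1 hμ hγ0 P G F K hP hG hF hK _ rfl hh).mono
    le_rfl ?_ le_rfl
  have hS := hI.maxSize_pos
  have hβ := hI.prod_b_pos hN hα
  set Φ := I.maxSize ^ m * ∏ j, I.b j with hΦ
  have hΦ0 : 0 < Φ := by positivity
  have h1 : γ * (V₀ / δ ^ d * h) = ε / 4 * h := by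
    rw [hγ]
    field_simp
  have h2 := hI.pow_card_div_le hN hα
  rw [← hΦ, ← hd] at h2
  set Md := ∑ i with min (η ^ 2 * θ / 2) (δ / 2) * I.maxSize < I.size i ∧
    I.size i < δ * I.maxSize, I.size i ^ d with hMd
  set c₁ := (1 - (1 - (2 * (d : ℝ) + 1) * η) * (1 - η) ^ m) * V₀
  set c₂ := m * θ * V₀ + P * (m * θ * 3 ^ m)
  have h3 : 4 * (Md + ((c₁ + c₂) * (Φ * h) + (K * F : ℕ) * I.maxSize ^ d)) / Φ =
      4 * Md / Φ + 4 * (c₁ + c₂) * h + 4 * (K * F : ℕ) * (I.maxSize ^ d / Φ) := by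
    field_simp
    ring
  rw [h3, h1]
  have h4 : 4 * ((K * F : ℕ) : ℝ) * (I.maxSize ^ d / Φ) ≤ 4 * (K * F : ℕ) * I.maxSize := by
    gcongr
  have h5 : 4 * (c₁ + c₂) * h ≤ ε / 2 * h := by
    gcongr
    linarith
  have h6 : 0 ≤ ε * h := by positivity
  have h7 : ∑ i ∈ I.medium (min (η ^ 2 * θ / 2) (δ / 2)) δ, I.size i ^ d = Md := rfl
  rw [h7]
  linarith

/-- Iterating `μ` gives scales `δ₀ > δ₁ > ⋯` whose medium sets are disjoint. Among `n > 8 V₀ / ε` of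
them, one has at most a fraction `1/n` of the bound on the total volume, and packing it costs at
most `ε/2 · h`. -/
theorem exists_boxable_of_sections (m q N : ℕ) (α ε : ℝ) (hN : 1 ≤ N) (hα : 1 ≤ α) (hε : 0 < ε) :
    ∃ (C : ℝ) (M : ℕ), 0 ≤ C ∧ ∀ I : StripInstance m q, I.IsAdmissible N α → ∀ h, 0 ≤ h →
      Sections I h → Boxable I Finset.univ ((1 + ε) * h + C * I.maxSize) M := by
  classical
  set d := Fintype.card (Coord m q) with hd
  have hN' : (0 : ℝ) < N := by exact_mod_cast hN
  set V₀ : ℝ := N * α ^ m with hV₀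
  have hV₀0 : 0 < V₀ := by positivity
  set δ₀ : ℝ := (1 / (2 * (2 * (d : ℝ) + 1))) ^ 2 / 2 with hδ₀
  have hδ₀0 : 0 < δ₀ := by positivity
  have key := fun (δ : ℝ) (hδ : 0 < δ ∧ δ ≤ δ₀) =>
    exists_boxable_add_medium m q N α (ε / 2) hN hα (by linarith) hδ.1 (by linarith [hδ.2])
  choose! μ hμ C M hC hbox using key
  set δ : ℕ → ℝ := fun t => μ^[t] δ₀ with hδ
  have hδs : ∀ t, δ (t + 1) = μ (δ t) := fun t => Function.iterate_succ_apply' μ t δ₀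
  have hinv : ∀ t, 0 < δ t ∧ δ t ≤ δ₀ := by
    intro t
    induction t with
    | zero => exact ⟨hδ₀0, le_rfl⟩
    | succ t ih =>
      rw [hδs]
      exact ⟨(hμ _ ih).1, (hμ _ ih).2.le.trans ih.2⟩
  have hanti : Antitone δ := antitone_nat_of_succ_le fun t => by
    rw [hδs]
    exact (hμ _ (hinv t)).2.le
  obtain ⟨n, hn⟩ := exists_nat_gt (8 * V₀ / ε)
  have hn0 : (0 : ℝ) < n := lt_trans (by positivity) hn
  -- The suitable scale depends on the instance; summing over all scales makes the constants
  -- independent of it.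
  refine ⟨∑ t ∈ Finset.range n, C (δ t), ∑ t ∈ Finset.range n, M (δ t),
    Finset.sum_nonneg fun t _ => hC _ (hinv t), fun I hI h hh X => ?_⟩
  have hS := hI.maxSize_pos
  have hβ := hI.prod_b_pos hN hα
  set Φ := I.maxSize ^ m * ∏ j, I.b j with hΦ
  have hΦ0 : 0 < Φ := by positivity
  have hdisj : ∀ t t', t < t' → Disjoint (I.medium (δ (t + 1)) (δ t))
      (I.medium (δ (t' + 1)) (δ t')) := by
    intro t t' htt
    rw [Finset.disjoint_left]
    intro i hi hi'
    have h1 := (Finset.mem_filter.1 hi).2.1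
    have h2 := (Finset.mem_filter.1 hi').2.2
    have h3 : δ t' * I.maxSize ≤ δ (t + 1) * I.maxSize := by
      gcongr
      exact hanti htt
    linarith
  have hsum : ∑ t ∈ Finset.range n, ∑ i ∈ I.medium (δ (t + 1)) (δ t), I.size i ^ d ≤
      ∑ t ∈ Finset.range n, V₀ * (Φ * h) / n := by
    rw [← Finset.sum_biUnion]
    · rw [Finset.sum_const, Finset.card_range, nsmul_eq_mul, mul_div_cancel₀ _ hn0.ne']
      refine (Finset.sum_le_sum_of_subset_of_nonneg (Finset.subset_univ _)
        fun i _ _ => pow_nonneg (hI.size_pos i).le _).trans ((X.sum_pow_le hI hα).trans (le_of_eq ?_))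
      rw [hΦ]
      ring
    · intro t _ t' _ hne
      rcases lt_or_gt_of_ne hne with hlt | hlt
      exacts [hdisj _ _ hlt, (hdisj _ _ hlt).symm]
  have hne : (Finset.range n).Nonempty := by
    rw [Finset.nonempty_range_iff]
    rintro rfl
    simp at hn0
  obtain ⟨t, ht, hmed⟩ := Finset.exists_le_of_sum_le hne hsum
  refine (hbox (δ t) (hinv t) I hI h hh X).mono le_rfl ?_
    (Finset.single_le_sum (f := fun t => M (δ t)) (fun _ _ => Nat.zero_le _) ht)
  have h1 : C (δ t) ≤ ∑ t ∈ Finset.range n, C (δ t) :=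
    Finset.single_le_sum (f := fun t => C (δ t)) (fun t _ => hC _ (hinv t)) ht
  have h2 := mul_le_mul_of_nonneg_right h1 hS.le
  have h3 : 4 * (∑ i ∈ I.medium (μ (δ t)) (δ t), I.size i ^ d) / Φ ≤ ε / 2 * h := by
    rw [← hδs, div_le_iff₀ hΦ0]
    rw [le_div_iff₀ hn0] at hmed
    rw [div_lt_iff₀ hε] at hn
    refine le_of_mul_le_mul_right (a := (n : ℝ)) ?_ hn0
    have h4 : 8 * V₀ * (Φ * h) ≤ n * ε * (Φ * h) := by gcongr
    linarith
  linarith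

/-- Items stacked at the heights `i ŝ`. It is needed so that `opt` is the infimum of a nonempty set.
-/
theorem StripInstance.IsAdmissible.exists_isPacking {I : StripInstance m q} {N : ℕ} {α : ℝ}
    (hI : I.IsAdmissible N α) :
    ∃ h, ∃ pos : Fin I.n → Coord m q → ℝ, IsPacking I.size pos (container I.A I.b h) := by
  choose p hp using hI.fits
  have hS := hI.maxSize_pos
  refine ⟨I.n * I.maxSize, fun i => Sum.elim (fun j => p i (.inl j))
    (Sum.elim (fun j => p i (.inr (.inl j))) fun _ => i * I.maxSize), fun i x hx => ?_,
    fun i i' hne => ?_⟩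
  · rw [Cuboid.mem_toSet] at hx
    have h1 : Sum.elim (fun j => x (.inl j)) (Sum.elim (fun j => x (.inr (.inl j))) fun _ =>
        p i (.inr (.inr ()))) ∈ (cube (p i) (I.size i)).toSet := by
      rw [Cuboid.mem_toSet]
      rintro (j | j | j)
      · exact hx (.inl j)
      · exact hx (.inr (.inl j))
      · simpa [cube] using (hI.size_pos i).le
    have h2 := hp i h1
    have h3 := hx (.inr (.inr ()))
    simp only [cube, Sum.elim_inr] at h3
    have h4 : ((i : ℕ) : ℝ) + 1 ≤ I.n := by exact_mod_cast i.2
    have h5 := I.size_le_maxSize i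
    have h6 : (0 : ℝ) ≤ (i : ℕ) := Nat.cast_nonneg _
    exact ⟨h2.1, h2.2.1, by nlinarith, by nlinarith⟩
  · apply Cuboid.Separated.nonOverlapping
    refine ⟨.inr (.inr ()), ?_⟩
    simp only [cube, Sum.elim_inr]
    have h5 := I.size_le_maxSize i
    have h6 := I.size_le_maxSize i'
    rcases lt_or_gt_of_ne hne with h | h
    · left
      have : ((i : ℕ) : ℝ) + 1 ≤ (i' : ℕ) := by exact_mod_cast h
      nlinarith
    · right
      have : ((i' : ℕ) : ℝ) + 1 ≤ (i : ℕ) := by exact_mod_cast h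
      nlinarith

/-- The construction is applied to a packing of height below `opt + ŝ`; the additive constant takes
up the slack, so the infimum need not be attained. -/
theorem exists_boxable (m q N : ℕ) (α ε : ℝ) (hN : 1 ≤ N) (hα : 1 ≤ α) (hε : 0 < ε) :
    ∃ (C : ℝ) (M : ℕ), ∀ I : StripInstance m q, I.IsAdmissible N α →
      Boxable I Finset.univ ((1 + ε) * I.opt + C * I.maxSize) M := by
  obtain ⟨C, M, -, H⟩ := exists_boxable_of_sections m q N α ε hN hα hε
  refine ⟨C + (1 + ε), M, fun I hI => ?_⟩
  have hS := hI.maxSize_pos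
  obtain ⟨h, ⟨pos, hpos⟩, hh⟩ := exists_lt_of_csInf_lt (hI.exists_isPacking)
    (show I.opt < I.opt + I.maxSize by linarith)
  obtain ⟨h0, ⟨X⟩⟩ := hpos.nonempty_sections hI hN hα
  refine (H I hI h h0 X).mono le_rfl ?_ le_rfl
  have : (1 + ε) * h ≤ (1 + ε) * (I.opt + I.maxSize) := by gcongr
  linarith

/-! ### Integral packings -/

section Integral

variable {m q : ℕ}

/-- A common bound for the absolute values of the numerators of the grid boundaries. -/
def gridBound (X : InstanceCode m q) : ℕ :=
  ∑ j, (X.2.2.1 j).foldr (fun z a => z.natAbs + a) 0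

/-- The numerator of a grid boundary, shifted to a natural number. -/
def shiftedBdry (X : InstanceCode m q) (j : Fin m) (k : ℕ) : ℕ :=
  ((X.2.2.1 j).getD k 0 + gridBound X).toNat

theorem natAbs_getD_le_foldr (l : List ℤ) (k : ℕ) :
    (l.getD k 0).natAbs ≤ l.foldr (fun z a => z.natAbs + a) 0 := by
  induction l generalizing k with
  | nil => simp
  | cons z l ih =>
    cases k with
    | zero => simp
    | succ k =>
      have := ih k
      simp only [List.getD_cons_succ, List.foldr_cons]
      omega

theorem natAbs_getD_le_gridBound (X : InstanceCode m q) (j : Fin m) (k : ℕ) :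
    ((X.2.2.1 j).getD k 0).natAbs ≤ gridBound X :=
  (natAbs_getD_le_foldr _ _).trans (Finset.single_le_sum
    (f := fun j => (X.2.2.1 j).foldr (fun z a => z.natAbs + a) 0) (fun _ _ => Nat.zero_le _)
    (Finset.mem_univ j))

theorem shiftedBdry_cast (X : InstanceCode m q) (j : Fin m) (k : ℕ) :
    (shiftedBdry X j k : ℤ) = (X.2.2.1 j).getD k 0 + gridBound X := by
  have := natAbs_getD_le_gridBound X j k
  rw [shiftedBdry, Int.toNat_of_nonneg]
  omega

/-- The size of the item with number `i`. -/
def sizeNum (X : InstanceCode m q) (i : ℕ) : ℕ := X.2.1.getD i 0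

/-- A packing into boxes with integral coordinates, up to a common denominator. The short
coordinates are shifted by `gridBound X`. The box `t` has the lower corner `lo t` and the side
lengths `c t j * σ t`, item `i` has the lower corner `pos i` and lies in the box `bx i`. -/
structure IsPlan (X : InstanceCode m q) (M h L : ℕ) (lo c : ℕ → Coord m q → ℕ) (σ : ℕ → ℕ)
    (pos : ℕ → Coord m q → ℕ) (bx : ℕ → ℕ) : Prop where
  length_le : L ≤ M
  pos_mult : ∀ t < L, 0 < σ t ∧ ∀ j, 0 < c t j
  -- Containment in the union of grid cells is tested on the finitely many integral unit cells of
  -- the base of the box; each must lie in one grid cell.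
  short : ∀ t < L, ∀ u : Fin m → ℕ,
    (∀ j, lo t (.inl j) ≤ u j ∧ u j < lo t (.inl j) + c t (.inl j) * σ t) →
      ∃ a ∈ X.2.2.2.1, ∀ j, shiftedBdry X j (a j) ≤ u j ∧ u j + 1 ≤ shiftedBdry X j (a j + 1)
  -- Some item size replaces the maximum `ŝ`: a bound with any item implies the bound with `ŝ`, and
  -- the largest item realises it.
  long : ∀ t < L, ∀ j : Fin q, ∃ i < X.2.1.length,
    lo t (.inr (.inl j)) + c t (.inr (.inl j)) * σ t ≤ X.2.2.2.2 j + sizeNum X i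
  top : ∀ t < L, lo t (.inr (.inr ())) + c t (.inr (.inr ())) * σ t ≤ h
  boxes_sep : ∀ t < L, ∀ t' < L, t < t' →
    ∃ j, lo t j + c t j * σ t ≤ lo t' j ∨ lo t' j + c t' j * σ t' ≤ lo t j
  item : ∀ i < X.2.1.length, bx i < L ∧ sizeNum X i ≤ σ (bx i) ∧ ∀ j,
    lo (bx i) j ≤ pos i j ∧ pos i j + sizeNum X i ≤ lo (bx i) j + c (bx i) j * σ (bx i)
  items_sep : ∀ i < X.2.1.length, ∀ i' < X.2.1.length, i ≠ i' →
    ∃ j, pos i j + sizeNum X i ≤ pos i' j ∨ pos i' j + sizeNum X i' ≤ pos i j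
  type : ∀ t < L,
    (∑ i ∈ Finset.range X.2.1.length, if bx i = t then 1 else 0) ≤ ∏ j, c t j ∨
    (∑ i ∈ Finset.range X.2.1.length,
      if bx i = t then sizeNum X i ^ Fintype.card (Coord m q) else 0) +
      σ t * ∑ j, ∏ j' ∈ Finset.univ.erase j, c t j' * σ t ≤ ∏ j, c t j * σ t

/-- The code of the point with numerators `v`, shifted back by `K` in the short coordinates. -/
def pointCode (K : ℕ) (v : Coord m q → ℕ) : PointCode m q :=
  (fun j => (v (.inl j) : ℤ) - K, fun j => (v (.inr (.inl j)) : ℤ), (v (.inr (.inr ())) : ℤ))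

/-- The code of an integral packing. -/
def planCode (X : InstanceCode m q) (h L : ℕ) (lo c : ℕ → Coord m q → ℕ) (σ : ℕ → ℕ)
    (pos : ℕ → Coord m q → ℕ) (bx : ℕ → ℕ) : PackingCode m q :=
  (X.1, h, (List.range L).map fun t =>
      (pointCode (gridBound X) (lo t), pointCode 0 fun j => c t j * σ t),
    (List.range X.2.1.length).map fun i => (bx i, pointCode (gridBound X) (pos i)))

/-- The shift of the coordinates. -/
def shift (K : ℕ) : Coord m q → ℤ := Sum.elim (fun _ => K) fun _ => 0

theorem decodePoint_pointCode (D K : ℕ) (v : Coord m q → ℕ) (j : Coord m q) :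
    decodePoint D (pointCode K v) j = ((v j : ℤ) - shift K j : ℤ) / ((D : ℝ) + 1) := by
  rcases j with j | j | j <;> simp [decodePoint, pointCode, shift]

theorem decodePoint_pointCode_zero (D : ℕ) (v : Coord m q → ℕ) (j : Coord m q) :
    decodePoint D (pointCode 0 v) j = (v j : ℝ) / ((D : ℝ) + 1) := by
  rcases j with j | j | j <;> simp [decodePoint, pointCode]

theorem decodeInstance_size (X : InstanceCode m q) (i : Fin (decodeInstance X).n) :
    (decodeInstance X).size i = (sizeNum X i : ℝ) / ((X.1 : ℝ) + 1) := by
  have hi : (i : ℕ) < X.2.1.length := i.2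
  rw [sizeNum, List.getD_eq_getElem _ _ hi]
  rfl

theorem decodeInstance_bdry (X : InstanceCode m q) (j : Fin m) (k : ℕ) :
    (decodeInstance X).A.bdry j k = ((shiftedBdry X j k : ℤ) - gridBound X : ℤ) / ((X.1 : ℝ) + 1) := by
  rw [shiftedBdry_cast, add_sub_cancel_right]
  rfl

theorem mem_region_decodeInstance {X : InstanceCode m q} {x : Fin m → ℝ} :
    x ∈ (decodeInstance X).A.region ↔ ∃ a ∈ X.2.2.2.1, ∀ j,
      (shiftedBdry X j (a j) : ℝ) ≤ x j * (X.1 + 1) + gridBound X ∧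
      x j * (X.1 + 1) + gridBound X ≤ shiftedBdry X j (a j + 1) := by
  have hD : (0 : ℝ) < (X.1 : ℝ) + 1 := by positivity
  simp only [Grid.region, Set.mem_iUnion, exists_prop, Cuboid.mem_toSet, Grid.cell,
    add_sub_cancel, decodeInstance_bdry]
  have : ∀ a, a ∈ (decodeInstance X).A.cells ↔ a ∈ X.2.2.2.1 := fun a => List.mem_toFinset
  simp only [this]
  refine exists_congr fun a => and_congr_right fun _ => forall_congr' fun j => ?_
  rw [div_le_iff₀ hD, le_div_iff₀ hD]
  push_cast
  constructor <;> rintro ⟨h1, h2⟩ <;> constructor <;> linarith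

variable {X : InstanceCode m q} {M h L : ℕ} {lo c : ℕ → Coord m q → ℕ} {σ : ℕ → ℕ}
  {pos : ℕ → Coord m q → ℕ} {bx : ℕ → ℕ}

/-- The box with number `t` of an integral packing. -/
def planBox (X : InstanceCode m q) (lo c : ℕ → Coord m q → ℕ) (σ : ℕ → ℕ) (t : ℕ) :
    Cuboid (Coord m q) :=
  ⟨decodePoint X.1 (pointCode (gridBound X) (lo t)),
    decodePoint X.1 (pointCode 0 fun j => c t j * σ t)⟩

theorem separated_of_nat {D K : ℕ} {a b v w : Coord m q → ℕ}
    (H : ∃ j, a j + v j ≤ b j ∨ b j + w j ≤ a j) :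
    (⟨decodePoint D (pointCode K a), fun j => (v j : ℝ) / ((D : ℝ) + 1)⟩ :
      Cuboid (Coord m q)).Separated
      ⟨decodePoint D (pointCode K b), fun j => (w j : ℝ) / ((D : ℝ) + 1)⟩ := by
  have hD : (0 : ℝ) < (D : ℝ) + 1 := by positivity
  obtain ⟨j, hj⟩ := H
  refine ⟨j, ?_⟩
  simp only [decodePoint_pointCode, ← add_div, div_le_div_iff_of_pos_right hD]
  push_cast
  rcases hj with hj | hj
  · left
    have : (a j : ℝ) + v j ≤ b j := by exact_mod_cast hj
    linarith
  · right
    have : (b j : ℝ) + w j ≤ a j := by exact_mod_cast hj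
    linarith

theorem IsPlan.box_holds (H : IsPlan X M h L lo c σ pos bx) {t : ℕ} (ht : t < L) :
    (decodeInstance X).Holds 0 ((h : ℝ) / ((X.1 : ℝ) + 1)) (planBox X lo c σ t) := by
  have hD : (0 : ℝ) < (X.1 : ℝ) + 1 := by positivity
  refine ⟨fun x hx => ?_, fun j => ⟨?_, ?_⟩, ?_, ?_⟩
  · rw [Cuboid.mem_toSet] at hx
    simp only [Cuboid.short, planBox, decodePoint_pointCode, shift,
      Sum.elim_inl, ← add_div, div_le_iff₀ hD, le_div_iff₀ hD] at hx
    push_cast at hx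
    rw [mem_region_decodeInstance]
    set K := gridBound X
    have hpos := H.pos_mult t ht
    set x' : Fin m → ℝ := fun j => x j * (X.1 + 1) + K with hx'
    have hx1 : ∀ j, (lo t (.inl j) : ℝ) ≤ x' j ∧
        x' j ≤ lo t (.inl j) + c t (.inl j) * σ t := fun j => by
      obtain ⟨h1, h2⟩ := hx j
      constructor <;> simp only [hx'] <;> linarith
    have hx0 : ∀ j, 0 ≤ x' j := fun j => (Nat.cast_nonneg _).trans (hx1 j).1
    -- The unit cell containing the point has its floor as lower corner, except on an upper face of
    -- the box, where the last cell inside the box is taken; hence the minimum with the upper end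
    -- minus one.
    obtain ⟨a, ha, hau⟩ := H.short t ht
      (fun j => min ⌊x' j⌋₊ (lo t (.inl j) + c t (.inl j) * σ t - 1)) fun j => by
        have h1 : lo t (.inl j) ≤ ⌊x' j⌋₊ := Nat.le_floor (hx1 j).1
        have h2 : 0 < c t (.inl j) * σ t := Nat.mul_pos (hpos.2 _) hpos.1
        constructor
        · exact le_min h1 (by omega)
        · have := min_le_right ⌊x' j⌋₊ (lo t (.inl j) + c t (.inl j) * σ t - 1)
          omega
    refine ⟨a, ha, fun j => ?_⟩
    obtain ⟨h1, h2⟩ := hau j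
    have h3 : 0 < c t (.inl j) * σ t := Nat.mul_pos (hpos.2 _) hpos.1
    constructor
    · have h4 : (shiftedBdry X j (a j) : ℝ) ≤ (⌊x' j⌋₊ : ℝ) :=
        Nat.cast_le.2 (h1.trans (min_le_left _ _))
      exact h4.trans (Nat.floor_le (hx0 j))
    · rcases le_total ⌊x' j⌋₊ (lo t (.inl j) + c t (.inl j) * σ t - 1) with h4 | h4
      · rw [min_eq_left h4] at h2
        refine (Nat.lt_floor_add_one (x' j)).le.trans ?_
        exact_mod_cast h2
      · rw [min_eq_right h4] at h2
        refine (hx1 j).2.trans ?_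
        have : lo t (.inl j) + c t (.inl j) * σ t ≤ shiftedBdry X j (a j + 1) := by omega
        exact_mod_cast this
  · simp only [planBox, decodePoint_pointCode, shift, Sum.elim_inr, sub_zero, Int.cast_natCast]
    positivity
  · obtain ⟨i, hi, h1⟩ := H.long t ht j
    refine le_trans ?_ (add_le_add le_rfl ((decodeInstance X).size_le_maxSize ⟨i, hi⟩))
    have hb : (decodeInstance X).b j = (X.2.2.2.2 j : ℝ) / ((X.1 : ℝ) + 1) := rfl
    rw [decodeInstance_size, hb]
    simp only [planBox, decodePoint_pointCode, shift, Sum.elim_inr,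
      ← add_div, div_le_div_iff_of_pos_right hD, sub_zero]
    exact_mod_cast h1
  · simp only [planBox, decodePoint_pointCode, shift, Sum.elim_inr, sub_zero, Int.cast_natCast]
    positivity
  · have h1 := H.top t ht
    simp only [planBox, decodePoint_pointCode, shift, Sum.elim_inr,
      ← add_div, div_le_div_iff_of_pos_right hD, sub_zero]
    exact_mod_cast h1

theorem cube_eq (X : InstanceCode m q) (p : Coord m q → ℝ) (i : Fin (decodeInstance X).n) :
    cube p ((decodeInstance X).size i) =
      ⟨p, fun _ => (sizeNum X i : ℝ) / ((X.1 : ℝ) + 1)⟩ := by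
  rw [cube, decodeInstance_size]

/-- The volume condition for V-Boxes in terms of numerators. -/
theorem sum_le_vol_sub_iff (X : InstanceCode m q) (C : Cuboid (Coord m q)) (c : Coord m q → ℕ)
    (s : ℕ) (hside : ∀ j, C.side j = ((c j * s : ℕ) : ℝ) / ((X.1 : ℝ) + 1))
    (Q : Finset (Fin (decodeInstance X).n)) :
    ∑ i ∈ Q, (decodeInstance X).size i ^ Fintype.card (Coord m q) ≤
      C.vol - (s : ℝ) / ((X.1 : ℝ) + 1) * (C.surf / 2) ↔
    ∑ i ∈ Q, sizeNum X i ^ Fintype.card (Coord m q) +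
      s * ∑ j, ∏ j' ∈ Finset.univ.erase j, c j' * s ≤ ∏ j, c j * s := by
  have hD : (0 : ℝ) < (X.1 : ℝ) + 1 := by positivity
  set d := Fintype.card (Coord m q) with hd
  have h2 : ∀ s' : Finset (Coord m q), ∏ j ∈ s', C.side j =
      (∏ j ∈ s', c j * s : ℕ) / ((X.1 : ℝ) + 1) ^ s'.card := fun s' => by
    simp_rw [hside, Finset.prod_div_distrib, Finset.prod_const]
    push_cast
    rfl
  have hd0 : 0 < d := Fintype.card_pos_iff.2 ⟨.inr (.inr ())⟩
  have h3 : C.surf / 2 =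
      (∑ j, ∏ j' ∈ Finset.univ.erase j, c j' * s : ℕ) / ((X.1 : ℝ) + 1) ^ (d - 1) := by
    rw [Cuboid.surf, mul_div_cancel_left₀ _ two_ne_zero]
    push_cast
    rw [Finset.sum_div]
    refine Finset.sum_congr rfl fun j _ => ?_
    rw [h2, Finset.card_erase_of_mem (Finset.mem_univ j), Finset.card_univ]
    push_cast
    rfl
  rw [h3, Cuboid.vol, h2, Finset.card_univ, ← hd, div_mul_div_comm, ← pow_succ',
    Nat.sub_add_cancel hd0, ← sub_div, le_div_iff₀ (by positivity), Finset.sum_mul,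
    le_sub_iff_add_le]
  have h4 : ∑ i ∈ Q, (decodeInstance X).size i ^ d * ((X.1 : ℝ) + 1) ^ d =
      ((∑ i ∈ Q, sizeNum X i ^ d : ℕ) : ℝ) := by
    push_cast
    refine Finset.sum_congr rfl fun i _ => ?_
    rw [decodeInstance_size, ← mul_pow, div_mul_cancel₀ _ hD.ne']
  rw [h4]
  norm_cast

theorem sum_range_ite_eq (X : InstanceCode m q) (bx : ℕ → ℕ) (t : ℕ) (f : ℕ → ℕ) :
    (∑ i ∈ Finset.range X.2.1.length, if bx i = t then f i else 0) =
      ∑ i ∈ Finset.univ.filter fun i : Fin (decodeInstance X).n => bx i = t, f i := by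
  rw [Finset.sum_filter]
  exact Finset.sum_range fun i => if bx i = t then f i else 0

theorem IsPlan.isValidFor (H : IsPlan X M h L lo c σ pos bx) :
    IsValidFor (decodeInstance X) (decodePacking _ (planCode X h L lo c σ pos bx)) ∧
      (decodePacking (decodeInstance X).n (planCode X h L lo c σ pos bx)).boxes.length ≤ M ∧
      (decodePacking (decodeInstance X).n (planCode X h L lo c σ pos bx)).height =
        (h : ℝ) / ((X.1 : ℝ) + 1) := by
  have hD : (0 : ℝ) < (X.1 : ℝ) + 1 := by positivity
  have hboxes : (decodePacking (decodeInstance X).n (planCode X h L lo c σ pos bx)).boxes =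
      (List.range L).map (planBox X lo c σ) := by
    simp [decodePacking, planCode, planBox, Function.comp_def]
  have hitem : ∀ i : Fin (decodeInstance X).n, ((List.range X.2.1.length).map fun i =>
      (bx i, pointCode (gridBound X) (pos i))).getD i (0, 0, 0, 0) =
        (bx i, pointCode (gridBound X) (pos i)) := fun i => by
    have hi : (i : ℕ) < X.2.1.length := i.2
    rw [List.getD_eq_getElem _ _ (by simpa using hi)]
    simp
  have hbx : ∀ i, (decodePacking (decodeInstance X).n
      (planCode X h L lo c σ pos bx)).boxOf i = bx i := fun i => by
    simp only [decodePacking, planCode]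
    rw [hitem]
  have hpos : ∀ i, (decodePacking (decodeInstance X).n (planCode X h L lo c σ pos bx)).pos i =
      decodePoint X.1 (pointCode (gridBound X) (pos i)) := fun i => by
    simp only [decodePacking, planCode]
    rw [hitem]
  have hside : ∀ t j, (planBox X lo c σ t).side j = ((c t j * σ t : ℕ) : ℝ) / ((X.1 : ℝ) + 1) :=
    fun t j => decodePoint_pointCode_zero X.1 (fun j => c t j * σ t) j
  have hin : ∀ i : Fin (decodeInstance X).n,
      (cube (decodePoint X.1 (pointCode (gridBound X) (pos i)))
      ((decodeInstance X).size i)).toSet ⊆ (planBox X lo c σ (bx i)).toSet := fun i => by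
    rw [cube_eq]
    refine Cuboid.toSet_subset fun j => ?_
    obtain ⟨h1, h2, h3⟩ := H.item i i.2
    obtain ⟨h4, h5⟩ := h3 j
    rw [hside]
    simp only [planBox, decodePoint_pointCode, ← add_div, div_le_div_iff_of_pos_right hD]
    push_cast
    have h4' : (lo (bx i) j : ℝ) ≤ pos i j := by exact_mod_cast h4
    have h5' : (pos i j : ℝ) + sizeNum X i ≤ lo (bx i) j + c (bx i) j * σ (bx i) := by
      exact_mod_cast h5
    constructor <;> linarith
  have hsub : ∀ t < L, (planBox X lo c σ t).toSet ⊆ container (decodeInstance X).A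
      (fun j => (decodeInstance X).b j + (decodeInstance X).maxSize) ((h : ℝ) / ((X.1 : ℝ) + 1)) :=
    fun t ht => (H.box_holds ht).toSet_subset
  refine ⟨⟨⟨fun i => ?_, fun i i' hne => ?_⟩, ?_, ?_, fun i => ?_, fun t ht => ?_⟩, ?_, ?_⟩
  · rw [hpos]
    exact (hin i).trans (hsub _ (H.item i i.2).1)
  · rw [hpos, hpos, cube_eq, cube_eq]
    refine Cuboid.Separated.nonOverlapping (separated_of_nat
      (v := fun _ => sizeNum X i) (w := fun _ => sizeNum X i') ?_)
    exact H.items_sep i i.2 i' i'.2 fun h => hne (Fin.ext h)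
  · rw [hboxes]
    intro C hC
    obtain ⟨t, ht, rfl⟩ := List.mem_map.1 hC
    exact hsub t (List.mem_range.1 ht)
  · rw [hboxes, List.pairwise_map]
    refine List.Pairwise.imp_of_mem ?_ (List.pairwise_lt_range (n := L))
    intro t t' ht ht' hlt
    have := separated_of_nat (D := X.1) (K := gridBound X)
      (H.boxes_sep t (List.mem_range.1 ht) t' (List.mem_range.1 ht') hlt)
    refine (this.mono (C' := planBox X lo c σ t) (D' := planBox X lo c σ t') (fun j => ?_)
      fun j => ?_).nonOverlapping
    · rw [hside]; exact ⟨le_rfl, le_rfl⟩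
    · rw [hside]; exact ⟨le_rfl, le_rfl⟩
  · refine ⟨by rw [hboxes, hbx]; simpa using (H.item i i.2).1, ?_⟩
    rw [hpos]
    refine (hin i).trans (le_of_eq ?_)
    simp only [hboxes, hbx]
    simp
  · have ht' : t < L := by simpa [hboxes] using ht
    have hbox : (decodePacking (decodeInstance X).n (planCode X h L lo c σ pos bx)).boxes[t] =
        planBox X lo c σ t := by
      simp only [hboxes]
      simp
    rw [hbox]
    have hQ : (Finset.univ.filter fun i => (decodePacking (decodeInstance X).n
        (planCode X h L lo c σ pos bx)).boxOf i = t) = Finset.univ.filter fun i : Fin _ => bx i = t := by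
      simp only [hbx]
    rw [hQ]
    obtain ⟨hσ, hc⟩ := H.pos_mult t ht'
    have hσ' : (0 : ℝ) < σ t := by exact_mod_cast hσ
    have hbs : HasBoxSides (decodeInstance X).size
        (Finset.univ.filter fun i : Fin (decodeInstance X).n => bx i = t)
        (planBox X lo c σ t) ((σ t : ℝ) / ((X.1 : ℝ) + 1)) (c t) := by
      refine ⟨by positivity, fun i hi => ?_, fun j => ⟨hc j, ?_⟩⟩
      · have h1 := (H.item i i.2).2.1
        rw [(Finset.mem_filter.1 hi).2] at h1
        rw [decodeInstance_size, div_le_div_iff_of_pos_right hD]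
        exact_mod_cast h1
      · rw [hside]
        push_cast
        ring
    rcases H.type t ht' with h1 | h1
    · left
      refine ⟨_, _, hbs, ?_⟩
      rw [sum_range_ite_eq X bx t fun _ => 1] at h1
      simpa using h1
    · right
      refine ⟨_, _, hbs, ?_⟩
      rw [sum_range_ite_eq X bx t fun i => sizeNum X i ^ Fintype.card (Coord m q)] at h1
      exact (sum_le_vol_sub_iff X _ _ _ (hside t) _).2 h1
  · rw [hboxes]
    simpa using H.length_le
  · simp [decodePacking, planCode]

end Integral

/-! ### Rounding a real packing to an integral one. -/

section Completeness

variable {m q : ℕ}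

/-- A bound for all numbers that occur in an integral packing of height at most `h`. -/
def planBound (X : InstanceCode m q) (M h : ℕ) : ℕ :=
  2 * gridBound X + ∑ j, X.2.2.2.2 j + X.2.1.foldr (fun a b => a + b) 0 + h + M + 2

theorem getD_le_foldr (l : List ℕ) (k : ℕ) : l.getD k 0 ≤ l.foldr (fun a b => a + b) 0 := by
  induction l generalizing k with
  | nil => simp
  | cons z l ih =>
    cases k with
    | zero => simp
    | succ k =>
      have := ih k
      simp only [List.getD_cons_succ, List.foldr_cons]
      omega

theorem shiftedBdry_le (X : InstanceCode m q) (j : Fin m) (k : ℕ) :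
    shiftedBdry X j k ≤ 2 * gridBound X := by
  have h1 := shiftedBdry_cast X j k
  have h2 := natAbs_getD_le_gridBound X j k
  omega

/-- Rounding down is monotone and commutes with adding integers. Thus inequalities between
coordinates that differ by integral lengths, which express separation and containment, survive
rounding. -/
theorem floor_add_le_floor_add {x y : ℝ} {a b : ℕ} (h : x + a ≤ y + b) :
    ⌊x⌋ + (a : ℤ) ≤ ⌊y⌋ + b := by
  rw [← Int.floor_add_natCast, ← Int.floor_add_natCast]
  exact Int.floor_mono h

/-- A packing of a rational instance into good boxes can be made integral by rounding all
coordinates down. -/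
theorem Boxable.exists_isPlan {X : InstanceCode m q} {N M : ℕ} {α H : ℝ}
    (hI : (decodeInstance X).IsAdmissible N α)
    (HB : Boxable (decodeInstance X) Finset.univ H M) :
    ∃ (L : ℕ) (lo c : ℕ → Coord m q → ℕ) (σ : ℕ → ℕ) (pos : ℕ → Coord m q → ℕ) (bx : ℕ → ℕ),
      IsPlan X M ⌊H * ((X.1 : ℝ) + 1)⌋₊ L lo c σ pos bx ∧
      (∀ t j, lo t j < planBound X M ⌊H * ((X.1 : ℝ) + 1)⌋₊ ∧
        c t j < planBound X M ⌊H * ((X.1 : ℝ) + 1)⌋₊ ∧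
        pos t j < planBound X M ⌊H * ((X.1 : ℝ) + 1)⌋₊) ∧
      (∀ t, σ t < planBound X M ⌊H * ((X.1 : ℝ) + 1)⌋₊ ∧
        bx t < planBound X M ⌊H * ((X.1 : ℝ) + 1)⌋₊) ∧
      L < planBound X M ⌊H * ((X.1 : ℝ) + 1)⌋₊ := by
  classical
  set E : ℝ := (X.1 : ℝ) + 1 with hE
  have hE0 : 0 < E := by positivity
  set h := ⌊H * E⌋₊ with hh
  set B := planBound X M h with hB
  set K := gridBound X with hK
  obtain ⟨ι, _, box, R, hcard, hhold, hsep, hgood, hcov⟩ := HB 0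
  simp only [zero_add] at hhold
  choose bt hbt using fun i => hcov i (Finset.mem_univ i)
  choose i₀ c hbs htype using fun t => (hgood t).1
  choose p hp using fun t => (hgood t).2
  set e := Fintype.equivFin ι
  obtain ⟨imax, himax⟩ := (decodeInstance X).exists_size_eq_maxSize hI.nonempty
  have hn : 0 < X.2.1.length := hI.nonempty
  -- Indices out of range are sent to an arbitrary box, and below to the first item, so that the
  -- size bounds hold for all indices.
  set box' : ℕ → ι := fun t => if ht : t < Fintype.card ι then e.symm ⟨t, ht⟩ else bt ⟨0, hn⟩
    with hbox'
  set it : ℕ → Fin (decodeInstance X).n := fun i => if hi : i < X.2.1.length then ⟨i, hi⟩ else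
    ⟨0, hn⟩ with hit
  have hitlt : ∀ i (hi : i < X.2.1.length), it i = ⟨i, hi⟩ := fun i hi => by simp [hit, hi]
  set s : ι → ℕ := fun t => sizeNum X (i₀ t) with hs
  have hsize : ∀ i, (decodeInstance X).size i * E = sizeNum X i := fun i => by
    rw [decodeInstance_size, div_mul_cancel₀ _ hE0.ne']
  have hside : ∀ t j, (box t).side j * E = (c t j * s t : ℕ) := fun t j => by
    rw [((hbs t).2.2 j).2, mul_assoc, hsize]
    push_cast
    rfl
  have hs0 : ∀ t, 0 < s t := fun t => by
    have h1 : (0 : ℝ) < s t := by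
      have := hsize (i₀ t)
      simp only [hs]
      rw [← this]
      exact mul_pos (hbs t).1 hE0
    exact_mod_cast h1
  set up : Coord m q → ℕ := Sum.elim (fun _ => 2 * K) (Sum.elim
    (fun j => X.2.2.2.2 j + sizeNum X imax) fun _ => h) with hup
  have hsizeB : ∀ i, sizeNum X i ≤ X.2.1.foldr (fun a b => a + b) 0 := fun i => getD_le_foldr _ _
  have hupB : ∀ j, up j < B := by
    have h1 := hsizeB imax
    rintro (j | j | j)
    · simp only [hup, hB, planBound, Sum.elim_inl]
      omega
    · have h2 := Finset.single_le_sum (f := X.2.2.2.2) (fun _ _ => Nat.zero_le _)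
        (Finset.mem_univ j)
      simp only [hup, hB, planBound, Sum.elim_inl, Sum.elim_inr]
      omega
    · simp only [hup, hB, planBound, Sum.elim_inr]
      omega
  set lz : ι → Coord m q → ℤ := fun t j => ⌊(box t).lower j * E⌋ + shift K j with hlz
  have hbounds : ∀ t j, 0 ≤ lz t j ∧ lz t j + (c t j * s t : ℕ) ≤ up j := by
    intro t j
    have hsidej := hside t j
    have hs1 := (hgood t).side_pos
    rcases j with j | j | j
    · obtain ⟨a, -, ha⟩ := mem_region_decodeInstance.1 ((hhold t).short
        (Cuboid.mem_toSet.2 fun j => ⟨le_rfl, le_add_of_nonneg_right (hs1 (.inl j)).le⟩ :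
          (box t).short.lower ∈ _))
      obtain ⟨a', -, ha'⟩ := mem_region_decodeInstance.1 ((hhold t).short
        (Cuboid.mem_toSet.2 fun j => ⟨by
          simp only [Pi.add_apply, le_add_iff_nonneg_right]
          exact (hs1 (.inl j)).le, le_rfl⟩ :
          (box t).short.lower + (box t).short.side ∈ _))
      have h1 := (ha j).1
      have h2 := (ha' j).2
      have h3 : (shiftedBdry X j (a' j + 1) : ℝ) ≤ (2 * K : ℕ) := by
        exact_mod_cast shiftedBdry_le X j _
      have h4 : (0 : ℝ) ≤ shiftedBdry X j (a j) := Nat.cast_nonneg _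
      simp only [Pi.add_apply, Cuboid.short] at h1 h2
      simp only [hlz, hup, shift, Sum.elim_inl]
      have e1 := floor_add_le_floor_add (x := 0) (y := (box t).lower (.inl j) * E) (a := 0) (b := K)
        (by push_cast; linarith)
      have e2 := floor_add_le_floor_add (x := (box t).lower (.inl j) * E) (y := 0)
        (a := c t (.inl j) * s t + K) (b := 2 * K) (by push_cast at hsidej h3 ⊢; linarith)
      simp only [Int.floor_zero] at e1 e2
      push_cast at e1 e2 ⊢
      constructor <;> linarith
    · obtain ⟨h1, h2⟩ := (hhold t).long j
      rw [← himax] at h2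
      have hb : (decodeInstance X).b j * E = X.2.2.2.2 j := div_mul_cancel₀ _ hE0.ne'
      have h3 := mul_le_mul_of_nonneg_right h2 hE0.le
      rw [add_mul, add_mul, hb, hsize, hside] at h3
      simp only [hlz, hup, shift, Sum.elim_inl, Sum.elim_inr]
      have e1 := floor_add_le_floor_add (x := 0) (y := (box t).lower (.inr (.inl j)) * E) (a := 0)
        (b := 0) (by push_cast; simp only [add_zero]; positivity)
      have e2 := floor_add_le_floor_add (x := (box t).lower (.inr (.inl j)) * E) (y := 0)
        (a := c t (.inr (.inl j)) * s t) (b := X.2.2.2.2 j + sizeNum X imax)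
        (by push_cast at h3 ⊢; linarith)
      simp only [Int.floor_zero] at e1 e2
      push_cast at e1 e2 ⊢
      constructor <;> linarith
    · have h1 := (hhold t).bot
      have h2 := (hhold t).top
      have h3 := mul_le_mul_of_nonneg_right h2 hE0.le
      rw [add_mul, hside] at h3
      simp only [hlz, hup, shift, Sum.elim_inr, add_zero]
      have e1 : 0 ≤ ⌊(box t).lower (.inr (.inr ())) * E⌋ := Int.floor_nonneg.2 (by positivity)
      refine ⟨e1, ?_⟩
      have e2 : ⌊(box t).lower (.inr (.inr ())) * E⌋ + (c t (.inr (.inr ())) * s t : ℕ) ≤ ⌊H * E⌋ := by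
        rw [← Int.floor_add_natCast]
        exact Int.floor_mono h3
      refine e2.trans ?_
      rw [hh]
      exact Int.self_le_toNat _
  have hlo : ∀ t j, ((lz t j).toNat : ℤ) = lz t j := fun t j => Int.toNat_of_nonneg (hbounds t j).1
  have hpin : ∀ i j, lz (bt i) j ≤ ⌊p (bt i) i j * E⌋ + shift K j ∧
      ⌊p (bt i) i j * E⌋ + shift K j + sizeNum X i ≤ lz (bt i) j + (c (bt i) j * s (bt i) : ℕ) := by
    intro i j
    obtain ⟨h1, h2⟩ := (hp (bt i)).1 i (hbt i) j
    have h3 := mul_le_mul_of_nonneg_right h1 hE0.le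
    have h4 := mul_le_mul_of_nonneg_right h2 hE0.le
    rw [add_mul, add_mul, hsize, hside] at h4
    have e1 := floor_add_le_floor_add h4
    have e2 := Int.floor_mono h3
    simp only [hlz]
    constructor <;> linarith
  have hpos : ∀ i j, ((⌊p (bt i) i j * E⌋ + shift K j).toNat : ℤ) =
      ⌊p (bt i) i j * E⌋ + shift K j := fun i j =>
    Int.toNat_of_nonneg ((hbounds _ j).1.trans (hpin i j).1)
  have hL : Fintype.card ι < B := by
    simp only [hB, planBound]
    omega
  have hbox'lt : ∀ t (ht : t < Fintype.card ι), box' t = e.symm ⟨t, ht⟩ := fun t ht => by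
    simp [hbox', ht]
  have hbox'e : ∀ t, box' (e t) = t := fun t => by simp [hbox']
  refine ⟨Fintype.card ι, fun t j => (lz (box' t) j).toNat, fun t => c (box' t),
    fun t => s (box' t), fun i j => (⌊p (bt (it i)) (it i) j * E⌋ + shift K j).toNat,
    fun i => e (bt (it i)), ⟨hcard, ?_, ?_, ?_, ?_, ?_, ?_, ?_, ?_⟩, ?_, ?_, hL⟩
  · exact fun t _ => ⟨hs0 _, fun j => ((hbs _).2.2 j).1⟩
  · intro t _ u hu
    set b := box' t
    have hu' : ∀ j, (lz b (.inl j) : ℤ) ≤ u j ∧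
        (u j : ℤ) + 1 ≤ lz b (.inl j) + (c b (.inl j) * s b : ℕ) := fun j => by
      obtain ⟨h1, h2⟩ := hu j
      have h3 := hlo b (.inl j)
      constructor
      · rw [← h3]; exact_mod_cast h1
      · rw [← h3]; exact_mod_cast h2
    -- A test point in the unit cell `u` that also lies in the unrounded box. With `f` the
    -- fractional part of the scaled lower end, the offset `(f + 1)/2` is at least `f`, which keeps
    -- the point above the lower end, and at most `f + 1`, which keeps it below the upper end. It
    -- lies strictly between 0 and 1, so a grid cell with integral boundaries containing the point
    -- contains the whole unit cell.
    set x : Fin m → ℝ := fun j =>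
      ((u j : ℝ) - K + (Int.fract ((box b).lower (.inl j) * E) + 1) / 2) / E with hx
    have hxE : ∀ j, x j * E = (u j : ℝ) - K + (Int.fract ((box b).lower (.inl j) * E) + 1) / 2 :=
      fun j => div_mul_cancel₀ _ hE0.ne'
    have hmem : x ∈ (box b).short.toSet := by
      rw [Cuboid.mem_toSet]
      intro j
      obtain ⟨h1, h2⟩ := hu' j
      have h3 := Int.floor_add_fract ((box b).lower (.inl j) * E)
      have h4 := Int.fract_lt_one ((box b).lower (.inl j) * E)
      have h5 := Int.fract_nonneg ((box b).lower (.inl j) * E)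
      have h6 := hside b (.inl j)
      simp only [hlz, shift, Sum.elim_inl] at h1 h2
      have h1' : (⌊(box b).lower (.inl j) * E⌋ : ℝ) + K ≤ u j := by exact_mod_cast h1
      have h2' : (u j : ℝ) + 1 ≤ ⌊(box b).lower (.inl j) * E⌋ + K + (c b (.inl j) * s b : ℕ) := by
        exact_mod_cast h2
      simp only [Cuboid.short]
      constructor
      · refine le_of_mul_le_mul_right ?_ hE0
        rw [hxE]
        linarith
      · refine le_of_mul_le_mul_right ?_ hE0
        rw [hxE, add_mul, h6]
        linarith
    obtain ⟨a, ha, hau⟩ := mem_region_decodeInstance.1 ((hhold b).short hmem)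
    refine ⟨a, ha, fun j => ?_⟩
    obtain ⟨h1, h2⟩ := hau j
    have h4 := Int.fract_lt_one ((box b).lower (.inl j) * E)
    have h5 := Int.fract_nonneg ((box b).lower (.inl j) * E)
    rw [← hE, hxE] at h1 h2
    constructor
    · have : (shiftedBdry X j (a j) : ℝ) < (u j + 1 : ℕ) := by push_cast; linarith
      exact Nat.lt_succ_iff.1 (by exact_mod_cast this)
    · have : (u j : ℝ) < shiftedBdry X j (a j + 1) := by linarith
      exact_mod_cast this
  · intro t _ j
    refine ⟨imax, imax.2, ?_⟩
    have h1 := (hbounds (box' t) (.inr (.inl j))).2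
    rw [← hlo] at h1
    exact_mod_cast h1
  · intro t _
    have h1 := (hbounds (box' t) (.inr (.inr ()))).2
    rw [← hlo] at h1
    exact_mod_cast h1
  · intro t ht t' ht' hlt
    obtain ⟨j, hj⟩ := hsep (box' t) (box' t') (by
      rw [hbox'lt t ht, hbox'lt t' ht']
      exact fun h => hlt.ne (by simpa using e.symm.injective h))
    refine ⟨j, ?_⟩
    zify
    rw [hlo, hlo]
    simp only [hlz]
    refine hj.imp (fun h => ?_) (fun h => ?_)
    · have h1 := mul_le_mul_of_nonneg_right h hE0.le
      rw [add_mul, hside] at h1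
      have := floor_add_le_floor_add (x := (box (box' t)).lower j * E) (a := c (box' t) j * s (box' t))
        (y := (box (box' t')).lower j * E) (b := 0) (by rwa [Nat.cast_zero, add_zero])
      push_cast at this
      linarith
    · have h1 := mul_le_mul_of_nonneg_right h hE0.le
      rw [add_mul, hside] at h1
      have := floor_add_le_floor_add (x := (box (box' t')).lower j * E) (a := c (box' t') j * s (box' t'))
        (y := (box (box' t)).lower j * E) (b := 0) (by rwa [Nat.cast_zero, add_zero])
      push_cast at this
      linarith
  · intro i hi
    simp only [hbox'e]
    refine ⟨(e _).2, ?_, fun j => ?_⟩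
    · have h1 := (hbs (bt (it i))).2.1 (it i) (hbt _)
      have h2 := mul_le_mul_of_nonneg_right h1 hE0.le
      rw [hsize, hsize, hitlt i hi] at h2
      simp only [hs]
      rw [hitlt i hi]
      exact_mod_cast h2
    · obtain ⟨h1, h2⟩ := hpin (it i) j
      have h3 : sizeNum X (it i) = sizeNum X i := by rw [hitlt i hi]
      rw [h3] at h2
      zify
      rw [hlo, hpos]
      push_cast at h2
      exact ⟨h1, h2⟩
  · intro i hi i' hi' hne
    have hne' : it i ≠ it i' := by
      rw [hitlt i hi, hitlt i' hi']
      exact fun h => hne (congrArg Fin.val h)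
    have hs1 : sizeNum X (it i) = sizeNum X i := by rw [hitlt i hi]
    have hs2 : sizeNum X (it i') = sizeNum X i' := by rw [hitlt i' hi']
    have hsepi : (cube (p (bt (it i)) (it i)) ((decodeInstance X).size (it i))).Separated
        (cube (p (bt (it i')) (it i')) ((decodeInstance X).size (it i'))) := by
      by_cases hb : bt (it i) = bt (it i')
      · have := (hp (bt (it i))).2 (it i) (hbt _) (it i') (by rw [hb]; exact hbt _) hne'
        rwa [← hb]
      · exact (hsep _ _ hb).mono (fun j => (hp _).1 _ (hbt _) j) (fun j => (hp _).1 _ (hbt _) j)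
    obtain ⟨j, hj⟩ := hsepi
    simp only [cube] at hj
    refine ⟨j, ?_⟩
    zify
    rw [hpos, hpos]
    refine hj.imp (fun h => ?_) (fun h => ?_)
    · have h1 := mul_le_mul_of_nonneg_right h hE0.le
      rw [add_mul, hsize, hs1] at h1
      have := floor_add_le_floor_add (x := p (bt (it i)) (it i) j * E) (a := sizeNum X i)
        (y := p (bt (it i')) (it i') j * E) (b := 0) (by rwa [Nat.cast_zero, add_zero])
      push_cast at this
      linarith
    · have h1 := mul_le_mul_of_nonneg_right h hE0.le
      rw [add_mul, hsize, hs2] at h1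
      have := floor_add_le_floor_add (x := p (bt (it i')) (it i') j * E) (a := sizeNum X i')
        (y := p (bt (it i)) (it i) j * E) (b := 0) (by rwa [Nat.cast_zero, add_zero])
      push_cast at this
      linarith
  · intro t ht
    have hsub : (Finset.univ.filter fun i : Fin (decodeInstance X).n => (e (bt (it i)) : ℕ) = t) ⊆
        R (box' t) := by
      intro i hi
      have h1 := (Finset.mem_filter.1 hi).2
      rw [hitlt i i.2] at h1
      have h2 : box' t = bt i := by
        rw [hbox'lt t ht, Equiv.symm_apply_eq]
        exact Fin.ext h1.symm
      rw [h2]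
      exact hbt i
    rw [sum_range_ite_eq X _ t fun _ => 1, sum_range_ite_eq X _ t fun i => sizeNum X i ^ _]
    refine (htype (box' t)).imp (fun h1 => ?_) (fun h1 => ?_)
    · rw [Finset.sum_const, smul_eq_mul, mul_one]
      exact (Finset.card_le_card hsub).trans h1
    · have h2 : (∑ i ∈ Finset.univ.filter fun i : Fin (decodeInstance X).n =>
          (e (bt (it i)) : ℕ) = t, (decodeInstance X).size i ^ Fintype.card (Coord m q)) ≤
          (box (box' t)).vol - (s (box' t) : ℝ) / ((X.1 : ℝ) + 1) * ((box (box' t)).surf / 2) := by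
        refine (Finset.sum_le_sum_of_subset_of_nonneg hsub
          fun i _ _ => pow_nonneg (hI.size_pos i).le _).trans (h1.trans (le_of_eq ?_))
        rw [decodeInstance_size]
      exact (sum_le_vol_sub_iff X _ (c (box' t)) (s (box' t)) (fun j => by
        rw [eq_div_iff hE0.ne', hside]) _).1 h2
  · intro t j
    refine ⟨?_, ?_, ?_⟩
    · have h1 := (hbounds (box' t) j).2
      have h2 := hupB j
      rw [← hlo] at h1
      zify at h2 ⊢
      have : (0 : ℤ) ≤ (c (box' t) j * s (box' t) : ℕ) := Int.natCast_nonneg _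
      linarith
    · have h1 := hbounds (box' t) j
      have h2 := hupB j
      have h3 : c (box' t) j ≤ c (box' t) j * s (box' t) := Nat.le_mul_of_pos_right _ (hs0 _)
      zify at h2 h3 ⊢
      have h4 := h1.1
      have h5 := h1.2
      push_cast at h5
      linarith
    · have h1 := hpin (it t) j
      have h2 := (hbounds (bt (it t)) j).2
      have h3 := hupB j
      zify at h3 ⊢
      rw [hpos]
      have : (0 : ℤ) ≤ sizeNum X (it t) := Int.natCast_nonneg _
      linarith [h1.2]
  · intro t
    refine ⟨?_, ?_⟩
    · have := hsizeB (i₀ (box' t))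
      simp only [hs, hB, planBound]
      omega
    · exact lt_trans (e (bt (it t))).2 hL

end Completeness

/-! ### Primitive recursive functions and predicates -/

section PrimitiveRecursion

attribute [fun_prop] Primrec
attribute [fun_prop] Primrec.id Primrec.const Primrec.comp Primrec.fst Primrec.snd Primrec.pair

variable {γ δ : Type*} [Primcodable γ] [Primcodable δ]

@[fun_prop]
theorem primrec_add {f g : γ → ℕ} (hf : Primrec f) (hg : Primrec g) :
    Primrec fun a => f a + g a :=
  Primrec.nat_add.comp hf hg

@[fun_prop]
theorem primrec_sub {f g : γ → ℕ} (hf : Primrec f) (hg : Primrec g) :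
    Primrec fun a => f a - g a :=
  Primrec.nat_sub.comp hf hg

@[fun_prop]
theorem primrec_mul {f g : γ → ℕ} (hf : Primrec f) (hg : Primrec g) :
    Primrec fun a => f a * g a :=
  Primrec.nat_mul.comp hf hg

@[fun_prop]
theorem primrec_div {f g : γ → ℕ} (hf : Primrec f) (hg : Primrec g) :
    Primrec fun a => f a / g a :=
  Primrec.nat_div.comp hf hg

@[fun_prop]
theorem primrec_mod {f g : γ → ℕ} (hf : Primrec f) (hg : Primrec g) :
    Primrec fun a => f a % g a :=
  Primrec.nat_mod.comp hf hg

@[fun_prop]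
theorem primrec_pow {f g : γ → ℕ} (hf : Primrec f) (hg : Primrec g) :
    Primrec fun a => f a ^ g a :=
  (Primrec₂.unpaired'.1 Nat.Primrec.pow).comp hf hg

@[fun_prop]
theorem primrec_length {f : γ → List δ} (hf : Primrec f) : Primrec fun a => (f a).length :=
  Primrec.list_length.comp hf

@[fun_prop]
theorem primrec_getD {f : γ → List δ} {g : γ → ℕ} (d : δ) (hf : Primrec f) (hg : Primrec g) :
    Primrec fun a => (f a).getD (g a) d :=
  (Primrec.list_getD d).comp hf hg

theorem primrec_apply {n : ℕ} {f : γ → Fin n → δ} (hf : Primrec f) (j : Fin n) :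
    Primrec fun a => f a j :=
  Primrec.fin_app.comp hf (Primrec.const j)

theorem primrec_pi {n : ℕ} {f : γ → Fin n → δ} (hf : ∀ j, Primrec fun a => f a j) : Primrec f :=
  Primrec.fin_curry.2 (Primrec₂.swap (Primrec.fin_curry₁ (f := fun j a => f a j).2 hf))

theorem primrec_finset_sum {κ : Type*} (s : Finset κ) {f : κ → γ → ℕ} (hf : ∀ j, Primrec (f j)) :
    Primrec fun a => ∑ j ∈ s, f j a := by
  classical
  induction s using Finset.induction_on with
  | empty => simpa using Primrec.const 0
  | insert j s hj ih => simpa [Finset.sum_insert hj] using primrec_add (hf j) ih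

theorem primrec_finset_prod {κ : Type*} (s : Finset κ) {f : κ → γ → ℕ} (hf : ∀ j, Primrec (f j)) :
    Primrec fun a => ∏ j ∈ s, f j a := by
  classical
  induction s using Finset.induction_on with
  | empty => simpa using Primrec.const 1
  | insert j s hj ih => simpa [Finset.prod_insert hj] using primrec_mul (hf j) ih

theorem primrec_sum_range {f : γ → ℕ} {g : γ → ℕ → ℕ} (hf : Primrec f)
    (hg : Primrec fun p : γ × ℕ => g p.1 p.2) : Primrec fun a => ∑ i ∈ Finset.range (f a), g a i := by
  have h : Primrec₂ fun (a : γ) (p : ℕ × ℕ) => p.2 + g a p.1 :=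
    primrec_add (by fun_prop) (hg.comp (g := fun x : γ × ℕ × ℕ => (x.1, x.2.1)) (by fun_prop))
  refine (Primrec.nat_rec' hf (Primrec.const 0) h).of_eq fun a => ?_
  induction f a with
  | zero => rfl
  | succ n ih => rw [Finset.sum_range_succ, ← ih]

theorem primrec_foldr_add {f : γ → List δ} {g : δ → ℕ} (hf : Primrec f) (hg : Primrec g) :
    Primrec fun a => (f a).foldr (fun z b => g z + b) 0 :=
  Primrec.list_foldr hf (Primrec.const 0) (h := fun _ p => g p.1 + p.2)
    (primrec_add (hg.comp (by fun_prop)) (by fun_prop))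

/-- Integers are encoded by `n ↦ 2n` and `-(n+1) ↦ 2n+1`, so the absolute value is `(code + 1) / 2`.
-/
theorem primrec_natAbs : Primrec Int.natAbs := by
  have h : Primrec fun z : ℤ => (Encodable.encode z + 1) / 2 :=
    primrec_div (primrec_add Primrec.encode (Primrec.const 1)) (Primrec.const 2)
  refine h.of_eq fun z => ?_
  cases z with
  | ofNat n => change (2 * n + 1) / 2 = n; omega
  | negSucc n => change (2 * n + 1 + 1) / 2 = n + 1; omega

theorem primrecPred_le {f g : γ → ℕ} (hf : Primrec f) (hg : Primrec g) :
    PrimrecPred fun a => f a ≤ g a :=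
  Primrec.nat_le.comp hf hg

theorem primrecPred_lt {f g : γ → ℕ} (hf : Primrec f) (hg : Primrec g) :
    PrimrecPred fun a => f a < g a :=
  Primrec.nat_lt.comp hf hg

theorem primrecPred_eq {f g : γ → ℕ} (hf : Primrec f) (hg : Primrec g) :
    PrimrecPred fun a => f a = g a :=
  Primrec.eq.comp hf hg

theorem primrec_toNat_add {f : γ → ℤ} {g : γ → ℕ} (hf : Primrec f) (hg : Primrec g) :
    Primrec fun a => (f a + g a).toNat := by
  have he : Primrec fun a => Encodable.encode (f a) := Primrec.encode.comp hf
  have h : Primrec fun a => if Encodable.encode (f a) % 2 = 0 then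
      Encodable.encode (f a) / 2 + g a else g a - (Encodable.encode (f a) / 2 + 1) :=
    Primrec.ite (primrecPred_eq (by fun_prop) (by fun_prop)) (by fun_prop) (by fun_prop)
  refine h.of_eq fun a => ?_
  cases hz : f a with
  | ofNat n =>
    have : Encodable.encode (Int.ofNat n) = 2 * n := rfl
    rw [this, if_pos (by omega), Int.ofNat_eq_natCast]
    omega
  | negSucc n =>
    have : Encodable.encode (Int.negSucc n) = 2 * n + 1 := rfl
    rw [this, if_neg (by omega), Int.negSucc_eq]
    omega

theorem primrec_cast_sub_cast {f g : γ → ℕ} (hf : Primrec f) (hg : Primrec g) :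
    Primrec fun a => (f a : ℤ) - (g a : ℤ) := by
  refine Primrec.encode_iff.1 ?_
  have h : Primrec fun a => if g a ≤ f a then 2 * (f a - g a) else 2 * (g a - f a - 1) + 1 :=
    Primrec.ite (primrecPred_le hg hf) (by fun_prop) (by fun_prop)
  refine h.of_eq fun a => ?_
  split_ifs with hle
  · have : (f a : ℤ) - (g a : ℤ) = ((f a - g a : ℕ) : ℤ) := by omega
    rw [this]
    rfl
  · have : (f a : ℤ) - (g a : ℤ) = Int.negSucc (g a - f a - 1) := by omega
    rw [this]
    rfl

theorem primrec_natCast {f : γ → ℕ} (hf : Primrec f) : Primrec fun a => (f a : ℤ) :=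
  (primrec_cast_sub_cast hf (Primrec.const 0)).of_eq fun a => by simp

theorem primrecPred_imp {p q : γ → Prop} (hp : PrimrecPred p) (hq : PrimrecPred q) :
    PrimrecPred fun a => p a → q a :=
  (hp.not.or hq).of_eq fun _ => imp_iff_not_or.symm

theorem primrecPred_forall_lt {f : γ → ℕ} {P : γ → ℕ → Prop} (hf : Primrec f)
    (hP : PrimrecPred fun p : γ × ℕ => P p.1 p.2) : PrimrecPred fun a => ∀ t < f a, P a t := by
  have h : PrimrecRel fun (t : ℕ) (a : γ) => P a t :=
    hP.comp (f := fun x : ℕ × γ => (x.2, x.1)) (by fun_prop)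
  exact (h.forall_mem_list.comp (Primrec.list_range.comp hf) Primrec.id).of_eq fun a => by simp

theorem primrecPred_exists_lt {f : γ → ℕ} {P : γ → ℕ → Prop} (hf : Primrec f)
    (hP : PrimrecPred fun p : γ × ℕ => P p.1 p.2) : PrimrecPred fun a => ∃ t < f a, P a t := by
  have h : PrimrecRel fun (t : ℕ) (a : γ) => P a t :=
    hP.comp (f := fun x : ℕ × γ => (x.2, x.1)) (by fun_prop)
  exact (h.exists_mem_list.comp (Primrec.list_range.comp hf) Primrec.id).of_eq fun a => by simp

theorem primrecPred_exists_mem {f : γ → List δ} {P : γ → δ → Prop} (hf : Primrec f)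
    (hP : PrimrecPred fun p : γ × δ => P p.1 p.2) : PrimrecPred fun a => ∃ x ∈ f a, P a x := by
  have h : PrimrecRel fun (x : δ) (a : γ) => P a x :=
    hP.comp (f := fun x : δ × γ => (x.2, x.1)) (by fun_prop)
  exact h.exists_mem_list.comp hf Primrec.id

theorem primrecPred_const (p : Prop) : PrimrecPred fun _ : γ => p := by
  classical
  exact ⟨fun _ => inferInstance, Primrec.const (decide p)⟩

theorem primrecPred_forall_mem {κ : Type*} (s : Finset κ) {P : κ → γ → Prop}
    (hP : ∀ j, PrimrecPred (P j)) : PrimrecPred fun a => ∀ j ∈ s, P j a := by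
  classical
  induction s using Finset.induction_on with
  | empty => simpa using primrecPred_const True
  | insert j s hj ih => simpa using (hP j).and ih

theorem primrecPred_forall {κ : Type*} [Fintype κ] {P : κ → γ → Prop}
    (hP : ∀ j, PrimrecPred (P j)) : PrimrecPred fun a => ∀ j, P j a :=
  (primrecPred_forall_mem Finset.univ hP).of_eq fun a => by simp

theorem primrecPred_exists {κ : Type*} [Fintype κ] {P : κ → γ → Prop}
    (hP : ∀ j, PrimrecPred (P j)) : PrimrecPred fun a => ∃ j, P j a :=
  (primrecPred_forall fun j => (hP j).not).not.of_eq fun a => by simp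

/-- A bounded search for a witness, with the least possible first parameter. -/
theorem exists_partrec_minimal {chk : γ × ℕ × ℕ → Prop} {B : γ × ℕ → ℕ} {out : γ × ℕ × ℕ → δ}
    (hchk : PrimrecPred chk) (hB : Primrec B) (hout : Primrec out) :
    ∃ alg : γ →. δ, Partrec alg ∧ ∀ x h₀, (∃ y < B (x, h₀), chk (x, h₀, y)) →
      ∃ h y, h ≤ h₀ ∧ chk (x, h, y) ∧ out (x, h, y) ∈ alg x := by
  classical
  have h1 : PrimrecPred fun p : γ × ℕ => ∃ y < B p, chk (p.1, p.2, y) :=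
    primrecPred_exists_lt hB
      (hchk.comp (f := fun x : (γ × ℕ) × ℕ => (x.1.1, x.1.2, x.2)) (by fun_prop))
  have h2 : PrimrecPred fun p : (γ × ℕ) × ℕ => chk (p.1.1, p.1.2, p.2) :=
    hchk.comp (f := fun p : (γ × ℕ) × ℕ => (p.1.1, p.1.2, p.2)) (by fun_prop)
  -- Two successive searches: for the least `h` that has a witness below the bound, which is
  -- decidable, and then for a witness `y` of this `h`. The first ends at or before `h₀`, the second
  -- because a witness exists.
  have r1 : Partrec fun x : γ => Nat.rfind fun h =>
      Part.some (decide (∃ y < B (x, h), chk (x, h, y))) :=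
    Partrec.rfind (Computable.partrec (primrecPred_iff_primrec_decide.1 h1).to_comp).to₂
  have r2 : Partrec fun p : γ × ℕ => Nat.rfind fun y => Part.some (decide (chk (p.1, p.2, y))) :=
    Partrec.rfind (Computable.partrec (primrecPred_iff_primrec_decide.1 h2).to_comp).to₂
  have r3 : Partrec fun p : γ × ℕ => (Nat.rfind fun y =>
      Part.some (decide (chk (p.1, p.2, y)))).map fun y => out (p.1, p.2, y) :=
    r2.map (hout.comp (g := fun x : (γ × ℕ) × ℕ => (x.1.1, x.1.2, x.2)) (by fun_prop)).to_comp.to₂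
  refine ⟨_, r1.bind r3.to₂, fun x h₀ hx => ?_⟩
  have hd1 : (Nat.rfind fun h => Part.some (decide (∃ y < B (x, h), chk (x, h, y)))).Dom :=
    Nat.rfind_dom.2 ⟨h₀, by simpa using hx, fun _ => trivial⟩
  obtain ⟨h, hh⟩ := Part.dom_iff_mem.1 hd1
  have hh' := Nat.mem_rfind.1 hh
  have hex : ∃ y < B (x, h), chk (x, h, y) := by simpa using hh'.1
  obtain ⟨y₀, -, hy₀⟩ := hex
  have hd2 : (Nat.rfind fun y => Part.some (decide (chk (x, h, y)))).Dom :=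
    Nat.rfind_dom.2 ⟨y₀, by simpa using hy₀, fun _ => trivial⟩
  obtain ⟨y, hy⟩ := Part.dom_iff_mem.1 hd2
  have hy' := Nat.mem_rfind.1 hy
  refine ⟨h, y, ?_, by simpa using hy'.1, ?_⟩
  · by_contra hlt
    have := hh'.2 (not_le.1 hlt)
    simp only [Part.mem_some_iff] at this
    exact absurd hx (by simpa using this)
  · exact Part.mem_bind_iff.2 ⟨h, hh, Part.mem_map _ hy⟩

end PrimitiveRecursion

/-- Every finite sequence of digits is the sequence of digits of a number. -/
theorem exists_digits (R : ℕ) (E : ℕ) (f : ℕ → ℕ) (hf : ∀ e < E, f e < R) :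
    ∃ y < R ^ E, ∀ e < E, y / R ^ e % R = f e := by
  induction E with
  | zero => exact ⟨0, by simp, by simp⟩
  | succ E ih =>
    obtain ⟨y, hy, hd⟩ := ih fun e he => hf e (by omega)
    have hE := hf E (by omega)
    have hR : 0 < R := by omega
    refine ⟨y + R ^ E * f E, ?_, fun e he => ?_⟩
    · calc y + R ^ E * f E < R ^ E + R ^ E * f E := by omega
        _ = R ^ E * (f E + 1) := by ring
        _ ≤ R ^ E * R := Nat.mul_le_mul_left _ hE
        _ = R ^ (E + 1) := (pow_succ _ _).symm
    · rcases Nat.lt_succ_iff_lt_or_eq.1 he with he | rfl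
      · obtain ⟨k, rfl⟩ : ∃ k, E = e + 1 + k := ⟨E - (e + 1), by omega⟩
        rw [show R ^ (e + 1 + k) * f (e + 1 + k) = R ^ e * (R * (R ^ k * f (e + 1 + k))) by ring,
          Nat.add_mul_div_left _ _ (by positivity), Nat.add_mul_mod_self_left]
        exact hd e he
      · rw [Nat.add_mul_div_left _ _ (by positivity), Nat.div_eq_of_lt hy, zero_add,
          Nat.mod_eq_of_lt hE]

/-! ### The algorithm -/

section Algorithm

variable {m q : ℕ} {γ : Type*} [Primcodable γ]

/-- Only values at indices of actual boxes and items matter, so the digits read off at other indices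
may be anything. -/
theorem IsPlan.congr {X : InstanceCode m q} {M h L : ℕ} {lo c pos lo' c' pos' : ℕ → Coord m q → ℕ}
    {σ bx σ' bx' : ℕ → ℕ} (H : IsPlan X M h L lo c σ pos bx) (hlo : ∀ t < L, lo' t = lo t)
    (hc : ∀ t < L, c' t = c t) (hσ : ∀ t < L, σ' t = σ t)
    (hpos : ∀ i < X.2.1.length, pos' i = pos i) (hbx : ∀ i < X.2.1.length, bx' i = bx i) :
    IsPlan X M h L lo' c' σ' pos' bx' where
  length_le := H.length_le
  pos_mult t ht := by
    rw [hσ t ht, hc t ht]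
    exact H.pos_mult t ht
  short t ht := by
    rw [hσ t ht, hc t ht, hlo t ht]
    exact H.short t ht
  long t ht := by
    rw [hσ t ht, hc t ht, hlo t ht]
    exact H.long t ht
  top t ht := by
    rw [hσ t ht, hc t ht, hlo t ht]
    exact H.top t ht
  boxes_sep t ht t' ht' := by
    rw [hσ t ht, hc t ht, hlo t ht, hσ t' ht', hc t' ht', hlo t' ht']
    exact H.boxes_sep t ht t' ht'
  item i hi := by
    have h1 := H.item i hi
    rw [hbx i hi, hσ _ h1.1, hc _ h1.1, hlo _ h1.1, hpos i hi]
    exact h1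
  items_sep i hi i' hi' := by
    rw [hpos i hi, hpos i' hi']
    exact H.items_sep i hi i' hi'
  type t ht := by
    have h1 : ∀ f : ℕ → ℕ, (∑ i ∈ Finset.range X.2.1.length, if bx' i = t then f i else 0) =
        ∑ i ∈ Finset.range X.2.1.length, if bx i = t then f i else 0 := fun f =>
      Finset.sum_congr rfl fun i hi => by rw [hbx i (Finset.mem_range.1 hi)]
    rw [h1 fun _ => 1, h1 fun i => sizeNum X i ^ _, hσ t ht, hc t ht]
    exact H.type t ht

@[fun_prop]
theorem primrec_gridBound : Primrec (gridBound : InstanceCode m q → ℕ) :=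
  primrec_finset_sum _ fun j => primrec_foldr_add
    (primrec_apply (f := fun X : InstanceCode m q => X.2.2.1) (by fun_prop) j) primrec_natAbs

@[fun_prop]
theorem primrec_sizeNum {f : γ → InstanceCode m q} {g : γ → ℕ} (hf : Primrec f) (hg : Primrec g) :
    Primrec fun a => sizeNum (f a) (g a) :=
  primrec_getD 0 (by fun_prop) hg

@[fun_prop]
theorem primrec_shiftedBdry {f : γ → InstanceCode m q} {g : γ → ℕ} (j : Fin m) (hf : Primrec f)
    (hg : Primrec g) : Primrec fun a => shiftedBdry (f a) j (g a) :=
  primrec_toNat_add (primrec_getD 0 (primrec_apply (f := fun a => (f a).2.2.1) (by fun_prop) j) hg)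
    (by fun_prop)

@[fun_prop]
theorem primrec_planBound {f : γ → InstanceCode m q} {g : γ → ℕ} (M : ℕ) (hf : Primrec f)
    (hg : Primrec g) : Primrec fun a => planBound (f a) M (g a) := by
  have h1 : Primrec fun a => ∑ j, (f a).2.2.2.2 j := primrec_finset_sum _ fun j =>
    primrec_apply (f := fun a => (f a).2.2.2.2) (by fun_prop) j
  have h2 : Primrec fun a => (f a).2.1.foldr (fun a b => a + b) 0 :=
    primrec_foldr_add (g := fun a => a) (by fun_prop) Primrec.id
  unfold planBound
  fun_prop

theorem primrec_pointCode {K : γ → ℕ} {v : γ → Coord m q → ℕ} (hK : Primrec K)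
    (hv : ∀ j, Primrec fun a => v a j) : Primrec fun a => pointCode (K a) (v a) :=
  Primrec.pair (primrec_pi fun _ => primrec_cast_sub_cast (hv _) hK)
    (Primrec.pair (primrec_pi fun _ => primrec_natCast (hv _)) (primrec_natCast (hv _)))

/-- The digit with number `e` of the last entry, in the base given by `planBound`. -/
def digit (M : ℕ) (z : InstanceCode m q × ℕ × ℕ) (e : ℕ) : ℕ :=
  z.2.2 / planBound z.1 M z.2.1 ^ e % planBound z.1 M z.2.1

@[fun_prop]
theorem primrec_digit {f : γ → InstanceCode m q × ℕ × ℕ} {g : γ → ℕ} (M : ℕ) (hf : Primrec f)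
    (hg : Primrec g) : Primrec fun a => digit M (f a) (g a) := by
  unfold digit
  fun_prop

/-- The place of the digit of kind `k` that belongs to the coordinate `j` of the object `t`. -/
def slot (k t : ℕ) (j : Coord m q) : ℕ :=
  -- Five kinds are interleaved: `0`, `1`, `2` for lower corner, multiples and unit of a box, `3`,
  -- `4` for position and box number of an item. Kinds `2` and `4` are read only at `heightCoord`.
  5 * (t * Fintype.card (Coord m q) + Fintype.equivFin (Coord m q) j) + k

@[fun_prop]
theorem primrec_slot {g : γ → ℕ} (k : ℕ) (j : Coord m q) (hg : Primrec g) :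
    Primrec fun a => slot k (g a) j := by
  unfold slot
  fun_prop

/-- The coordinate of the height. -/
abbrev heightCoord : Coord m q := .inr (.inr ())

/-- The map from kind, object and coordinate to a place is undone by division with remainder, so
prescribed values below the base can be written into one number. -/
theorem exists_digit_eq (X : InstanceCode m q) (M h T : ℕ) (f : ℕ → ℕ → Coord m q → ℕ)
    (hf : ∀ k t j, f k t j < planBound X M h) :
    ∃ y < planBound X M h ^ (5 * (T * Fintype.card (Coord m q))),
      ∀ k < 5, ∀ t < T, ∀ j, digit M (X, h, y) (slot k t j) = f k t j := by
  set d := Fintype.card (Coord m q) with hd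
  have hd0 : 0 < d := Fintype.card_pos_iff.2 ⟨heightCoord⟩
  obtain ⟨y, hy, hdig⟩ := exists_digits (planBound X M h) (5 * (T * d))
    (fun e => f (e % 5) (e / 5 / d) ((Fintype.equivFin (Coord m q)).symm
      ⟨e / 5 % d, Nat.mod_lt _ hd0⟩)) fun e _ => hf _ _ _
  refine ⟨y, hy, fun k hk t ht j => ?_⟩
  have hj : (Fintype.equivFin (Coord m q) j : ℕ) < d := (Fintype.equivFin (Coord m q) j).2
  have hlt : slot k t j < 5 * (T * d) := by
    have : (t + 1) * d ≤ T * d := Nat.mul_le_mul_right _ ht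
    rw [add_mul] at this
    simp only [slot, ← hd]
    omega
  have h1 : slot k t j % 5 = k := by
    simp only [slot]
    omega
  have h2 : slot k t j / 5 = t * d + Fintype.equivFin (Coord m q) j := by
    simp only [slot, ← hd]
    omega
  have h3 : slot k t j / 5 / d = t := by
    rw [h2, mul_comm, Nat.mul_add_div hd0, Nat.div_eq_of_lt hj, add_zero]
  have h4 : slot k t j / 5 % d = Fintype.equivFin (Coord m q) j := by
    rw [h2, mul_comm, Nat.mul_add_mod, Nat.mod_eq_of_lt hj]
  refine (hdig _ hlt).trans ?_
  simp only [h1, h3, h4, Fin.eta, Equiv.symm_apply_apply]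

/-- The number of boxes, according to the digits of the last entry. -/
def numBoxes (M : ℕ) (z : InstanceCode m q × ℕ × ℕ) : ℕ :=
  -- Stored where the box number of one further item would stand, just past the last item.
  digit M z (slot 4 z.1.2.1.length (heightCoord : Coord m q))

@[fun_prop]
theorem primrec_numBoxes (M : ℕ) : Primrec (numBoxes M : InstanceCode m q × ℕ × ℕ → ℕ) := by
  unfold numBoxes
  fun_prop

/-- The digits of the last entry describe an integral packing. -/
def CodesPlan (M : ℕ) (z : InstanceCode m q × ℕ × ℕ) : Prop :=
  IsPlan z.1 M z.2.1 (numBoxes M z) (fun t j => digit M z (slot 0 t j))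
    (fun t j => digit M z (slot 1 t j)) (fun t => digit M z (slot 2 t (heightCoord : Coord m q)))
    (fun t j => digit M z (slot 3 t j)) (fun t => digit M z (slot 4 t (heightCoord : Coord m q)))

theorem digit_lt (M : ℕ) (z : InstanceCode m q × ℕ × ℕ) (e : ℕ) :
    digit M z e < planBound z.1 M z.2.1 :=
  Nat.mod_lt _ (by simp only [planBound]; omega)

/-- A quantifier over integral vectors in a box becomes a bounded quantifier over one number whose
digits in base `W` are the coordinates. In this form it is primitive recursive. -/
theorem forall_box_iff {W : ℕ} {a b : Fin m → ℕ} (hb : ∀ j, b j ≤ W) {P : (Fin m → ℕ) → Prop} :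
    (∀ u : Fin m → ℕ, (∀ j, a j ≤ u j ∧ u j < b j) → P u) ↔
      ∀ w < W ^ m, (∀ j : Fin m, a j ≤ w / W ^ (j : ℕ) % W ∧ w / W ^ (j : ℕ) % W < b j) →
        P fun j => w / W ^ (j : ℕ) % W := by
  refine ⟨fun H w _ hw => H _ hw, fun H u hu => ?_⟩
  obtain ⟨w, hw, hd⟩ := exists_digits W m (fun e => if he : e < m then u ⟨e, he⟩ else 0)
    fun e he => by
      rw [dif_pos he]
      exact (hu _).2.trans_le (hb _)
  have hwu : (fun j : Fin m => w / W ^ (j : ℕ) % W) = u := by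
    funext j
    rw [hd j j.2, dif_pos j.2]
  have := H w hw
  rw [hwu] at this
  exact this fun j => by
    rw [congrFun hwu j]
    exact hu j

/-- All quantifiers in the definition are bounded or range over fixed finite sets or lists. The only
exception is the vector `u`, which is bounded through `forall_box_iff` with base `R`. -/
theorem primrecPred_isPlan {X : γ → InstanceCode m q} (M : ℕ) {h L R : γ → ℕ}
    {lo c pos : Coord m q → γ × ℕ → ℕ} {σ bx : γ × ℕ → ℕ} (hX : Primrec X) (hh : Primrec h)
    (hL : Primrec L) (hR : Primrec R) (hlo : ∀ j, Primrec (lo j)) (hc : ∀ j, Primrec (c j))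
    (hpos : ∀ j, Primrec (pos j)) (hσ : Primrec σ) (hbx : Primrec bx)
    (hle : ∀ p j, lo j p + c j p * σ p ≤ R p.1) :
    PrimrecPred fun a => IsPlan (X a) M (h a) (L a) (fun t j => lo j (a, t))
      (fun t j => c j (a, t)) (fun t => σ (a, t)) (fun t j => pos j (a, t))
      (fun t => bx (a, t)) := by
  have f1 : PrimrecPred fun a => L a ≤ M := primrecPred_le (by fun_prop) (by fun_prop)
  have f2 : PrimrecPred fun a => ∀ t < L a, 0 < σ (a, t) ∧ ∀ j, 0 < c j (a, t) :=
    primrecPred_forall_lt hL ((primrecPred_lt (by fun_prop) (by fun_prop)).and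
      (primrecPred_forall fun j => primrecPred_lt (by fun_prop) (by fun_prop)))
  have f3a (j : Fin m) : PrimrecPred fun p : ((γ × ℕ) × ℕ) × (Fin m → ℕ) =>
      shiftedBdry (X p.1.1.1) j (p.2 j) ≤ p.1.2 / R p.1.1.1 ^ (j : ℕ) % R p.1.1.1 ∧
      p.1.2 / R p.1.1.1 ^ (j : ℕ) % R p.1.1.1 + 1 ≤ shiftedBdry (X p.1.1.1) j (p.2 j + 1) := by
    have hj : Primrec fun p : ((γ × ℕ) × ℕ) × (Fin m → ℕ) => p.2 j :=
      primrec_apply (by fun_prop) j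
    exact (primrecPred_le (by fun_prop) (by fun_prop)).and
      (primrecPred_le (by fun_prop) (by fun_prop))
  have f3b : PrimrecPred fun p : (γ × ℕ) × ℕ =>
      (∀ j : Fin m, lo (.inl j) p.1 ≤ p.2 / R p.1.1 ^ (j : ℕ) % R p.1.1 ∧
        p.2 / R p.1.1 ^ (j : ℕ) % R p.1.1 < lo (.inl j) p.1 + c (.inl j) p.1 * σ p.1) →
      ∃ a ∈ (X p.1.1).2.2.2.1, ∀ j : Fin m,
        shiftedBdry (X p.1.1) j (a j) ≤ p.2 / R p.1.1 ^ (j : ℕ) % R p.1.1 ∧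
        p.2 / R p.1.1 ^ (j : ℕ) % R p.1.1 + 1 ≤ shiftedBdry (X p.1.1) j (a j + 1) :=
    primrecPred_imp (primrecPred_forall fun j => (primrecPred_le (by fun_prop) (by fun_prop)).and
      (primrecPred_lt (by fun_prop) (by fun_prop)))
      (primrecPred_exists_mem (by fun_prop) (primrecPred_forall f3a))
  have f3 : PrimrecPred fun a => ∀ t < L a, ∀ u : Fin m → ℕ,
      (∀ j, lo (.inl j) (a, t) ≤ u j ∧ u j < lo (.inl j) (a, t) + c (.inl j) (a, t) * σ (a, t)) →
      ∃ z ∈ (X a).2.2.2.1, ∀ j, shiftedBdry (X a) j (z j) ≤ u j ∧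
        u j + 1 ≤ shiftedBdry (X a) j (z j + 1) := by
    refine primrecPred_forall_lt hL ?_
    refine (primrecPred_forall_lt (f := fun p : γ × ℕ => R p.1 ^ m) (P := fun p w =>
      (∀ j : Fin m, lo (.inl j) p ≤ w / R p.1 ^ (j : ℕ) % R p.1 ∧
        w / R p.1 ^ (j : ℕ) % R p.1 < lo (.inl j) p + c (.inl j) p * σ p) →
      ∃ a ∈ (X p.1).2.2.2.1, ∀ j : Fin m,
        shiftedBdry (X p.1) j (a j) ≤ w / R p.1 ^ (j : ℕ) % R p.1 ∧
        w / R p.1 ^ (j : ℕ) % R p.1 + 1 ≤ shiftedBdry (X p.1) j (a j + 1))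
      (by fun_prop) f3b).of_eq fun p => ?_
    exact (forall_box_iff (W := R p.1) (a := fun j => lo (.inl j) p)
      (b := fun j => lo (.inl j) p + c (.inl j) p * σ p) (P := fun u =>
      ∃ z ∈ (X p.1).2.2.2.1, ∀ j, shiftedBdry (X p.1) j (z j) ≤ u j ∧
        u j + 1 ≤ shiftedBdry (X p.1) j (z j + 1)) fun j => hle p _).symm
  have f4 : PrimrecPred fun a => ∀ t < L a, ∀ j : Fin q, ∃ i < (X a).2.1.length,
      lo (.inr (.inl j)) (a, t) + c (.inr (.inl j)) (a, t) * σ (a, t) ≤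
        (X a).2.2.2.2 j + sizeNum (X a) i := by
    refine primrecPred_forall_lt hL (primrecPred_forall fun j =>
      primrecPred_exists_lt (by fun_prop) ?_)
    have hj : Primrec fun p : (γ × ℕ) × ℕ => (X p.1.1).2.2.2.2 j :=
      primrec_apply (f := fun p : (γ × ℕ) × ℕ => (X p.1.1).2.2.2.2) (by fun_prop) j
    exact primrecPred_le (by fun_prop) (by fun_prop)
  have f5 : PrimrecPred fun a => ∀ t < L a, lo (.inr (.inr ())) (a, t) +
      c (.inr (.inr ())) (a, t) * σ (a, t) ≤ h a :=
    primrecPred_forall_lt hL (primrecPred_le (by fun_prop) (by fun_prop))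
  have f6 : PrimrecPred fun a => ∀ t < L a, ∀ t' < L a, t < t' →
      ∃ j, lo j (a, t) + c j (a, t) * σ (a, t) ≤ lo j (a, t') ∨
        lo j (a, t') + c j (a, t') * σ (a, t') ≤ lo j (a, t) :=
    primrecPred_forall_lt hL (primrecPred_forall_lt (by fun_prop) (primrecPred_imp
      (primrecPred_lt (by fun_prop) (by fun_prop)) (primrecPred_exists fun j =>
        (primrecPred_le (by fun_prop) (by fun_prop)).or
          (primrecPred_le (by fun_prop) (by fun_prop)))))
  have f7 : PrimrecPred fun a => ∀ i < (X a).2.1.length, bx (a, i) < L a ∧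
      sizeNum (X a) i ≤ σ (a, bx (a, i)) ∧ ∀ j, lo j (a, bx (a, i)) ≤ pos j (a, i) ∧
        pos j (a, i) + sizeNum (X a) i ≤
          lo j (a, bx (a, i)) + c j (a, bx (a, i)) * σ (a, bx (a, i)) :=
    primrecPred_forall_lt (by fun_prop) ((primrecPred_lt (by fun_prop) (by fun_prop)).and
      ((primrecPred_le (by fun_prop) (by fun_prop)).and (primrecPred_forall fun j =>
        (primrecPred_le (by fun_prop) (by fun_prop)).and
          (primrecPred_le (by fun_prop) (by fun_prop)))))
  have f8 : PrimrecPred fun a => ∀ i < (X a).2.1.length, ∀ i' < (X a).2.1.length, i ≠ i' →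
      ∃ j, pos j (a, i) + sizeNum (X a) i ≤ pos j (a, i') ∨
        pos j (a, i') + sizeNum (X a) i' ≤ pos j (a, i) :=
    primrecPred_forall_lt (by fun_prop) (primrecPred_forall_lt (by fun_prop) (primrecPred_imp
      (primrecPred_eq (by fun_prop) (by fun_prop)).not (primrecPred_exists fun j =>
        (primrecPred_le (by fun_prop) (by fun_prop)).or
          (primrecPred_le (by fun_prop) (by fun_prop)))))
  have hsum (f : γ × ℕ → ℕ) (hf : Primrec f) : Primrec fun p : γ × ℕ =>
      ∑ i ∈ Finset.range (X p.1).2.1.length, if bx (p.1, i) = p.2 then f (p.1, i) else 0 :=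
    primrec_sum_range (g := fun (p : γ × ℕ) (i : ℕ) => if bx (p.1, i) = p.2 then f (p.1, i) else 0) (by fun_prop)
      (Primrec.ite (primrecPred_eq (by fun_prop) (by fun_prop)) (by fun_prop) (by fun_prop))
  have f9 : PrimrecPred fun a => ∀ t < L a,
      (∑ i ∈ Finset.range (X a).2.1.length, if bx (a, i) = t then 1 else 0) ≤ ∏ j, c j (a, t) ∨
      (∑ i ∈ Finset.range (X a).2.1.length,
        if bx (a, i) = t then sizeNum (X a) i ^ Fintype.card (Coord m q) else 0) +
        σ (a, t) * ∑ j, ∏ j' ∈ Finset.univ.erase j, c j' (a, t) * σ (a, t) ≤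
          ∏ j, c j (a, t) * σ (a, t) := by
    have h1 := hsum (fun _ => 1) (by fun_prop)
    have h2 := hsum (fun p => sizeNum (X p.1) p.2 ^ Fintype.card (Coord m q)) (by fun_prop)
    have h3 : Primrec fun p : γ × ℕ => ∏ j, c j (p.1, p.2) :=
      primrec_finset_prod _ fun j => by fun_prop
    have h4 : Primrec fun p : γ × ℕ => ∏ j, c j (p.1, p.2) * σ (p.1, p.2) :=
      primrec_finset_prod _ fun j => by fun_prop
    have h5 : Primrec fun p : γ × ℕ =>
        ∑ j, ∏ j' ∈ Finset.univ.erase j, c j' (p.1, p.2) * σ (p.1, p.2) :=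
      primrec_finset_sum _ fun j => primrec_finset_prod _ fun j' => by fun_prop
    exact primrecPred_forall_lt hL ((primrecPred_le h1 h3).or
      (primrecPred_le (primrec_add h2 (primrec_mul (by fun_prop) h5)) h4))
  exact (f1.and (f2.and (f3.and (f4.and (f5.and (f6.and (f7.and (f8.and f9)))))))).of_eq fun a =>
    ⟨fun ⟨h1, h2, h3, h4, h5, h6, h7, h8, h9⟩ => ⟨h1, h2, h3, h4, h5, h6, h7, h8, h9⟩,
      fun ⟨h1, h2, h3, h4, h5, h6, h7, h8, h9⟩ => ⟨h1, h2, h3, h4, h5, h6, h7, h8, h9⟩⟩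

theorem primrecPred_codesPlan (M : ℕ) :
    PrimrecPred (CodesPlan M : InstanceCode m q × ℕ × ℕ → Prop) := by
  refine primrecPred_isPlan (γ := InstanceCode m q × ℕ × ℕ) M (X := fun z => z.1)
    (h := fun z => z.2.1) (L := numBoxes M)
    -- All digits are below `planBound`, so `lo + c * σ` stays within the base plus its square.
    (R := fun z => planBound z.1 M z.2.1 + planBound z.1 M z.2.1 * planBound z.1 M z.2.1)
    (lo := fun j p => digit M p.1 (slot 0 p.2 j)) (c := fun j p => digit M p.1 (slot 1 p.2 j))
    (σ := fun p => digit M p.1 (slot 2 p.2 (heightCoord : Coord m q)))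
    (pos := fun j p => digit M p.1 (slot 3 p.2 j))
    (bx := fun p => digit M p.1 (slot 4 p.2 (heightCoord : Coord m q)))
    (by fun_prop) (by fun_prop) (by fun_prop) (by fun_prop) (fun j => by fun_prop)
    (fun j => by fun_prop) (fun j => by fun_prop) (by fun_prop) (by fun_prop) fun p j =>
    add_le_add (digit_lt _ _ _).le (Nat.mul_le_mul (digit_lt _ _ _).le (digit_lt _ _ _).le)

/-- The packing that is described by the digits of the last entry. -/
def outCode (M : ℕ) (z : InstanceCode m q × ℕ × ℕ) : PackingCode m q :=
  planCode z.1 z.2.1 (numBoxes M z) (fun t j => digit M z (slot 0 t j))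
    (fun t j => digit M z (slot 1 t j)) (fun t => digit M z (slot 2 t (heightCoord : Coord m q)))
    (fun t j => digit M z (slot 3 t j)) (fun t => digit M z (slot 4 t (heightCoord : Coord m q)))

theorem primrec_outCode (M : ℕ) :
    Primrec (outCode M : InstanceCode m q × ℕ × ℕ → PackingCode m q) := by
  unfold outCode planCode
  have h1 : Primrec fun p : (InstanceCode m q × ℕ × ℕ) × ℕ =>
      pointCode (gridBound p.1.1) fun j : Coord m q => digit M p.1 (slot 0 p.2 j) :=
    primrec_pointCode (by fun_prop) fun j => by fun_prop
  have h2 : Primrec fun p : (InstanceCode m q × ℕ × ℕ) × ℕ =>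
      pointCode 0 fun j : Coord m q => digit M p.1 (slot 1 p.2 j) *
        digit M p.1 (slot 2 p.2 (heightCoord : Coord m q)) :=
    primrec_pointCode (by fun_prop) fun j => by fun_prop
  have h3 : Primrec fun p : (InstanceCode m q × ℕ × ℕ) × ℕ =>
      pointCode (gridBound p.1.1) fun j : Coord m q => digit M p.1 (slot 3 p.2 j) :=
    primrec_pointCode (by fun_prop) fun j => by fun_prop
  have h4 : Primrec fun p : (InstanceCode m q × ℕ × ℕ) × ℕ =>
      digit M p.1 (slot 4 p.2 (heightCoord : Coord m q)) := by fun_prop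
  have h5 : Primrec fun z : InstanceCode m q × ℕ × ℕ => List.range (numBoxes M z) :=
    Primrec.list_range.comp (by fun_prop)
  have h6 : Primrec fun z : InstanceCode m q × ℕ × ℕ => List.range z.1.2.1.length :=
    Primrec.list_range.comp (by fun_prop)
  have h7 := Primrec.list_map h5 (Primrec.pair h1 h2).to₂
  have h8 := Primrec.list_map h6 (Primrec.pair h4 h3).to₂
  have h9 : Primrec fun z : InstanceCode m q × ℕ × ℕ => z.1.1 := by fun_prop
  have h10 : Primrec fun z : InstanceCode m q × ℕ × ℕ => z.2.1 := by fun_prop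
  exact h9.pair (h10.pair (h7.pair h8))

theorem Boxable.nonneg {I : StripInstance m q} {h : ℝ} {M : ℕ} (H : Boxable I Finset.univ h M)
    (hn : 0 < I.n) : 0 ≤ h := by
  obtain ⟨ι, _, box, R, -, hhold, -, hgood, hcov⟩ := H 0
  obtain ⟨t, -⟩ := hcov ⟨0, hn⟩ (Finset.mem_univ _)
  have h1 := (hhold t).bot
  have h2 := (hhold t).top
  have h3 := (hgood t).side_pos (.inr (.inr ()))
  linarith

/-- There is an algorithm that packs the items of every rational admissible instance into good
boxes, with a height at most that of any packing into at most `M` good boxes at real positions. -/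
theorem exists_partrec_packing (m q M N : ℕ) (α : ℝ) :
    ∃ alg : InstanceCode m q →. PackingCode m q, Partrec alg ∧
      ∀ (X : InstanceCode m q) (H : ℝ), (decodeInstance X).IsAdmissible N α →
        Boxable (decodeInstance X) Finset.univ H M →
        ∃ Y ∈ alg X, IsValidFor (decodeInstance X) (decodePacking _ Y) ∧
          (decodePacking (decodeInstance X).n Y).boxes.length ≤ M ∧
          (decodePacking (decodeInstance X).n Y).height ≤ H := by
  have hB : Primrec fun p : InstanceCode m q × ℕ => planBound p.1 M p.2 ^
      (5 * ((p.1.2.1.length + M + 1) * Fintype.card (Coord m q))) := by fun_prop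
  obtain ⟨alg, halg, hmin⟩ := exists_partrec_minimal (primrecPred_codesPlan M) hB
    (primrec_outCode M)
  refine ⟨alg, halg, fun X H hI HB => ?_⟩
  have hH : 0 ≤ H := HB.nonneg hI.nonempty
  obtain ⟨L, lo, c, σ, pos, bx, hplan, hb1, hb2, hLB⟩ := HB.exists_isPlan hI
  set h₀ := ⌊H * ((X.1 : ℝ) + 1)⌋₊
  set n := X.2.1.length with hn
  -- `n + M + 1` objects leave room for the `n` items, for the at most `M` boxes, and for the number
  -- of boxes at place `n`.
  obtain ⟨y, hy, hdig⟩ := exists_digit_eq X M h₀ (n + M + 1) (fun k t j => match k with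
    | 0 => lo t j
    | 1 => c t j
    | 2 => σ t
    | 3 => pos t j
    | _ => if t < n then bx t else L) (by
      intro k t j
      obtain ⟨h1, h2, h3⟩ := hb1 t j
      obtain ⟨h4, h5⟩ := hb2 t
      split
      · exact h1
      · exact h2
      · exact h4
      · exact h3
      · split_ifs
        · exact h5
        · exact hLB)
  have hL : numBoxes M (X, h₀, y) = L := by
    refine (hdig 4 (by norm_num) n (by omega) heightCoord).trans ?_
    simp
  have hLM := hplan.length_le
  have hcodes : CodesPlan M (X, h₀, y) := by
    unfold CodesPlan
    rw [hL]
    refine hplan.congr (fun t ht => ?_) (fun t ht => ?_) (fun t ht => ?_) (fun i hi => ?_)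
      fun i hi => ?_
    · exact funext fun j => hdig 0 (by norm_num) t (by omega) j
    · exact funext fun j => hdig 1 (by norm_num) t (by omega) j
    · exact hdig 2 (by norm_num) t (by omega) _
    · exact funext fun j => hdig 3 (by norm_num) i (by omega) j
    · exact (hdig 4 (by norm_num) i (by omega) _).trans (if_pos hi)
  -- The search does not know `H`: minimality alone puts its height at or below `h₀`, hence below
  -- `H` after division by the denominator.
  obtain ⟨h, y', hle, hchk, hmem⟩ := hmin X h₀ ⟨y, hy, hcodes⟩
  obtain ⟨hvalid, hlen, hheight⟩ := IsPlan.isValidFor hchk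
  refine ⟨_, hmem, hvalid, hlen, ?_⟩
  have hD : (0 : ℝ) < (X.1 : ℝ) + 1 := by positivity
  have h1 : (h : ℝ) ≤ H * ((X.1 : ℝ) + 1) :=
    (Nat.cast_le.2 hle).trans (Nat.floor_le (by positivity))
  exact hheight.trans_le ((div_le_iff₀ hD).2 h1)

end Algorithm

end HypercubeStrip

end

theorem mainTheorem3 (k : ℕ) (hk : 1 ≤ k) :
    ∃ c : ℝ, ∀ d : ℕ, k < d → ∀ (N : ℕ) (α ε : ℝ), 1 ≤ N → 1 ≤ α → 0 < ε →
      ∃ (C : ℝ) (M : ℕ),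
        (∀ I : StripInstance (d - k) (k - 1), I.IsAdmissible N α →
          ∃ P : BoxedPacking (d - k) (k - 1) I.n, IsGoodPacking I (c * ε) C M P) ∧
        (∃ alg : InstanceCode (d - k) (k - 1) →. PackingCode (d - k) (k - 1),
          Partrec alg ∧
          ∀ X : InstanceCode (d - k) (k - 1), (decodeInstance X).IsAdmissible N α →
            ∃ Y ∈ alg X,
              IsGoodPacking (decodeInstance X) (c * ε) C M (decodePacking _ Y)) := by
  -- The constant `c = 1` suffices for every `k`, since the error budget was scaled to total at most
  -- `ε`.
  refine ⟨1, fun d _ N α ε hN hα hε => ?_⟩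
  obtain ⟨C, M, hbox⟩ := exists_boxable (d - k) (k - 1) N α ε hN hα hε
  obtain ⟨alg, halg, hpack⟩ := exists_partrec_packing (d - k) (k - 1) M N α
  refine ⟨C, M, fun I hI => ?_, alg, halg, fun X hX => ?_⟩
  · obtain ⟨P, hP, hM, hh⟩ := (hbox I hI).exists_isValidFor hI.size_pos
    exact ⟨P, hP, hM, by rw [hh, one_mul]⟩
  · obtain ⟨Y, hY, hP, hM, hh⟩ := hpack X _ hX (hbox _ hX)
    exact ⟨Y, hY, hP, hM, by rwa [one_mul]⟩
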